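/- Let $n\ge 1$ and $k\ge 1$ be integers, let $\alpha>0$, $s>n/2$, $v\in\mathbb R^n$ and $\mu\in\mathbb C$ (the signs $\pm$ are $\mu=\pm1$), and consider $$ i\partial_t u+t^{\alpha}\Delta u+i\,t^{\alpha}\,v\cdot\nabla u=\mu\,u|u|^{2k},\qquad u(0,\cdot)=u_0, \qquad (*)$$ on $\mathbb R^n$; the case $v=0$ is $b\equiv0$, and $v\ne 0$ is $b=ct^\alpha$ with the imaginary vector $c=iv$. Let $W_\alpha(t,\tau)=\exp\!\big(i\tfrac{t^{\alpha+1}-\tau^{\alpha+1}}{\alpha+1}(\Delta+iv\cdot\nabla)\big)$, a unitary Fourier multiplier on $L^2(\mathbb R^n)$. By a solution $u\in C([0,T],H^s(\mathbb R^n))$ of $(*)$ we mean a solution of $$u(t)=W_\alpha(t,0)u_0-i\mu\int_0^tW_\alpha(t,\tau)\big(u|u|^{2k}\big)(\tau)\,d\tau,\qquad 0\le t\le T .$$ Let $D^\sigma$ be the Fourier multiplier with symbol $|\xi|^\sigma$. Put $|\!|\!|g|\!|\!|_T=\|g\|_{L^\infty_x(\mathbb R)L^2_t([0,T])}$ if $n=1$,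 and $|\!|\!|g|\!|\!|_T=\sup_{\beta\in\mathbb Z^n}\|g\|_{L^2_x(Q_\beta)L^2_t([0,T])}$ with $Q_\beta=\beta+[0,1)^n$ if $n\ge2$. Then $(*)$ is locally well-posed in $H^s(\mathbb R^n)$, and its solutions satisfy the smoothing estimates of the linear equation. More precisely, there is a constant $C>0$, depending only on $n,\alpha,v,k,\mu,s$, such that for every ball $B\subset H^s(\mathbb R^n)$ there is $T>0$ for which the following hold. 1. The space $X=\{u\in C([0,T],H^s(\mathbb R^n)):\ |\!|\!|t^{\alpha/2}D^{s+1/2}u|\!|\!|_T<\infty\}$ with the norm $\|u\|_X=\sup_{0\le t\le T}\|u(t)\|_{H^s}+|\!|\!|t^{\alpha/2}D^{s+1/2}u|\!|\!|_T$ is a Banach space. 2. For every $u_0\in B$ there is a unique solution $u\in X$ of $(*)$ on $[0,T]$. 3. The map $u_0\mapsto u$ is continuous from $B$ (with the $H^s$ norm) to $C([0,T],H^s(\mathbb R^n))$. 4. For every $u_0\in B$ the solution satisfies $$|\!|\!|t^{\alpha/2}D^{s+1/2}u|\!|\!|_T\le C\|u_0\|_{H^s},\qquad |\!|\!|t^{\alpha/2}D^{1/2}u|\!|\!|_T\le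 C\|u_0\|_{L^2}.$$ -/

import Mathlib

open MeasureTheory FourierTransform SchwartzMap
open scoped ENNReal

noncomputable section

namespace DegenerateNLS

/-- The space `ℝⁿ` with its Euclidean norm. -/
abbrev E (n : ℕ) : Type := EuclideanSpace ℝ (Fin n)

/-- Complex valued `L²(ℝⁿ)`. Mathlib's Fourier transform `𝓕` is unitary on it; its kernel is
`exp (-2πi x·ξ)`, so that `ξ` stands for the angular frequency `2πξ`. -/
abbrev L2 (n : ℕ) : Type := Lp ℂ 2 (volume : Measure (E n))

/-- The symbol `⟨2πξ⟩ ^ s = (1 + |2πξ|²) ^ (s / 2)` of `Λ ^ s = (1 - Δ) ^ (s / 2)`. -/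
def japanese (n : ℕ) (s : ℝ) (ξ : E n) : ℝ := (1 + (2 * Real.pi * ‖ξ‖) ^ 2) ^ (s / 2)

/-- The functions in `L²(ℝⁿ)` which belong to `H^s(ℝⁿ)` (for `s ≥ 0`). -/
def sobolevSubmodule (n : ℕ) (s : ℝ) : Submodule ℂ (L2 n) where
  carrier := {f | MemLp (fun ξ => (japanese n s ξ : ℂ) * (𝓕 f : L2 n) ξ) 2 volume}
  zero_mem' := by
    have h0 : (𝓕 (0 : L2 n) : L2 n) = 0 := map_zero (Lp.fourierTransformₗᵢ (E n) ℂ)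
    have h : (fun ξ => (japanese n s ξ : ℂ) * (𝓕 (0 : L2 n) : L2 n) ξ) =ᵐ[volume]
        (fun _ => (0 : ℂ)) := by
      rw [h0]
      filter_upwards [Lp.coeFn_zero ℂ 2 (volume : Measure (E n))] with ξ hξ
      rw [hξ, Pi.zero_apply, mul_zero]
    exact (memLp_congr_ae h).mpr MemLp.zero'
  add_mem' := by
    intro f g hf hg
    have h0 : (𝓕 (f + g) : L2 n) = 𝓕 f + 𝓕 g := map_add (Lp.fourierTransformₗᵢ (E n) ℂ) f g
    have h : (fun ξ => (japanese n s ξ : ℂ) * (𝓕 (f + g) : L2 n) ξ) =ᵐ[volume]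
        ((fun ξ => (japanese n s ξ : ℂ) * (𝓕 f : L2 n) ξ) +
          (fun ξ => (japanese n s ξ : ℂ) * (𝓕 g : L2 n) ξ)) := by
      rw [h0]
      filter_upwards [Lp.coeFn_add (𝓕 f : L2 n) (𝓕 g : L2 n)] with ξ hξ
      rw [hξ, Pi.add_apply, Pi.add_apply, mul_add]
    exact (memLp_congr_ae h).mpr (MemLp.add hf hg)
  smul_mem' := by
    intro c f hf
    have h0 : (𝓕 (c • f) : L2 n) = c • 𝓕 f := map_smul (Lp.fourierTransformₗᵢ (E n) ℂ) c f
    have h : (fun ξ => (japanese n s ξ : ℂ) * (𝓕 (c • f) : L2 n) ξ) =ᵐ[volume]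
        (c • (fun ξ => (japanese n s ξ : ℂ) * (𝓕 f : L2 n) ξ)) := by
      rw [h0]
      filter_upwards [Lp.coeFn_smul c (𝓕 f : L2 n)] with ξ hξ
      rw [hξ, Pi.smul_apply, Pi.smul_apply, smul_eq_mul, smul_eq_mul, mul_left_comm]
    exact (memLp_congr_ae h).mpr (MemLp.const_smul hf c)

/-- The Sobolev space `H^s(ℝⁿ)`, for `s ≥ 0`, as a type of its own: it does not carry the norm of
`L²` but the norm defined below. -/
def Hs (n : ℕ) (s : ℝ) : Type := ↥(sobolevSubmodule n s)

instance (n : ℕ) (s : ℝ) : AddCommGroup (Hs n s) :=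
  inferInstanceAs (AddCommGroup ↥(sobolevSubmodule n s))

instance (n : ℕ) (s : ℝ) : Module ℂ (Hs n s) :=
  inferInstanceAs (Module ℂ ↥(sobolevSubmodule n s))

/-- The inclusion of `H^s` in `L²`. -/
def Hs.toL2 (n : ℕ) (s : ℝ) : Hs n s →ₗ[ℂ] L2 n := (sobolevSubmodule n s).subtype

theorem Hs.memLp {n : ℕ} {s : ℝ} (f : Hs n s) :
    MemLp (fun ξ => (japanese n s ξ : ℂ) * (𝓕 (Hs.toL2 n s f) : L2 n) ξ) 2 volume := f.2

/-- The linear map `f ↦ ⟨2πξ⟩ ^ s 𝓕 f` from `H^s` to `L²`. -/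
def Hs.weighted (n : ℕ) (s : ℝ) : Hs n s →ₗ[ℂ] L2 n where
  toFun f := MemLp.toLp (fun ξ => (japanese n s ξ : ℂ) * (𝓕 (Hs.toL2 n s f) : L2 n) ξ) f.memLp
  map_add' := by
    intro f g
    have h0 : (𝓕 (Hs.toL2 n s (f + g)) : L2 n) = 𝓕 (Hs.toL2 n s f) + 𝓕 (Hs.toL2 n s g) := by
      rw [map_add]
      exact map_add (Lp.fourierTransformₗᵢ (E n) ℂ) _ _
    refine Eq.trans (MemLp.toLp_congr _ (f.memLp.add g.memLp) ?_)
      (MemLp.toLp_add f.memLp g.memLp)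
    rw [h0]
    filter_upwards [Lp.coeFn_add (𝓕 (Hs.toL2 n s f) : L2 n) (𝓕 (Hs.toL2 n s g) : L2 n)] with ξ hξ
    rw [hξ, Pi.add_apply, Pi.add_apply, mul_add]
  map_smul' := by
    intro c f
    have h0 : (𝓕 (Hs.toL2 n s (c • f)) : L2 n) = c • 𝓕 (Hs.toL2 n s f) := by
      rw [map_smul]
      exact map_smul (Lp.fourierTransformₗᵢ (E n) ℂ) c _
    refine Eq.trans (MemLp.toLp_congr _ (f.memLp.const_smul c) ?_)
      (MemLp.toLp_const_smul c f.memLp)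
    rw [h0]
    filter_upwards [Lp.coeFn_smul c (𝓕 (Hs.toL2 n s f) : L2 n)] with ξ hξ
    rw [hξ, Pi.smul_apply, Pi.smul_apply, smul_eq_mul, smul_eq_mul, mul_left_comm]

theorem japanese_pos (n : ℕ) (s : ℝ) (ξ : E n) : 0 < japanese n s ξ :=
  Real.rpow_pos_of_pos (by positivity) _

theorem Hs.weighted_injective (n : ℕ) (s : ℝ) : Function.Injective (Hs.weighted n s) := by
  rw [← LinearMap.ker_eq_bot, LinearMap.ker_eq_bot']
  intro f hf
  have h1 : (fun ξ => (japanese n s ξ : ℂ) * (𝓕 (Hs.toL2 n s f) : L2 n) ξ) =ᵐ[volume]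
      (fun _ => (0 : ℂ)) := by
    have h2 := MemLp.coeFn_toLp f.memLp
    have h3 : ((Hs.weighted n s f : L2 n) : E n → ℂ) =ᵐ[volume] 0 := by
      rw [hf]
      exact Lp.coeFn_zero ℂ 2 (volume : Measure (E n))
    exact h2.symm.trans h3
  have h4 : (𝓕 (Hs.toL2 n s f) : L2 n) = 0 := by
    rw [Lp.eq_zero_iff_ae_eq_zero]
    filter_upwards [h1] with ξ hξ
    have := (japanese_pos n s ξ).ne'
    simpa [this] using hξ
  have h5 : Hs.toL2 n s f = 0 := by
    apply (Lp.fourierTransformₗᵢ (E n) ℂ).injective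
    rw [map_zero]
    exact h4
  exact Subtype.ext h5

/-- The norm of `H^s` is `‖f‖_{H^s} = ‖⟨2πξ⟩ ^ s 𝓕 f‖_{L²}`. -/
instance (n : ℕ) (s : ℝ) : NormedAddCommGroup (Hs n s) :=
  NormedAddCommGroup.induced (Hs n s) (L2 n) (Hs.weighted n s) (Hs.weighted_injective n s)

instance (n : ℕ) (s : ℝ) : NormedSpace ℂ (Hs n s) :=
  NormedSpace.induced ℂ (Hs n s) (L2 n) (Hs.weighted n s)

/-- The space `C([0,T], H^s(ℝⁿ))`; its norm is the supremum norm. -/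
abbrev CHs (n : ℕ) (s T : ℝ) : Type := C(Set.Icc (0 : ℝ) T, Hs n s)

/-- The symbol of the solution operator of `i ∂ₜu + t^α Δu + i t^α v·∇u = 0` from time `τ` to
time `t`, that is, of
`exp (i (t^(α+1) - τ^(α+1)) / (α+1) (Δ + i v·∇))`, at the angular frequency `2πξ`. -/
def propSymbol (n : ℕ) (α : ℝ) (v : E n) (t τ : ℝ) (ξ : E n) : ℂ :=
  Complex.exp (((-((t ^ (α + 1) - τ ^ (α + 1)) / (α + 1) *
    ((2 * Real.pi * ‖ξ‖) ^ 2 + 2 * Real.pi * inner ℝ v ξ)) : ℝ) : ℂ) * Complex.I)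

theorem memLp_propSymbol_mul (n : ℕ) (α : ℝ) (v : E n) (t τ : ℝ) (f : L2 n) :
    MemLp (fun ξ => propSymbol n α v t τ ξ * f ξ) 2 volume := by
  refine MemLp.of_le (Lp.memLp f) ?_ ?_
  · refine AEStronglyMeasurable.mul ?_ (Lp.aestronglyMeasurable f)
    unfold propSymbol
    exact Continuous.aestronglyMeasurable (by fun_prop)
  · refine Filter.Eventually.of_forall fun ξ => ?_
    rw [norm_mul, propSymbol, Complex.norm_exp_ofReal_mul_I, one_mul]

/-- The solution operator `W_α(t, τ)`, a Fourier multiplier on `L²(ℝⁿ)`. -/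
def W (n : ℕ) (α : ℝ) (v : E n) (t τ : ℝ) (f : L2 n) : L2 n :=
  𝓕⁻ ((memLp_propSymbol_mul n α v t τ (𝓕 f)).toLp : L2 n)

/-- `u` satisfies on `[0,T]` the integral equation
`u(t) = W(t,0) u₀ - i μ ∫₀ᵗ W(t,τ) (u |u|^{2k})(τ) dτ`
that belongs to `i ∂ₜu + t^α Δu + i t^α v·∇u = μ u |u|^{2k}`, `u(0) = u₀`.
The integral is an integral of `L²`-valued functions; it is part of the definition that
`u |u|^{2k}` takes its values in `L²` and that the integrand is integrable. -/
def IsMildSolution (n : ℕ) (α : ℝ) (v : E n) (k : ℕ) (μ : ℂ) (s T : ℝ)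
    (u₀ : Hs n s) (u : CHs n s T) : Prop :=
  ∃ G : ℝ → L2 n,
    (∀ τ : Set.Icc (0 : ℝ) T,
      (G τ : E n → ℂ) =ᵐ[volume]
        fun x => Hs.toL2 n s (u τ) x * ((‖Hs.toL2 n s (u τ) x‖ ^ (2 * k) : ℝ) : ℂ)) ∧
    ∀ t : Set.Icc (0 : ℝ) T,
      IntervalIntegrable (fun τ => W n α v t τ (G τ)) volume 0 (t : ℝ) ∧
      Hs.toL2 n s (u t) = W n α v t 0 (Hs.toL2 n s u₀) -
        (Complex.I * μ) • ∫ τ in (0 : ℝ)..t, W n α v t τ (G τ)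

/-- The function `g` represents the tempered distribution `D^σ h`, where `h ∈ L²`, `σ ≥ 0` and
`D^σ` is the Fourier multiplier with symbol `|2πξ| ^ σ`. -/
def IsFracDeriv (n : ℕ) (σ : ℝ) (h : L2 n) (g : E n → ℂ) : Prop :=
  ∀ φ : 𝓢(E n, ℂ), Integrable (fun x => g x * φ x) volume ∧
    ∫ x, g x * φ x =
      ∫ ξ, (((2 * Real.pi * ‖ξ‖) ^ σ : ℝ) : ℂ) * (𝓕 h : L2 n) ξ * (𝓕⁻ φ : 𝓢(E n, ℂ)) ξ

/-- The half-open unit cube with lower corner `β ∈ ℤⁿ`. -/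
def unitCube (n : ℕ) (β : Fin n → ℤ) : Set (E n) :=
  {x | ∀ i, (β i : ℝ) ≤ x i ∧ x i < β i + 1}

/-- The norm in `L²([0,T])` of `t ↦ t^{α/2} g(t,x)`, for fixed `x`. -/
def timeNorm (n : ℕ) (α T : ℝ) (g : ℝ → E n → ℂ) (x : E n) : ℝ≥0∞ :=
  (∫⁻ t in Set.Icc (0 : ℝ) T, ‖((t ^ (α / 2) : ℝ) : ℂ) * g t x‖ₑ ^ 2) ^ (1 / 2 : ℝ)

/-- The norm of `t^{α/2} g` in `L^∞_x L²_t([0,T])` if `n = 1`, and its norm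
`sup_β ‖ · ‖_{L²_x(Q_β) L²_t([0,T])}` over the unit cubes `Q_β` otherwise. -/
def localNorm (n : ℕ) (α T : ℝ) (g : ℝ → E n → ℂ) : ℝ≥0∞ :=
  if n = 1 then essSup (timeNorm n α T g) volume
  else ⨆ β : Fin n → ℤ, (∫⁻ x in unitCube n β, timeNorm n α T g x ^ 2) ^ (1 / 2 : ℝ)

/-- `g` is a jointly measurable function on `[0,T] × ℝⁿ` such that `g(t,·) = D^σ u(t)` for almost
every `t ∈ [0,T]`. -/
def Represents (n : ℕ) (s T σ : ℝ) (u : CHs n s T) (g : ℝ → E n → ℂ) : Prop :=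
  AEStronglyMeasurable (Function.uncurry g)
    (((volume : Measure ℝ).restrict (Set.Icc 0 T)).prod (volume : Measure (E n))) ∧
  ∀ᵐ t : ℝ, ∀ ht : t ∈ Set.Icc (0 : ℝ) T, IsFracDeriv n σ (Hs.toL2 n s (u ⟨t, ht⟩)) (g t)

/-- The local smoothing norm of `t^{α/2} D^σ u`; it is `∞` if `D^σ u` is not a function. (The
function `g` is unique up to null sets, so the infimum only selects it.) -/
def smoothingNorm (n : ℕ) (α s T σ : ℝ) (u : CHs n s T) : ℝ≥0∞ :=
  ⨅ (g : ℝ → E n → ℂ) (_ : Represents n s T σ u g), localNorm n α T g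

end DegenerateNLS

end

/-!
The time change `r = t^(α+1)/(α+1)` turns the equation into the Schrödinger equation with constant
coefficients, whose propagators form the unitary group `group hs v r` with phase
`p(ξ) = |2πξ|² + 2π v·ξ`; the weight `t^(α/2)` of the smoothing norm is the square root of the
Jacobian of that change.

**Well-posedness.** For `s > n/2` the space `H^s` is an algebra (`Hs.exists_mul`), since Young's
inequality bounds `‖a ⋆ b‖₂` by `‖a‖₁ ‖b‖₂` on the Fourier side. Hence the nonlinearity is locally
Lipschitz (`exists_nonlinearity`). In the interaction picture the integral equation becomes an
ordinary differential equation in `H^s` with a locally Lipschitz field, and the Picard–Lindelöf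
theorem gives the flow. On a short time interval the total mass of the nonlinearity is at most the
size of the datum, in `H^s` and in `L²` (`exists_flow`), so that the smoothing estimates follow from
those of the inhomogeneous linear equation. No smallness in the smoothing norm is needed, and
uniqueness holds among all continuous curves.

**Smoothing.** The square of the smoothing norm of a free wave is tested against a point mass in
`x` if `n = 1`, and against a unit cube otherwise. A cube, and the time interval, may be replaced by
Gaussian measures. The Gram kernel of the plane waves `exp (-i r p(ξ) + 2πi x·ξ)` is then
`exp (-c (p(ξ) - p(η))²)` times a Gaussian in `ξ - η` (times `1` if `n = 1`). By a `TT*` argument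
(`lintegral_sq_superposition_le`) the gain of half a derivative amounts to a Schur test with the
weight `1 + |η|`. It is enough to treat the weights `1 + |η_j|`: the Gaussian controls the
directions transversal to the `j`-th axis, and along that axis `1 + |η_j|` is dominated by the
derivative of the phase, away from a compact set (`exists_lintegral_kernel_le`). Minkowski's
inequality extends the estimate to Duhamel integrals (`exists_smoothingNorm_band_le`).

**From bounded to all frequencies.** For bounded frequencies `D^σ u` is a continuous function, given
by a Fourier integral. The smoothing norm is countably subadditive (`smoothingNorm_le_tsum`), because
it controls a weighted `L¹` norm at almost every time. The general estimate
(`exists_smoothingNorm_le`) is obtained from a decomposition into a ball and shells whose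
contributions are summable and, from the second one on, arbitrarily small. Subadditivity also yields
the completeness of the space of curves with finite smoothing norm
(`SmoothSpace.completeSpace`). The estimate in `L²` is the linear estimate at regularity zero.
-/


namespace DegenerateNLS

open Filter Topology

/-! ### The Fourier transform on `L¹ ∩ L²` -/

theorem continuous_neg_innerₗ {n : ℕ} :
    Continuous fun p : E n × E n => (-innerₗ (E n)) p.1 p.2 := by
  have h : Continuous fun p : E n × E n => -inner ℝ p.1 p.2 := by fun_prop
  simpa using h

theorem integral_fourierInv_mul_eq {n : ℕ} {a b : E n → ℂ} (ha : Integrable a)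
    (hb : Integrable b) : ∫ x, (𝓕⁻ a) x * b x = ∫ ξ, a ξ * (𝓕⁻ b) ξ := by
  have h := VectorFourier.integral_fourierIntegral_smul_eq_flip (e := Real.fourierChar)
    (L := -innerₗ (E n)) (μ := (volume : Measure (E n))) (ν := (volume : Measure (E n)))
    Real.continuous_fourierChar continuous_neg_innerₗ ha hb
  have hL : (-innerₗ (E n)).flip = -innerₗ (E n) := by
    ext x y; simp [real_inner_comm]
  rw [hL] at h
  exact h

/-- A locally integrable function is determined by its integrals against Schwartz functions. -/
theorem ae_eq_of_integral_mul_schwartz_eq {n : ℕ} {f g : E n → ℂ} (hf : LocallyIntegrable f)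
    (hg : LocallyIntegrable g) (h : ∀ φ : 𝓢(E n, ℂ), ∫ x, f x * φ x = ∫ x, g x * φ x) :
    f =ᵐ[volume] g := by
  refine ae_eq_of_integral_contDiff_smul_eq hf hg fun φ hφ hc => ?_
  have hg₁ : HasCompactSupport (Complex.ofRealCLM ∘ φ) := hc.comp_left rfl
  have hg₂ : ContDiff ℝ (⊤ : ℕ∞) (Complex.ofRealCLM ∘ φ) :=
    Complex.ofRealCLM.contDiff.comp hφ
  have := h (hg₁.toSchwartzMap hg₂)
  simpa [mul_comm] using this

theorem continuous_fourierInv_of_integrable {n : ℕ} {a : E n → ℂ} (ha : Integrable a) :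
    Continuous (𝓕⁻ a) :=
  VectorFourier.fourierIntegral_continuous Real.continuous_fourierChar
    continuous_neg_innerₗ ha

theorem norm_fourierInv_le {n : ℕ} (a : E n → ℂ) (x : E n) : ‖(𝓕⁻ a) x‖ ≤ ∫ ξ, ‖a ξ‖ :=
  VectorFourier.norm_fourierIntegral_le_integral_norm _ _ _ _ _

/-- On `L¹ ∩ L²` the inverse Fourier transform of `L²` is given by the Fourier integral. -/
theorem fourierInv_toLp_ae_eq {n : ℕ} {a : E n → ℂ} (ha : Integrable a) (h2 : MemLp a 2 volume) :
    ((𝓕⁻ (h2.toLp a : L2 n) : L2 n) : E n → ℂ) =ᵐ[volume] 𝓕⁻ a := by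
  refine ae_eq_of_integral_mul_schwartz_eq
    ((Lp.memLp _).locallyIntegrable (by norm_num))
    (continuous_fourierInv_of_integrable ha).locallyIntegrable fun φ => ?_
  rw [integral_fourierInv_mul_eq ha φ.integrable]
  have h := congrArg (fun d : 𝓢'(E n, ℂ) => d φ)
    (Lp.fourierInv_toTemperedDistribution_eq (h2.toLp a : L2 n))
  simp only [TemperedDistribution.fourierInv_apply, Lp.toTemperedDistribution_apply,
    smul_eq_mul] at h
  calc _ = ∫ x, φ x * ((𝓕⁻ (h2.toLp a : L2 n) : L2 n) : E n → ℂ) x := by simp_rw [mul_comm]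
    _ = _ := h.symm
    _ = _ := by
      refine integral_congr_ae ?_
      filter_upwards [h2.coeFn_toLp] with ξ hξ
      rw [hξ, mul_comm, SchwartzMap.fourierInv_coe]

/-! ### Multiplication operators and Fourier multipliers -/

/-- A measurable symbol bounded by `1`. -/
structure UnitSymbol (n : ℕ) where
  /-- The underlying function. -/
  toFun : E n → ℂ
  measurable : Measurable toFun
  norm_le_one : ∀ ξ, ‖toFun ξ‖ ≤ 1

instance (n : ℕ) : CoeFun (UnitSymbol n) (fun _ => E n → ℂ) := ⟨UnitSymbol.toFun⟩

theorem UnitSymbol.enorm_le_one {n : ℕ} (m : UnitSymbol n) (ξ : E n) : ‖m ξ‖ₑ ≤ 1 := by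
  rw [enorm_eq_nnnorm]
  exact_mod_cast m.norm_le_one ξ

theorem UnitSymbol.memLp {n : ℕ} (m : UnitSymbol n) (f : L2 n) :
    MemLp (fun ξ => m ξ * f ξ) 2 volume := by
  refine MemLp.of_le (Lp.memLp f)
    (m.measurable.aestronglyMeasurable.mul (Lp.aestronglyMeasurable f))
    (Eventually.of_forall fun ξ => ?_)
  rw [norm_mul]
  exact mul_le_of_le_one_left (norm_nonneg _) (m.norm_le_one ξ)

/-- Multiplication by a symbol on `L²`. -/
noncomputable def UnitSymbol.mulL2 {n : ℕ} (m : UnitSymbol n) : L2 n →L[ℂ] L2 n :=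
  LinearMap.mkContinuous
    { toFun := fun f => (m.memLp f).toLp
      map_add' := fun f g => by
        refine Eq.trans (MemLp.toLp_congr _ ((m.memLp f).add (m.memLp g)) ?_)
          (MemLp.toLp_add _ _)
        filter_upwards [Lp.coeFn_add f g] with ξ hξ
        rw [hξ, Pi.add_apply, Pi.add_apply, mul_add]
      map_smul' := fun c f => by
        refine Eq.trans (MemLp.toLp_congr _ ((m.memLp f).const_smul c) ?_)
          (MemLp.toLp_const_smul c _)
        filter_upwards [Lp.coeFn_smul c f] with ξ hξ
        rw [hξ, Pi.smul_apply, Pi.smul_apply, smul_eq_mul, smul_eq_mul, mul_left_comm] } 1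
    (fun f => by
      rw [one_mul]
      refine Lp.norm_le_norm_of_ae_le ?_
      filter_upwards [(m.memLp f).coeFn_toLp] with ξ hξ
      simp only [LinearMap.coe_mk, AddHom.coe_mk]
      rw [hξ, norm_mul]
      exact mul_le_of_le_one_left (norm_nonneg _) (m.norm_le_one ξ))

theorem UnitSymbol.mulL2_eq {n : ℕ} (m : UnitSymbol n) (f : L2 n) :
    m.mulL2 f = (m.memLp f).toLp := rfl

theorem UnitSymbol.coeFn_mulL2 {n : ℕ} (m : UnitSymbol n) (f : L2 n) :
    (m.mulL2 f : E n → ℂ) =ᵐ[volume] fun ξ => m ξ * f ξ := (m.memLp f).coeFn_toLp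

theorem UnitSymbol.norm_mulL2_le {n : ℕ} (m : UnitSymbol n) (f : L2 n) : ‖m.mulL2 f‖ ≤ ‖f‖ := by
  refine Lp.norm_le_norm_of_ae_le ?_
  filter_upwards [m.coeFn_mulL2 f] with ξ hξ
  rw [hξ, norm_mul]
  exact mul_le_of_le_one_left (norm_nonneg _) (m.norm_le_one ξ)

/-- A family of symbols that converges pointwise converges strongly. -/
theorem UnitSymbol.tendsto_mulL2 {n : ℕ} {ι : Type*} {l : Filter ι} [l.IsCountablyGenerated]
    (m : ι → UnitSymbol n) (m₀ : UnitSymbol n)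
    (h : ∀ ξ, Tendsto (fun i => m i ξ) l (𝓝 (m₀ ξ))) (f : L2 n) :
    Tendsto (fun i => (m i).mulL2 f) l (𝓝 (m₀.mulL2 f)) := by
  rw [Lp.tendsto_Lp_iff_tendsto_eLpNorm']
  simp only [eLpNorm_eq_lintegral_rpow_enorm_toReal two_ne_zero ENNReal.ofNat_ne_top,
    ENNReal.toReal_ofNat]
  rw [show (0 : ℝ≥0∞) = 0 ^ (1 / 2 : ℝ) by simp]
  refine (ENNReal.continuous_rpow_const.tendsto 0).comp ?_
  have hF : ∀ i, (∫⁻ ξ, ‖((m i).mulL2 f - m₀.mulL2 f : E n → ℂ) ξ‖ₑ ^ (2 : ℝ)) =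
      ∫⁻ ξ, ‖(m i ξ - m₀ ξ) * f ξ‖ₑ ^ (2 : ℝ) := fun i => by
    refine lintegral_congr_ae ?_
    filter_upwards [(m i).coeFn_mulL2 f, m₀.coeFn_mulL2 f] with ξ h1 h2
    rw [Pi.sub_apply, h1, h2, sub_mul]
  simp only [hF]
  rw [show (0 : ℝ≥0∞) = ∫⁻ _ : E n, 0 by simp]
  refine tendsto_lintegral_filter_of_dominated_convergence' 
    (fun ξ => (2 * ‖f ξ‖ₑ) ^ (2 : ℝ)) (Eventually.of_forall fun i => ?_)
    (Eventually.of_forall fun i => Eventually.of_forall fun ξ => ?_) ?_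
    (Eventually.of_forall fun ξ => ?_)
  · exact ((((m i).measurable.sub m₀.measurable).aestronglyMeasurable.mul
      (Lp.aestronglyMeasurable f)).enorm).pow_const _
  · gcongr
    rw [enorm_mul]
    gcongr
    rw [← one_add_one_eq_two]
    refine enorm_sub_le.trans (add_le_add ?_ ?_)
    · exact (m i).enorm_le_one ξ
    · exact m₀.enorm_le_one ξ
  · simp only [ENNReal.mul_rpow_of_nonneg _ _ (zero_le_two : (0 : ℝ) ≤ 2)]
    rw [lintegral_const_mul' _ _ (by simp)]
    refine ENNReal.mul_ne_top (by simp) ?_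
    have := (Lp.memLp f).eLpNorm_lt_top
    rw [eLpNorm_lt_top_iff_lintegral_rpow_enorm_lt_top two_ne_zero ENNReal.ofNat_ne_top] at this
    simpa using this.ne
  · have h1 : Tendsto (fun i => (m i ξ - m₀ ξ) * f ξ) l (𝓝 0) := by
      simpa using ((h ξ).sub_const (m₀ ξ)).mul_const (f ξ)
    have h2 := (ENNReal.continuous_rpow_const (y := (2 : ℝ))).tendsto 0 |>.comp
      (by simpa using h1.enorm)
    simpa [Function.comp_def] using h2

theorem UnitSymbol.continuous_mulL2 {n : ℕ} {Z : Type*} [TopologicalSpace Z]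
    [FirstCountableTopology Z] (m : Z → UnitSymbol n) (h : ∀ ξ, Continuous fun z => m z ξ) :
    Continuous fun p : Z × L2 n => (m p.1).mulL2 p.2 := by
  refine continuous_prod_of_continuous_lipschitzWith' _ 1 (fun z => ?_) (fun f => ?_)
  · refine LipschitzWith.of_dist_le_mul fun f g => ?_
    rw [NNReal.coe_one, one_mul, dist_eq_norm, dist_eq_norm, ← map_sub]
    exact (m z).norm_mulL2_le _
  · exact continuous_iff_continuousAt.2 fun z =>
      UnitSymbol.tendsto_mulL2 m (m z) (fun ξ => (h ξ).tendsto z) f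

/-! ### The Sobolev space as a weighted `L²` space -/

theorem one_le_japanese {n : ℕ} {s : ℝ} (hs : 0 ≤ s) (ξ : E n) : 1 ≤ japanese n s ξ :=
  Real.one_le_rpow (by nlinarith [sq_nonneg (2 * Real.pi * ‖ξ‖)]) (by positivity)

theorem continuous_japanese (n : ℕ) (s : ℝ) : Continuous (japanese n s) := by
  unfold japanese
  exact Continuous.rpow_const (by fun_prop) fun ξ => Or.inl (by positivity)

/-- The symbol `⟨2πξ⟩ ^ (-s)`, for `s ≥ 0`. -/
noncomputable def invJapanese (n : ℕ) {s : ℝ} (hs : 0 ≤ s) : UnitSymbol n where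
  toFun ξ := ((japanese n s ξ)⁻¹ : ℝ)
  measurable := (Complex.continuous_ofReal.comp ((continuous_japanese n s).inv₀ fun ξ =>
    (japanese_pos n s ξ).ne')).measurable
  norm_le_one ξ := by
    rw [Complex.norm_real, Real.norm_of_nonneg (inv_nonneg.2 (japanese_pos n s ξ).le)]
    exact inv_le_one_of_one_le₀ (one_le_japanese hs ξ)

theorem Hs.coeFn_weighted {n : ℕ} {s : ℝ} (f : Hs n s) :
    (Hs.weighted n s f : E n → ℂ) =ᵐ[volume]
      fun ξ => (japanese n s ξ : ℂ) * (𝓕 (Hs.toL2 n s f) : L2 n) ξ := MemLp.coeFn_toLp f.memLp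

theorem Hs.norm_def {n : ℕ} {s : ℝ} (f : Hs n s) : ‖f‖ = ‖Hs.weighted n s f‖ := rfl

theorem Hs.fourier_toL2 {n : ℕ} {s : ℝ} (hs : 0 ≤ s) (f : Hs n s) :
    (𝓕 (Hs.toL2 n s f) : L2 n) = (invJapanese n hs).mulL2 (Hs.weighted n s f) := by
  refine Lp.ext ?_
  filter_upwards [(invJapanese n hs).coeFn_mulL2 (Hs.weighted n s f), f.coeFn_weighted]
    with ξ h1 h2
  rw [h1, h2, ← mul_assoc]
  have : (japanese n s ξ : ℂ) ≠ 0 := by exact_mod_cast (japanese_pos n s ξ).ne'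
  simp [invJapanese, this]

theorem Hs.toL2_injective {n : ℕ} {s : ℝ} : Function.Injective (Hs.toL2 n s) :=
  Subtype.val_injective

theorem Hs.norm_toL2_le {n : ℕ} {s : ℝ} (hs : 0 ≤ s) (f : Hs n s) : ‖Hs.toL2 n s f‖ ≤ ‖f‖ := by
  rw [← Lp.norm_fourier_eq, Hs.fourier_toL2 hs]
  exact (invJapanese n hs).norm_mulL2_le _

/-- A function on the frequency side whose product with `⟨2πξ⟩ ^ s` is in `L²` is the Fourier
transform of an element of `H^s`. -/
theorem Hs.exists_fourier_eq {n : ℕ} {s : ℝ} (hs : 0 ≤ s) {a : E n → ℂ}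
    (ha : MemLp (fun ξ => (japanese n s ξ : ℂ) * a ξ) 2 volume) :
    ∃ f : Hs n s, (𝓕 (Hs.toL2 n s f) : L2 n) =ᵐ[volume] a ∧ Hs.weighted n s f = ha.toLp := by
  have h1 : ((invJapanese n hs).mulL2 ha.toLp : E n → ℂ) =ᵐ[volume] a := by
    filter_upwards [(invJapanese n hs).coeFn_mulL2 ha.toLp, ha.coeFn_toLp] with ξ h1 h2
    rw [h1, h2, ← mul_assoc]
    have : (japanese n s ξ : ℂ) ≠ 0 := by exact_mod_cast (japanese_pos n s ξ).ne'
    simp [invJapanese, this]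
  have h2 : (𝓕 (𝓕⁻ ((invJapanese n hs).mulL2 ha.toLp) : L2 n) : L2 n) =
      (invJapanese n hs).mulL2 ha.toLp := fourier_fourierInv_eq _
  have h3 : MemLp (fun ξ => (japanese n s ξ : ℂ) *
      (𝓕 (𝓕⁻ ((invJapanese n hs).mulL2 ha.toLp) : L2 n) : L2 n) ξ) 2 volume := by
    refine (memLp_congr_ae ?_).2 ha
    rw [h2]
    filter_upwards [h1] with ξ h
    rw [h]
  refine ⟨⟨𝓕⁻ ((invJapanese n hs).mulL2 ha.toLp), h3⟩, ?_, ?_⟩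
  · exact (Filter.EventuallyEq.of_eq (congrArg (fun f : L2 n => (f : E n → ℂ)) h2)).trans h1
  · refine MemLp.toLp_congr h3 _ ?_
    filter_upwards [(Filter.EventuallyEq.of_eq
      (congrArg (fun f : L2 n => (f : E n → ℂ)) h2)).trans h1] with ξ h
    exact congrArg _ h

/-- `H^s` is isometric to `L²`, by `f ↦ ⟨2πξ⟩ ^ s 𝓕 f`. -/
noncomputable def Hs.weightedEquiv (n : ℕ) {s : ℝ} (hs : 0 ≤ s) : Hs n s ≃ₗᵢ[ℂ] L2 n :=
  LinearIsometryEquiv.ofSurjective ⟨Hs.weighted n s, fun _ => rfl⟩ fun b => by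
    have hb : MemLp (fun ξ => (japanese n s ξ : ℂ) * (invJapanese n hs).mulL2 b ξ) 2 volume := by
      refine (memLp_congr_ae ?_).2 (Lp.memLp b)
      filter_upwards [(invJapanese n hs).coeFn_mulL2 b] with ξ h
      have : (japanese n s ξ : ℂ) ≠ 0 := by exact_mod_cast (japanese_pos n s ξ).ne'
      rw [h, ← mul_assoc]
      simp [invJapanese, this]
    obtain ⟨f, -, hf⟩ := Hs.exists_fourier_eq hs hb
    refine ⟨f, hf.trans (Lp.ext ?_)⟩
    filter_upwards [hb.coeFn_toLp, (invJapanese n hs).coeFn_mulL2 b] with ξ h1 h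
    have : (japanese n s ξ : ℂ) ≠ 0 := by exact_mod_cast (japanese_pos n s ξ).ne'
    rw [h1, h, ← mul_assoc]
    simp [invJapanese, this]

theorem Hs.completeSpace {n : ℕ} {s : ℝ} (hs : 0 ≤ s) : CompleteSpace (Hs n s) :=
  (completeSpace_congr (e := (Hs.weightedEquiv n hs).toEquiv)
    (Hs.weightedEquiv n hs).isometry.isUniformInducing.isUniformEmbedding).2 inferInstance

/-- The inclusion of `H^s` in `L²` as a continuous linear map. -/
noncomputable def Hs.toL2CLM (n : ℕ) {s : ℝ} (hs : 0 ≤ s) : Hs n s →L[ℂ] L2 n :=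
  LinearMap.mkContinuous (Hs.toL2 n s) 1 fun f => by
    rw [one_mul]
    exact Hs.norm_toL2_le hs f

theorem Hs.toL2CLM_apply {n : ℕ} {s : ℝ} (hs : 0 ≤ s) (f : Hs n s) :
    Hs.toL2CLM n hs f = Hs.toL2 n s f := rfl

/-- The Fourier multiplier with a given symbol on `H^s`. -/
noncomputable def UnitSymbol.mulHs {n : ℕ} {s : ℝ} (hs : 0 ≤ s) (m : UnitSymbol n) :
    Hs n s →L[ℂ] Hs n s :=
  ((Hs.weightedEquiv n hs).symm : L2 n →L[ℂ] Hs n s) ∘L m.mulL2 ∘L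
    ((Hs.weightedEquiv n hs) : Hs n s →L[ℂ] L2 n)

theorem UnitSymbol.weighted_mulHs {n : ℕ} {s : ℝ} (hs : 0 ≤ s) (m : UnitSymbol n) (f : Hs n s) :
    Hs.weighted n s (m.mulHs hs f) = m.mulL2 (Hs.weighted n s f) :=
  (Hs.weightedEquiv n hs).apply_symm_apply _

theorem UnitSymbol.mulL2_comm {n : ℕ} (m m' : UnitSymbol n) (f : L2 n) :
    m.mulL2 (m'.mulL2 f) = m'.mulL2 (m.mulL2 f) := by
  refine Lp.ext ?_
  filter_upwards [m.coeFn_mulL2 (m'.mulL2 f), m'.coeFn_mulL2 (m.mulL2 f), m.coeFn_mulL2 f,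
    m'.coeFn_mulL2 f] with ξ h1 h2 h3 h4
  rw [h1, h2, h3, h4, mul_left_comm]

theorem UnitSymbol.fourier_mulHs {n : ℕ} {s : ℝ} (hs : 0 ≤ s) (m : UnitSymbol n) (f : Hs n s) :
    (𝓕 (Hs.toL2 n s (m.mulHs hs f)) : L2 n) = m.mulL2 (𝓕 (Hs.toL2 n s f)) := by
  rw [Hs.fourier_toL2 hs, Hs.fourier_toL2 hs, UnitSymbol.weighted_mulHs, UnitSymbol.mulL2_comm]

theorem UnitSymbol.norm_mulHs_le {n : ℕ} {s : ℝ} (hs : 0 ≤ s) (m : UnitSymbol n) (f : Hs n s) :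
    ‖m.mulHs hs f‖ ≤ ‖f‖ := by
  rw [Hs.norm_def, UnitSymbol.weighted_mulHs]
  exact m.norm_mulL2_le _

theorem UnitSymbol.continuous_mulHs {n : ℕ} {s : ℝ} (hs : 0 ≤ s) {Z : Type*} [TopologicalSpace Z]
    [FirstCountableTopology Z] (m : Z → UnitSymbol n) (h : ∀ ξ, Continuous fun z => m z ξ) :
    Continuous fun p : Z × Hs n s => (m p.1).mulHs hs p.2 :=
  (Hs.weightedEquiv n hs).symm.continuous.comp ((UnitSymbol.continuous_mulL2 m h).comp
    (continuous_fst.prodMk ((Hs.weightedEquiv n hs).continuous.comp continuous_snd)))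

/-! ### The propagator -/

/-- The phase function `|2πξ|² + 2π v·ξ` of the group `exp (i r (Δ + i v·∇))`. -/
noncomputable def phase {n : ℕ} (v ξ : E n) : ℝ :=
  (2 * Real.pi * ‖ξ‖) ^ 2 + 2 * Real.pi * inner ℝ v ξ

theorem continuous_phase {n : ℕ} (v : E n) : Continuous (phase v) := by
  unfold phase; fun_prop

/-- The symbol of the group `exp (i r (Δ + i v·∇))`. -/
noncomputable def groupSymbol {n : ℕ} (v : E n) (r : ℝ) : UnitSymbol n where
  toFun ξ := Complex.exp (((-(r * phase v ξ) : ℝ) : ℂ) * Complex.I)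
  measurable := by
    have := continuous_phase v
    exact Continuous.measurable (by fun_prop)
  norm_le_one ξ := (Complex.norm_exp_ofReal_mul_I _).le

theorem groupSymbol_apply {n : ℕ} (v : E n) (r : ℝ) (ξ : E n) :
    groupSymbol v r ξ = Complex.exp (((-(r * phase v ξ) : ℝ) : ℂ) * Complex.I) := rfl

theorem continuous_groupSymbol {n : ℕ} (v : E n) (ξ : E n) :
    Continuous fun r => groupSymbol v r ξ := by
  simp only [groupSymbol_apply]; fun_prop

/-- The group `exp (i r (Δ + i v·∇))` on `H^s`. -/
noncomputable def group {n : ℕ} {s : ℝ} (hs : 0 ≤ s) (v : E n) (r : ℝ) : Hs n s →L[ℂ] Hs n s :=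
  (groupSymbol v r).mulHs hs

theorem continuous_group {n : ℕ} {s : ℝ} (hs : 0 ≤ s) (v : E n) :
    Continuous fun p : ℝ × Hs n s => group hs v p.1 p.2 :=
  UnitSymbol.continuous_mulHs hs (groupSymbol v) (continuous_groupSymbol v)

theorem norm_group_le {n : ℕ} {s : ℝ} (hs : 0 ≤ s) (v : E n) (r : ℝ) (f : Hs n s) :
    ‖group hs v r f‖ ≤ ‖f‖ := UnitSymbol.norm_mulHs_le hs _ f

theorem group_add {n : ℕ} {s : ℝ} (hs : 0 ≤ s) (v : E n) (r r' : ℝ) (f : Hs n s) :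
    group hs v (r + r') f = group hs v r (group hs v r' f) := by
  apply Hs.weighted_injective
  simp only [group, UnitSymbol.weighted_mulHs]
  refine Lp.ext ?_
  filter_upwards [(groupSymbol v (r + r')).coeFn_mulL2 (Hs.weighted n s f),
    (groupSymbol v r).coeFn_mulL2 ((groupSymbol v r').mulL2 (Hs.weighted n s f)),
    (groupSymbol v r').coeFn_mulL2 (Hs.weighted n s f)] with ξ h1 h2 h3
  rw [h1, h2, h3, ← mul_assoc]
  congr 1
  simp only [groupSymbol_apply]
  rw [← Complex.exp_add]
  congr 1
  push_cast
  ring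

theorem group_zero {n : ℕ} {s : ℝ} (hs : 0 ≤ s) (v : E n) (f : Hs n s) :
    group hs v 0 f = f := by
  apply Hs.weighted_injective
  simp only [group, UnitSymbol.weighted_mulHs]
  refine Lp.ext ?_
  filter_upwards [(groupSymbol v 0).coeFn_mulL2 (Hs.weighted n s f)] with ξ h1
  rw [h1, groupSymbol_apply]
  simp

theorem group_neg_group {n : ℕ} {s : ℝ} (hs : 0 ≤ s) (v : E n) (r : ℝ) (f : Hs n s) :
    group hs v (-r) (group hs v r f) = f := by
  rw [← group_add, neg_add_cancel, group_zero]

theorem norm_group {n : ℕ} {s : ℝ} (hs : 0 ≤ s) (v : E n) (r : ℝ) (f : Hs n s) :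
    ‖group hs v r f‖ = ‖f‖ := by
  refine le_antisymm (norm_group_le hs v r f) ?_
  conv_lhs => rw [← group_neg_group hs v r f]
  exact norm_group_le hs v _ _

/-- The time `t ^ (α + 1) / (α + 1)` in which the equation has constant coefficients. -/
noncomputable def newTime (α t : ℝ) : ℝ := t ^ (α + 1) / (α + 1)

theorem continuous_newTime {α : ℝ} (hα : 0 < α) : Continuous (newTime α) := by
  unfold newTime
  exact (Real.continuous_rpow_const (by positivity)).div_const _

theorem newTime_zero {α : ℝ} (hα : 0 < α) : newTime α 0 = 0 := by
  unfold newTime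
  rw [Real.zero_rpow (by positivity), zero_div]

/-- The solution operator is the group at the difference of the new times. -/
theorem W_toL2 {n : ℕ} {s : ℝ} (hs : 0 ≤ s) (α : ℝ) (v : E n) (t τ : ℝ) (f : Hs n s) :
    W n α v t τ (Hs.toL2 n s f) = Hs.toL2 n s (group hs v (newTime α t - newTime α τ) f) := by
  apply (Lp.fourierTransformₗᵢ (E n) ℂ).injective
  change (𝓕 (W n α v t τ (Hs.toL2 n s f)) : L2 n) = 𝓕 (Hs.toL2 n s _)
  rw [group, UnitSymbol.fourier_mulHs, W, fourier_fourierInv_eq, UnitSymbol.mulL2_eq]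
  refine MemLp.toLp_congr _ _ (Eventually.of_forall fun ξ => ?_)
  simp only [propSymbol, groupSymbol_apply, phase, newTime]
  congr 5
  ring

/-! ### The algebra property of the Sobolev space -/

/-- Young's inequality `‖A ⋆ B‖₂ ≤ ‖A‖₁ ‖B‖₂` for nonnegative functions. -/
theorem lintegral_sq_convolution_le {n : ℕ} {A B : E n → ℝ≥0∞} (hA : Measurable A)
    (hB : Measurable B) :
    ∫⁻ ξ, (∫⁻ η, A η * B (ξ - η)) ^ 2 ≤ (∫⁻ η, A η) ^ 2 * ∫⁻ η, B η ^ 2 := by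
  have h1 : ∀ ξ, (∫⁻ η, A η * B (ξ - η)) ^ 2 ≤ (∫⁻ η, A η) * ∫⁻ η, A η * B (ξ - η) ^ 2 := by
    intro ξ
    have h := ENNReal.lintegral_mul_le_Lp_mul_Lq (volume : Measure (E n))
      Real.HolderConjugate.two_two
      (f := fun η => A η ^ (1 / 2 : ℝ)) (g := fun η => A η ^ (1 / 2 : ℝ) * B (ξ - η))
      (by fun_prop) (by fun_prop)
    simp only [Pi.mul_apply] at h
    have e1 : ∀ x : ℝ≥0∞, x ^ (1 / 2 : ℝ) * x ^ (1 / 2 : ℝ) = x := fun x => by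
      rw [← ENNReal.rpow_add_of_nonneg _ _ (by norm_num) (by norm_num)]; norm_num
    have e2 : ∀ x : ℝ≥0∞, (x ^ (1 / 2 : ℝ)) ^ (2 : ℝ) = x := fun x => by
      rw [← ENNReal.rpow_mul]; norm_num
    simp only [← mul_assoc, e1, ENNReal.mul_rpow_of_nonneg _ _ (zero_le_two : (0 : ℝ) ≤ 2), e2] at h
    calc (∫⁻ η, A η * B (ξ - η)) ^ 2
        ≤ ((∫⁻ η, A η) ^ (1 / 2 : ℝ) * (∫⁻ η, A η * B (ξ - η) ^ (2 : ℝ)) ^ (1 / 2 : ℝ)) ^ 2 := by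
          gcongr
      _ = _ := by
        rw [mul_pow, ← ENNReal.rpow_natCast, ← ENNReal.rpow_natCast, Nat.cast_ofNat, e2, e2]
        simp
  calc ∫⁻ ξ, (∫⁻ η, A η * B (ξ - η)) ^ 2
      ≤ ∫⁻ ξ, (∫⁻ η, A η) * ∫⁻ η, A η * B (ξ - η) ^ 2 := lintegral_mono h1
    _ = (∫⁻ η, A η) * ∫⁻ ξ, ∫⁻ η, A η * B (ξ - η) ^ 2 := by
      rw [lintegral_const_mul]
      exact Measurable.lintegral_prod_right' (f := fun p : E n × E n => A p.2 * B (p.1 - p.2) ^ 2)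
        (by fun_prop)
    _ = (∫⁻ η, A η) * ∫⁻ η, ∫⁻ ξ, A η * B (ξ - η) ^ 2 := by
      rw [lintegral_lintegral_swap (by fun_prop)]
    _ = (∫⁻ η, A η) * ∫⁻ η, A η * ∫⁻ ξ, B ξ ^ 2 := by
      congr 1
      refine lintegral_congr fun η => ?_
      rw [lintegral_const_mul _ (by fun_prop), lintegral_sub_right_eq_self (fun ξ => B ξ ^ 2) η]
    _ = _ := by
      rw [lintegral_mul_const _ hA, sq, mul_assoc]

theorem japanese_add_le {n : ℕ} {s : ℝ} (hs : 0 ≤ s) (ξ η : E n) :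
    japanese n s ξ ≤ 4 ^ (s / 2) * (japanese n s η + japanese n s (ξ - η)) := by
  unfold japanese
  set x := 2 * Real.pi * ‖η‖
  set y := 2 * Real.pi * ‖ξ - η‖
  have hx : 0 ≤ x := by positivity
  have hy : 0 ≤ y := by positivity
  have h : 2 * Real.pi * ‖ξ‖ ≤ x + y := by
    have := norm_add_le η (ξ - η)
    rw [add_sub_cancel] at this
    calc 2 * Real.pi * ‖ξ‖ ≤ 2 * Real.pi * (‖η‖ + ‖ξ - η‖) := by gcongr
      _ = x + y := by ring
  have h' : 1 + (2 * Real.pi * ‖ξ‖) ^ 2 ≤ 1 + (x + y) ^ 2 := by gcongr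
  rcases le_total x y with hxy | hxy
  · calc (1 + (2 * Real.pi * ‖ξ‖) ^ 2) ^ (s / 2) ≤ (4 * (1 + y ^ 2)) ^ (s / 2) := by
          refine Real.rpow_le_rpow (by positivity) (h'.trans ?_) (by positivity)
          nlinarith
      _ = 4 ^ (s / 2) * (1 + y ^ 2) ^ (s / 2) := Real.mul_rpow (by norm_num) (by positivity)
      _ ≤ _ := by
        gcongr
        exact le_add_of_nonneg_left (by positivity)
  · calc (1 + (2 * Real.pi * ‖ξ‖) ^ 2) ^ (s / 2) ≤ (4 * (1 + x ^ 2)) ^ (s / 2) := by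
          refine Real.rpow_le_rpow (by positivity) (h'.trans ?_) (by positivity)
          nlinarith
      _ = 4 ^ (s / 2) * (1 + x ^ 2) ^ (s / 2) := Real.mul_rpow (by norm_num) (by positivity)
      _ ≤ _ := by
        gcongr
        exact le_add_of_nonneg_right (by positivity)

theorem memLp_inv_japanese {n : ℕ} {s : ℝ} (hs : (n : ℝ) / 2 < s) :
    MemLp (fun ξ : E n => (((japanese n s ξ)⁻¹ : ℝ) : ℂ)) 2 volume := by
  have hs0 : 0 ≤ s := le_trans (by positivity) hs.le
  have hc : Continuous fun ξ : E n => (japanese n s ξ)⁻¹ :=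
    (continuous_japanese n s).inv₀ fun ξ => (japanese_pos n s ξ).ne'
  have hm : AEStronglyMeasurable (fun ξ : E n => (((japanese n s ξ)⁻¹ : ℝ) : ℂ)) volume :=
    (Complex.continuous_ofReal.comp hc).aestronglyMeasurable
  rw [memLp_two_iff_integrable_sq_norm hm]
  have h := integrable_rpow_neg_one_add_norm_sq (E := E n) (μ := volume) (r := 2 * s)
    (by simp; linarith)
  refine h.mono' (by fun_prop) (Eventually.of_forall fun ξ => ?_)
  rw [Complex.norm_real, norm_pow, norm_norm, Real.norm_of_nonneg
    (inv_nonneg.2 (japanese_pos n s ξ).le), japanese, inv_pow, ← Real.rpow_natCast,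
    ← Real.rpow_mul (by positivity), ← Real.rpow_neg (by positivity)]
  have e : -(s / 2 * ((2 : ℕ) : ℝ)) = -(2 * s) / 2 := by push_cast; ring
  rw [e]
  refine Real.rpow_le_rpow_of_nonpos (by positivity) ?_ (by linarith)
  have h1 : 1 ≤ 2 * Real.pi := by linarith [Real.pi_gt_three]
  have h2 : ‖ξ‖ ≤ 2 * Real.pi * ‖ξ‖ := le_mul_of_one_le_left (norm_nonneg _) h1
  gcongr

theorem measurable_coeFn {n : ℕ} (f : L2 n) : Measurable (f : E n → ℂ) :=
  (Lp.stronglyMeasurable f).measurable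

/-- The Sobolev embedding on the frequency side: `‖𝓕 f‖_{L¹} ≤ C ‖f‖_{H^s}` for `s > n / 2`. -/
theorem exists_lintegral_fourier_le {n : ℕ} {s : ℝ} (hs : (n : ℝ) / 2 < s) :
    ∃ C : ℝ, 0 < C ∧ ∀ f : Hs n s,
      ∫⁻ ξ, ‖(𝓕 (Hs.toL2 n s f) : L2 n) ξ‖ₑ ≤ ENNReal.ofReal (C * ‖f‖) := by
  have h := memLp_inv_japanese hs
  refine ⟨(eLpNorm (fun ξ : E n => (((japanese n s ξ)⁻¹ : ℝ) : ℂ)) 2 volume).toReal + 1,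
    by positivity, fun f => ?_⟩
  calc ∫⁻ ξ, ‖(𝓕 (Hs.toL2 n s f) : L2 n) ξ‖ₑ
      = eLpNorm (𝓕 (Hs.toL2 n s f) : L2 n) 1 volume := eLpNorm_one_eq_lintegral_enorm.symm
    _ = eLpNorm ((fun ξ : E n => (((japanese n s ξ)⁻¹ : ℝ) : ℂ)) • 
          (Hs.weighted n s f : E n → ℂ)) 1 volume := by
        refine eLpNorm_congr_ae ?_
        filter_upwards [f.coeFn_weighted] with ξ hξ
        have : (japanese n s ξ : ℂ) ≠ 0 := by exact_mod_cast (japanese_pos n s ξ).ne'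
        simp [hξ, this]
    _ ≤ eLpNorm (fun ξ : E n => (((japanese n s ξ)⁻¹ : ℝ) : ℂ)) 2 volume *
          eLpNorm (Hs.weighted n s f) 2 volume :=
        eLpNorm_smul_le_mul_eLpNorm (Lp.aestronglyMeasurable _) h.1
    _ ≤ _ := by
      rw [Hs.norm_def, ENNReal.ofReal_mul (by positivity), Lp.norm_def,
        ENNReal.ofReal_toReal (Lp.eLpNorm_ne_top _)]
      gcongr
      refine (ENNReal.ofReal_toReal h.eLpNorm_ne_top).symm.le.trans ?_
      exact ENNReal.ofReal_le_ofReal (by linarith)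

theorem Hs.integrable_fourier {n : ℕ} {s : ℝ} (hs : (n : ℝ) / 2 < s) (f : Hs n s) :
    Integrable (𝓕 (Hs.toL2 n s f) : L2 n) := by
  obtain ⟨C, -, hC⟩ := exists_lintegral_fourier_le hs
  exact ⟨Lp.aestronglyMeasurable _, (hC f).trans_lt ENNReal.ofReal_lt_top⟩

theorem Hs.coeFn_toL2_ae_eq {n : ℕ} {s : ℝ} (hs : (n : ℝ) / 2 < s) (f : Hs n s) :
    (Hs.toL2 n s f : E n → ℂ) =ᵐ[volume] 𝓕⁻ ((𝓕 (Hs.toL2 n s f) : L2 n) : E n → ℂ) := by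
  have h := fourierInv_toLp_ae_eq (f.integrable_fourier hs) (Lp.memLp _)
  rw [Lp.toLp_coeFn, fourierInv_fourier_eq] at h
  exact h

theorem exists_norm_toL2_le {n : ℕ} {s : ℝ} (hs : (n : ℝ) / 2 < s) :
    ∃ C : ℝ, 0 < C ∧ ∀ f : Hs n s, ∀ᵐ x, ‖Hs.toL2 n s f x‖ ≤ C * ‖f‖ := by
  obtain ⟨C, hC0, hC⟩ := exists_lintegral_fourier_le hs
  refine ⟨C, hC0, fun f => ?_⟩
  filter_upwards [f.coeFn_toL2_ae_eq hs] with x hx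
  rw [hx]
  refine (norm_fourierInv_le _ x).trans ?_
  rw [integral_norm_eq_lintegral_enorm (Lp.aestronglyMeasurable _)]
  exact ENNReal.toReal_le_of_le_ofReal (by positivity) (hC f)

theorem fourierInv_mul_convolution_eq {n : ℕ} {a b : E n → ℂ} (ha : Integrable a)
    (hb : Integrable b) (x : E n) :
    (𝓕⁻ (convolution a b (ContinuousLinearMap.mul ℂ ℂ) volume)) x = (𝓕⁻ a) x * (𝓕⁻ b) x := by
  rw [Real.fourierInv_eq_fourier_neg, Real.fourierInv_eq_fourier_neg,
    Real.fourierInv_eq_fourier_neg, Real.fourier_mul_convolution_eq ha hb]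

theorem Hs.norm_eq_of_fourier {n : ℕ} {s : ℝ} (f : Hs n s) {a : E n → ℂ}
    (h : (𝓕 (Hs.toL2 n s f) : L2 n) =ᵐ[volume] a) :
    ‖f‖ = (eLpNorm (fun ξ => (japanese n s ξ : ℂ) * a ξ) 2 volume).toReal := by
  rw [Hs.norm_def, Lp.norm_def]
  congr 1
  refine eLpNorm_congr_ae ?_
  filter_upwards [f.coeFn_weighted, h] with ξ h1 h2
  rw [h1, h2]

theorem eLpNorm_two_eq {n : ℕ} {F : Type*} [NormedAddCommGroup F] (f : E n → F) :
    eLpNorm f 2 volume = (∫⁻ ξ, ‖f ξ‖ₑ ^ 2) ^ (1 / 2 : ℝ) := by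
  rw [eLpNorm_eq_lintegral_rpow_enorm_toReal two_ne_zero ENNReal.ofNat_ne_top]
  simp

theorem Hs.enorm_eq {n : ℕ} {s : ℝ} (f : Hs n s) :
    ENNReal.ofReal ‖f‖ = (∫⁻ ξ, ‖(japanese n s ξ : ℂ) *
      (𝓕 (Hs.toL2 n s f) : L2 n) ξ‖ₑ ^ 2) ^ (1 / 2 : ℝ) := by
  rw [Hs.norm_def, Lp.norm_def, ENNReal.ofReal_toReal (Lp.eLpNorm_ne_top _), ← eLpNorm_two_eq]
  exact eLpNorm_congr_ae f.coeFn_weighted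

theorem lintegral_sq_add_le {X : Type*} [MeasurableSpace X] {m : Measure X} {A B : X → ℝ≥0∞}
    (hA : Measurable A) (hB : Measurable B) :
    (∫⁻ ξ, (A ξ + B ξ) ^ 2 ∂m) ^ (1 / 2 : ℝ) ≤
      (∫⁻ ξ, A ξ ^ 2 ∂m) ^ (1 / 2 : ℝ) + (∫⁻ ξ, B ξ ^ 2 ∂m) ^ (1 / 2 : ℝ) := by
  have := ENNReal.lintegral_Lp_add_le (μ := m) (p := 2) hA.aemeasurable
    hB.aemeasurable (by norm_num)
  simpa using this

theorem rpow_half_sq (x : ℝ≥0∞) : (x ^ 2) ^ (1 / 2 : ℝ) = x := by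
  rw [← ENNReal.rpow_natCast, ← ENNReal.rpow_mul]; norm_num

/-- The `L²` norm of a function that is dominated by a sum of two convolutions. -/
theorem lintegral_sq_le_of_le_convolution {n : ℕ} {A A' B B' c : E n → ℝ≥0∞} (hA : Measurable A)
    (hA' : Measurable A') (hB : Measurable B) (hB' : Measurable B') (K : ℝ≥0∞)
    (h : ∀ ξ, c ξ ≤ K * ((∫⁻ η, A' η * B (ξ - η)) + ∫⁻ η, A η * B' (ξ - η))) :
    (∫⁻ ξ, c ξ ^ 2) ^ (1 / 2 : ℝ) ≤
      K * ((∫⁻ η, B η) * (∫⁻ η, A' η ^ 2) ^ (1 / 2 : ℝ) +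
        (∫⁻ η, A η) * (∫⁻ η, B' η ^ 2) ^ (1 / 2 : ℝ)) := by
  have hconv : ∀ {F G : E n → ℝ≥0∞}, Measurable F → Measurable G →
      Measurable fun ξ => ∫⁻ η, F η * G (ξ - η) := fun {F G} hF hG =>
    Measurable.lintegral_prod_right' (f := fun p : E n × E n => F p.2 * G (p.1 - p.2))
      (by fun_prop)
  have hY : ∀ {F G : E n → ℝ≥0∞}, Measurable F → Measurable G →
      (∫⁻ ξ, (∫⁻ η, F η * G (ξ - η)) ^ 2) ^ (1 / 2 : ℝ) ≤
        (∫⁻ η, F η) * (∫⁻ η, G η ^ 2) ^ (1 / 2 : ℝ) := fun {F G} hF hG => by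
    refine (ENNReal.rpow_le_rpow (lintegral_sq_convolution_le hF hG) (by norm_num)).trans ?_
    rw [ENNReal.mul_rpow_of_nonneg _ _ (by norm_num), rpow_half_sq]
  have e1 : ∀ ξ, (∫⁻ η, A' η * B (ξ - η)) = ∫⁻ η, B η * A' (ξ - η) := fun ξ => by
    rw [← lintegral_sub_left_eq_self _ ξ]
    refine lintegral_congr fun η => ?_
    rw [sub_sub_cancel, mul_comm]
  calc (∫⁻ ξ, c ξ ^ 2) ^ (1 / 2 : ℝ)
      ≤ (∫⁻ ξ, (K * ((∫⁻ η, B η * A' (ξ - η)) + ∫⁻ η, A η * B' (ξ - η))) ^ 2) ^ (1 / 2 : ℝ) := by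
        gcongr with ξ
        rw [← e1]
        exact h ξ
    _ = K * (∫⁻ ξ, ((∫⁻ η, B η * A' (ξ - η)) + ∫⁻ η, A η * B' (ξ - η)) ^ 2) ^ (1 / 2 : ℝ) := by
        have hm : Measurable fun ξ =>
            ((∫⁻ η, B η * A' (ξ - η)) + ∫⁻ η, A η * B' (ξ - η)) ^ 2 :=
          ((hconv hB hA').add (hconv hA hB')).pow_const 2
        simp only [mul_pow]
        rw [lintegral_const_mul _ hm,
          ENNReal.mul_rpow_of_nonneg _ _ (by norm_num), rpow_half_sq]
    _ ≤ _ := by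
        gcongr
        exact (lintegral_sq_add_le (hconv hB hA') (hconv hA hB')).trans
          (add_le_add (hY hB hA') (hY hA hB'))

theorem enorm_japanese {n : ℕ} (s : ℝ) (ξ : E n) :
    ‖(japanese n s ξ : ℂ)‖ₑ = ENNReal.ofReal (japanese n s ξ) := by
  rw [← ofReal_norm, Complex.norm_real, Real.norm_of_nonneg (japanese_pos n s ξ).le]

/-- The weight `⟨2πξ⟩ ^ s` is distributed over the two factors of a convolution. -/
theorem enorm_japanese_mul_convolution_le {n : ℕ} {s : ℝ} (hs : 0 ≤ s) {a b : E n → ℂ}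
    (ha : Measurable a) (hb : Measurable b) (ξ : E n) :
    ‖(japanese n s ξ : ℂ) * convolution a b (ContinuousLinearMap.mul ℂ ℂ) volume ξ‖ₑ ≤
      ENNReal.ofReal (4 ^ (s / 2)) *
      ((∫⁻ η, ‖(japanese n s η : ℂ) * a η‖ₑ * ‖b (ξ - η)‖ₑ) +
        ∫⁻ η, ‖a η‖ₑ * ‖(japanese n s (ξ - η) : ℂ) * b (ξ - η)‖ₑ) := by
  have hJ : Measurable fun ξ : E n => (japanese n s ξ : ℂ) :=
    (Complex.continuous_ofReal.comp (continuous_japanese n s)).measurable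
  have hJa : Measurable fun η => (japanese n s η : ℂ) * a η := hJ.mul ha
  have hJb : Measurable fun η => (japanese n s (ξ - η) : ℂ) * b (ξ - η) :=
    (hJ.mul hb).comp (measurable_const.sub measurable_id)
  have hb' : Measurable fun η => b (ξ - η) := hb.comp (measurable_const.sub measurable_id)
  have m1 : Measurable fun η => ‖(japanese n s η : ℂ) * a η‖ₑ * ‖b (ξ - η)‖ₑ :=
    hJa.enorm.mul hb'.enorm
  have m2 : Measurable fun η => ‖(japanese n s η : ℂ) * a η‖ₑ * ‖b (ξ - η)‖ₑ +
      ‖a η‖ₑ * ‖(japanese n s (ξ - η) : ℂ) * b (ξ - η)‖ₑ := m1.add (ha.enorm.mul hJb.enorm)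
  rw [← lintegral_add_left m1, ← lintegral_const_mul _ m2, enorm_mul]
  calc ‖(japanese n s ξ : ℂ)‖ₑ * ‖convolution a b (ContinuousLinearMap.mul ℂ ℂ) volume ξ‖ₑ
      ≤ ‖(japanese n s ξ : ℂ)‖ₑ * ∫⁻ η, ‖a η * b (ξ - η)‖ₑ := by
        gcongr
        exact enorm_integral_le_lintegral_enorm _
    _ = ∫⁻ η, ‖(japanese n s ξ : ℂ)‖ₑ * ‖a η * b (ξ - η)‖ₑ :=
        (lintegral_const_mul _ (ha.mul hb').enorm).symm
    _ ≤ _ := by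
      refine lintegral_mono fun η => ?_
      have h1 : ‖(japanese n s ξ : ℂ)‖ₑ ≤ ENNReal.ofReal (4 ^ (s / 2)) *
          (‖(japanese n s η : ℂ)‖ₑ + ‖(japanese n s (ξ - η) : ℂ)‖ₑ) := by
        rw [enorm_japanese, enorm_japanese, enorm_japanese,
          ← ENNReal.ofReal_add (japanese_pos n s _).le (japanese_pos n s _).le,
          ← ENNReal.ofReal_mul (by positivity)]
        exact ENNReal.ofReal_le_ofReal (japanese_add_le hs ξ η)
      simp only [enorm_mul]
      refine (mul_le_mul_left h1 _).trans (le_of_eq ?_)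
      ring

/-- `H^s` is an algebra for `s > n / 2`. -/
theorem Hs.exists_mul {n : ℕ} {s : ℝ} (hs : (n : ℝ) / 2 < s) :
    ∃ C : ℝ, 0 < C ∧ ∀ f g : Hs n s, ∃ h : Hs n s,
      (Hs.toL2 n s h =ᵐ[volume] fun x => Hs.toL2 n s f x * Hs.toL2 n s g x) ∧
      ‖h‖ ≤ C * (‖f‖ * ‖g‖) := by
  have hs0 : 0 ≤ s := le_trans (by positivity) hs.le
  obtain ⟨C, hC0, hC⟩ := exists_lintegral_fourier_le hs
  refine ⟨4 ^ (s / 2) * (2 * C), by positivity, fun f g => ?_⟩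
  set a : E n → ℂ := ⇑(𝓕 (Hs.toL2 n s f) : L2 n) with ha
  set b : E n → ℂ := ⇑(𝓕 (Hs.toL2 n s g) : L2 n) with hb
  have hai : Integrable a := f.integrable_fourier hs
  have hbi : Integrable b := g.integrable_fourier hs
  have hma : Measurable a := measurable_coeFn _
  have hmb : Measurable b := measurable_coeFn _
  have hJ : Measurable fun ξ : E n => (japanese n s ξ : ℂ) :=
    (Complex.continuous_ofReal.comp (continuous_japanese n s)).measurable
  set c : E n → ℂ := convolution a b (ContinuousLinearMap.mul ℂ ℂ) volume with hc
  have hci : Integrable c := hai.integrable_convolution _ hbi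
  have hnorm : (∫⁻ ξ, ‖(japanese n s ξ : ℂ) * c ξ‖ₑ ^ 2) ^ (1 / 2 : ℝ) ≤
      ENNReal.ofReal (4 ^ (s / 2) * (2 * C) * (‖f‖ * ‖g‖)) := by
    refine (lintegral_sq_le_of_le_convolution (A := fun η => ‖a η‖ₑ)
      (A' := fun η => ‖(japanese n s η : ℂ) * a η‖ₑ) (B := fun η => ‖b η‖ₑ)
      (B' := fun η => ‖(japanese n s η : ℂ) * b η‖ₑ) hma.enorm (hJ.mul hma).enorm hmb.enorm
      (hJ.mul hmb).enorm _ (enorm_japanese_mul_convolution_le hs0 hma hmb)).trans ?_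
    rw [← f.enorm_eq, ← g.enorm_eq]
    calc _ ≤ ENNReal.ofReal (4 ^ (s / 2)) * (ENNReal.ofReal (C * ‖g‖) * ENNReal.ofReal ‖f‖ +
            ENNReal.ofReal (C * ‖f‖) * ENNReal.ofReal ‖g‖) := by
          gcongr
          · exact hC g
          · exact hC f
      _ = _ := by
          rw [← ENNReal.ofReal_mul (by positivity), ← ENNReal.ofReal_mul (by positivity),
            ← ENNReal.ofReal_add (by positivity) (by positivity),
            ← ENNReal.ofReal_mul (by positivity)]
          congr 1; ring
  have hmem : MemLp (fun ξ => (japanese n s ξ : ℂ) * c ξ) 2 volume := by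
    refine ⟨hJ.aestronglyMeasurable.mul hci.1, ?_⟩
    rw [eLpNorm_two_eq]
    exact hnorm.trans_lt ENNReal.ofReal_lt_top
  obtain ⟨h, hh, -⟩ := Hs.exists_fourier_eq hs0 hmem
  refine ⟨h, ?_, ?_⟩
  · filter_upwards [h.coeFn_toL2_ae_eq hs, f.coeFn_toL2_ae_eq hs, g.coeFn_toL2_ae_eq hs]
      with x h1 h2 h3
    rw [h1, h2, h3, Real.fourierInv_congr_ae hh x]
    exact fourierInv_mul_convolution_eq hai hbi x
  · rw [h.norm_eq_of_fourier hh, eLpNorm_two_eq]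
    exact ENNReal.toReal_le_of_le_ofReal (by positivity) hnorm

theorem japanese_neg {n : ℕ} (s : ℝ) (ξ : E n) : japanese n s (-ξ) = japanese n s ξ := by
  simp [japanese]

/-- `H^s` is stable under complex conjugation, with equality of norms. -/
theorem Hs.exists_conj {n : ℕ} {s : ℝ} (hs : (n : ℝ) / 2 < s) (f : Hs n s) : ∃ h : Hs n s,
    (Hs.toL2 n s h =ᵐ[volume] fun x => starRingEnd ℂ (Hs.toL2 n s f x)) ∧ ‖h‖ = ‖f‖ := by
  have hs0 : 0 ≤ s := le_trans (by positivity) hs.le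
  set a : E n → ℂ := ⇑(𝓕 (Hs.toL2 n s f) : L2 n) with ha
  have hma : Measurable a := measurable_coeFn _
  have hJ : Measurable fun ξ : E n => (japanese n s ξ : ℂ) :=
    (Complex.continuous_ofReal.comp (continuous_japanese n s)).measurable
  have hcm : Measurable fun ξ => starRingEnd ℂ (a (-ξ)) :=
    Complex.continuous_conj.measurable.comp (hma.comp measurable_neg)
  have hn : eLpNorm (fun ξ => (japanese n s ξ : ℂ) * starRingEnd ℂ (a (-ξ))) 2 volume =
      eLpNorm (fun ξ => (japanese n s ξ : ℂ) * a ξ) 2 volume := by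
    rw [eLpNorm_two_eq, eLpNorm_two_eq]
    congr 1
    rw [← lintegral_neg_eq_self (fun ξ => ‖(japanese n s ξ : ℂ) * a ξ‖ₑ ^ 2)]
    refine lintegral_congr fun ξ => ?_
    rw [enorm_mul, enorm_mul, japanese_neg]
    congr 2
    rw [← ofReal_norm, RCLike.norm_conj, ofReal_norm]
  have hmem : MemLp (fun ξ => (japanese n s ξ : ℂ) * starRingEnd ℂ (a (-ξ))) 2 volume := by
    refine ⟨(hJ.mul hcm).aestronglyMeasurable, ?_⟩
    rw [hn]
    exact f.memLp.2
  obtain ⟨h, hh, -⟩ := Hs.exists_fourier_eq hs0 hmem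
  refine ⟨h, ?_, ?_⟩
  · filter_upwards [h.coeFn_toL2_ae_eq hs, f.coeFn_toL2_ae_eq hs] with x h1 h2
    rw [h1, h2, Real.fourierInv_congr_ae hh x, Real.fourierInv_eq', Real.fourierInv_eq',
      ← integral_conj, ← integral_neg_eq_self]
    refine integral_congr_ae (Eventually.of_forall fun ξ => ?_)
    simp only [smul_eq_mul, map_mul, neg_neg, ← Complex.exp_conj, Complex.conj_ofReal,
      Complex.conj_I, inner_neg_left]
    congr 2
    push_cast
    ring
  · rw [h.norm_eq_of_fourier hh, hn, ← f.norm_eq_of_fourier (EventuallyEq.refl _ _)]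

/-- The nonlinearity `f |f| ^ {2k}` acts on `H^s`, is Lipschitz on balls, and is bounded by a
multiple of `f` in `L²`, with a constant that depends on the norm of `f` in `H^s` only. -/
theorem exists_nonlinearity {n : ℕ} {s : ℝ} (hs : (n : ℝ) / 2 < s) (k : ℕ) :
    ∃ N : Hs n s → Hs n s,
      (∀ f, Hs.toL2 n s (N f) =ᵐ[volume]
        fun x => Hs.toL2 n s f x * ((‖Hs.toL2 n s f x‖ ^ (2 * k) : ℝ) : ℂ)) ∧
      N 0 = 0 ∧
      ∀ R : ℝ, 0 < R → ∃ K : ℝ, 0 < K ∧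
        (∀ f g : Hs n s, ‖f‖ ≤ R → ‖g‖ ≤ R → ‖N f - N g‖ ≤ K * ‖f - g‖) ∧
        ∀ f : Hs n s, ‖f‖ ≤ R → ‖Hs.toL2 n s (N f)‖ ≤ K * ‖Hs.toL2 n s f‖ := by
  obtain ⟨C, hC0, hC⟩ := Hs.exists_mul hs
  choose mul hmul hmuln using hC
  choose conj hconj hconjn using Hs.exists_conj hs
  obtain ⟨L, hL0, hL⟩ := exists_norm_toL2_le hs
  have hmul_sub : ∀ f f' g g', mul f g - mul f' g' = mul (f - f') g + mul f' (g - g') := by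
    intro f f' g g'
    apply Hs.toL2_injective
    simp only [map_sub, map_add]
    refine Lp.ext ?_
    filter_upwards [Lp.coeFn_sub (Hs.toL2 n s (mul f g)) (Hs.toL2 n s (mul f' g')),
      Lp.coeFn_add (Hs.toL2 n s (mul (f - f') g)) (Hs.toL2 n s (mul f' (g - g'))),
      Lp.coeFn_sub (Hs.toL2 n s f) (Hs.toL2 n s f'), Lp.coeFn_sub (Hs.toL2 n s g) (Hs.toL2 n s g'),
      hmul f g, hmul f' g', hmul (f - f') g, hmul f' (g - g')] with x h1 h2 h3 h4 h5 h6 h7 h8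
    rw [h1, h2, Pi.sub_apply, Pi.add_apply, h5, h6, h7, h8, map_sub, map_sub, h3, h4,
      Pi.sub_apply, Pi.sub_apply]
    ring
  have hconj_sub : ∀ f g, conj f - conj g = conj (f - g) := by
    intro f g
    apply Hs.toL2_injective
    simp only [map_sub]
    refine Lp.ext ?_
    filter_upwards [Lp.coeFn_sub (Hs.toL2 n s (conj f)) (Hs.toL2 n s (conj g)),
      Lp.coeFn_sub (Hs.toL2 n s f) (Hs.toL2 n s g), hconj f, hconj g, hconj (f - g)]
      with x h1 h2 h3 h4 h5
    rw [h1, Pi.sub_apply, h3, h4, h5, map_sub, h2, Pi.sub_apply, map_sub]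
  have hconj0 : conj 0 = 0 := norm_eq_zero.1 (by rw [hconjn, norm_zero])
  have hmul_lip : ∀ f f' g g', ‖mul f g - mul f' g'‖ ≤
      C * (‖f - f'‖ * ‖g‖) + C * (‖f'‖ * ‖g - g'‖) := by
    intro f f' g g'
    rw [hmul_sub]
    exact (norm_add_le _ _).trans (add_le_add (hmuln _ _) (hmuln _ _))
  induction k with
  | zero =>
    refine ⟨id, fun f => Eventually.of_forall fun x => by simp, rfl, fun R _ => ⟨1, one_pos,
      fun f g _ _ => by simp, fun f _ => by simp⟩⟩
  | succ k ih =>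
    obtain ⟨N, hN, hN0, hNR⟩ := ih
    refine ⟨fun f => mul f (mul (conj f) (N f)), fun f => ?_, ?_, fun R hR => ?_⟩
    · filter_upwards [hmul f (mul (conj f) (N f)), hmul (conj f) (N f), hconj f, hN f]
        with x h1 h2 h3 h4
      rw [h1, h2, h3, h4]
      have := Complex.conj_mul' (Hs.toL2 n s f x)
      push_cast
      calc _ = (starRingEnd ℂ (Hs.toL2 n s f x) * Hs.toL2 n s f x) * (Hs.toL2 n s f x *
            (‖Hs.toL2 n s f x‖ : ℂ) ^ (2 * k)) := by ring
        _ = _ := by rw [this]; ring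
    · refine norm_le_zero_iff.1 ((hmuln _ _).trans ?_)
      simp
    · obtain ⟨K, hK0, hK1, hK2⟩ := hNR R hR
      have hNn : ∀ f, ‖f‖ ≤ R → ‖N f‖ ≤ K * R := fun f hf => by
        have := hK1 f 0 hf (by simpa using hR.le)
        rw [hN0, sub_zero, sub_zero] at this
        exact this.trans (by gcongr)
      have hcN : ∀ f, ‖f‖ ≤ R → ‖mul (conj f) (N f)‖ ≤ C * (R * (K * R)) := fun f hf => by
        refine (hmuln _ _).trans ?_
        rw [hconjn]
        gcongr
        exact hNn f hf
      refine ⟨3 * C * C * K * R * R + (L * R) * (L * R) * K, by positivity,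
        fun f g hf hg => ?_, fun f hf => ?_⟩
      · have h1 : ‖mul (conj f) (N f) - mul (conj g) (N g)‖ ≤ 2 * C * K * R * ‖f - g‖ := by
          refine (hmul_lip _ _ _ _).trans ?_
          rw [hconj_sub, hconjn, hconjn]
          calc _ ≤ C * (‖f - g‖ * (K * R)) + C * (R * (K * ‖f - g‖)) := by
                gcongr
                · exact hNn f hf
                · exact hK1 f g hf hg
            _ = _ := by ring
        refine (hmul_lip _ _ _ _).trans ?_
        calc _ ≤ C * (‖f - g‖ * (C * (R * (K * R)))) + C * (R * (2 * C * K * R * ‖f - g‖)) := by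
              gcongr
              exact hcN f hf
          _ = 3 * C * C * K * R * R * ‖f - g‖ := by ring
          _ ≤ _ := by
            gcongr
            exact le_add_of_nonneg_right (by positivity)
      · have h1 : ‖Hs.toL2 n s (mul f (mul (conj f) (N f)))‖ ≤
            (L * R) * (L * R) * ‖Hs.toL2 n s (N f)‖ := by
          refine Lp.norm_le_mul_norm_of_ae_le_mul ?_
          filter_upwards [hmul f (mul (conj f) (N f)), hmul (conj f) (N f), hconj f, hL f]
            with x h1 h2 h3 h4
          rw [h1, h2, h3, norm_mul, norm_mul, RCLike.norm_conj, ← mul_assoc]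
          have h5 : ‖Hs.toL2 n s f x‖ ≤ L * R := h4.trans (by gcongr)
          gcongr
        refine h1.trans ?_
        calc _ ≤ (L * R) * (L * R) * (K * ‖Hs.toL2 n s f‖) := by
              gcongr
              exact hK2 f hf
          _ = (L * R) * (L * R) * K * ‖Hs.toL2 n s f‖ := by ring
          _ ≤ _ := by
            gcongr
            exact le_add_of_nonneg_left (by positivity)

/-! ### The integral equation as an ordinary differential equation in the Sobolev space -/

/-- `u` solves the linear equation with datum `u₀` and right-hand side `i F`, in the form of
Duhamel's formula in `H^s`. -/
def IsDuhamel {n : ℕ} {s T : ℝ} (hs : 0 ≤ s) (hT : 0 ≤ T) (α : ℝ) (v : E n) (u₀ : Hs n s)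
    (F u : CHs n s T) : Prop :=
  ∀ t : Set.Icc (0 : ℝ) T, u t = group hs v (newTime α t) u₀ +
    ∫ τ in (0 : ℝ)..t, group hs v (newTime α t - newTime α τ) (F (Set.projIcc 0 T hT τ))

/-- The composition of a curve in `H^s` with the nonlinearity, times `-i μ`. -/
noncomputable def source {n : ℕ} {s T : ℝ} (μ : ℂ) {N : Hs n s → Hs n s} (hN : Continuous N)
    (u : CHs n s T) : CHs n s T :=
  ⟨fun t => (-(Complex.I * μ)) • N (u t), by fun_prop⟩

theorem continuous_group_comp {n : ℕ} {s : ℝ} (hs : 0 ≤ s) (v : E n) {Z : Type*}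
    [TopologicalSpace Z] {r : Z → ℝ} {f : Z → Hs n s} (hr : Continuous r) (hf : Continuous f) :
    Continuous fun z => group hs v (r z) (f z) := by
  simpa [Function.comp_def] using (continuous_group hs v).comp (hr.prodMk hf)

theorem continuous_duhamel_integrand {n : ℕ} {s T : ℝ} (hs : 0 ≤ s) (hT : 0 ≤ T) {α : ℝ}
    (hα : 0 < α) (v : E n) (F : CHs n s T) (t : ℝ) :
    Continuous fun τ => group hs v (newTime α t - newTime α τ) (F (Set.projIcc 0 T hT τ)) :=
  continuous_group_comp hs v (continuous_const.sub (continuous_newTime hα))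
    (F.continuous.comp continuous_projIcc)

/-- The integral equation in `L²` is equivalent to Duhamel's formula in `H^s`, because the
nonlinearity takes its values in `H^s`. -/
theorem isMildSolution_iff {n : ℕ} {s T : ℝ} (hs : 0 ≤ s) (hT : 0 ≤ T) {α : ℝ} (hα : 0 < α)
    (v : E n) (k : ℕ) (μ : ℂ) {N : Hs n s → Hs n s} (hN : Continuous N)
    (hN' : ∀ f, Hs.toL2 n s (N f) =ᵐ[volume]
      fun x => Hs.toL2 n s f x * ((‖Hs.toL2 n s f x‖ ^ (2 * k) : ℝ) : ℂ))
    (u₀ : Hs n s) (u : CHs n s T) :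
    IsMildSolution n α v k μ s T u₀ u ↔ IsDuhamel hs hT α v u₀ (source μ hN u) u := by
  have hcs := Hs.completeSpace (n := n) hs
  have hcont : ∀ t : ℝ, Continuous fun τ =>
      group hs v (newTime α t - newTime α τ) (N (u (Set.projIcc 0 T hT τ))) := fun t =>
    continuous_group_comp hs v (continuous_const.sub (continuous_newTime hα))
      (hN.comp (u.continuous.comp continuous_projIcc))
  -- the two integrals correspond under the inclusion of `H^s` in `L²`
  have key : ∀ G : ℝ → L2 n, (∀ τ : Set.Icc (0 : ℝ) T, G τ = Hs.toL2 n s (N (u τ))) →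
      ∀ t : Set.Icc (0 : ℝ) T,
        IntervalIntegrable (fun τ => W n α v t τ (G τ)) volume 0 (t : ℝ) ∧
        (Hs.toL2 n s (u t) = W n α v t 0 (Hs.toL2 n s u₀) -
            (Complex.I * μ) • ∫ τ in (0 : ℝ)..t, W n α v t τ (G τ) ↔
          u t = group hs v (newTime α t) u₀ + ∫ τ in (0 : ℝ)..t,
            group hs v (newTime α t - newTime α τ) (source μ hN u (Set.projIcc 0 T hT τ))) := by
    intro G hG t
    have e1 : Set.EqOn (fun τ => W n α v t τ (G τ))
        (fun τ => Hs.toL2CLM n hs (group hs v (newTime α t - newTime α τ)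
          (N (u (Set.projIcc 0 T hT τ))))) (Set.uIcc 0 (t : ℝ)) := by
      intro τ hτ
      rw [Set.uIcc_of_le t.2.1] at hτ
      have hτ' : τ ∈ Set.Icc (0 : ℝ) T := ⟨hτ.1, hτ.2.trans t.2.2⟩
      have := hG ⟨τ, hτ'⟩
      simp only at this
      simp only [this, W_toL2 hs, Hs.toL2CLM_apply, Set.projIcc_of_mem hT hτ']
    have hi := (hcont t).intervalIntegrable (μ := volume) 0 (t : ℝ)
    refine ⟨?_, ?_⟩
    · refine IntervalIntegrable.congr (fun τ hτ => (e1 (Set.uIoc_subset_uIcc hτ)).symm) ?_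
      exact (((Hs.toL2CLM n hs).continuous.comp (hcont t)).intervalIntegrable _ _)
    · rw [intervalIntegral.integral_congr e1,
        ContinuousLinearMap.intervalIntegral_comp_comm _ hi, W_toL2 hs, newTime_zero hα, sub_zero,
        ← Hs.toL2_injective.eq_iff (a := u t)]
      have e2 : (∫ τ in (0 : ℝ)..t, group hs v (newTime α t - newTime α τ)
            (source μ hN u (Set.projIcc 0 T hT τ))) = (-(Complex.I * μ)) •
          ∫ τ in (0 : ℝ)..t, group hs v (newTime α t - newTime α τ)
            (N (u (Set.projIcc 0 T hT τ))) := by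
        rw [← intervalIntegral.integral_smul]
        refine intervalIntegral.integral_congr fun τ _ => ?_
        simp only [source, ContinuousMap.coe_mk, map_smul]
      rw [e2, map_add, map_smul, neg_smul, ← sub_eq_add_neg, Hs.toL2CLM_apply]
  constructor
  · rintro ⟨G, hG, h⟩ t
    refine ((key G (fun τ => Lp.ext ?_) t).2).1 (h t).2
    exact (hG τ).trans (hN' (u τ)).symm
  · intro h
    refine ⟨fun τ => Hs.toL2 n s (N (u (Set.projIcc 0 T hT τ))), fun τ => ?_, fun t => ?_⟩
    · simp only [Set.projIcc_val]
      exact hN' (u τ)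
    · have := key (fun τ => Hs.toL2 n s (N (u (Set.projIcc 0 T hT τ))))
        (fun τ => by simp only [Set.projIcc_val]) t
      exact ⟨this.1, this.2.2 (h t)⟩

/-- The vector field of the equation in the interaction picture `w(t) = W(0, t) u(t)`. -/
noncomputable def field {n : ℕ} {s : ℝ} (hs : 0 ≤ s) (α : ℝ) (v : E n) (μ : ℂ)
    (N : Hs n s → Hs n s) (t : ℝ) (w : Hs n s) : Hs n s :=
  group hs v (-newTime α t) ((-(Complex.I * μ)) • N (group hs v (newTime α t) w))

theorem continuous_field {n : ℕ} {s : ℝ} (hs : 0 ≤ s) {α : ℝ} (hα : 0 < α) (v : E n) (μ : ℂ)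
    {N : Hs n s → Hs n s} (hN : Continuous N) :
    Continuous fun p : ℝ × Hs n s => field hs α v μ N p.1 p.2 := by
  have h1 : Continuous fun p : ℝ × Hs n s => newTime α p.1 :=
    (continuous_newTime hα).comp continuous_fst
  have h2 : Continuous fun p : ℝ × Hs n s =>
      (-(Complex.I * μ)) • N (group hs v (newTime α p.1) p.2) :=
    (hN.comp (continuous_group_comp hs v h1 continuous_snd)).fun_const_smul _
  exact continuous_group_comp hs v h1.neg h2

theorem norm_field_sub_le {n : ℕ} {s : ℝ} (hs : 0 ≤ s) (α : ℝ) (v : E n) (μ : ℂ)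
    {N : Hs n s → Hs n s} {R K : ℝ}
    (hK : ∀ f g : Hs n s, ‖f‖ ≤ R → ‖g‖ ≤ R → ‖N f - N g‖ ≤ K * ‖f - g‖) (t : ℝ)
    {f g : Hs n s} (hf : ‖f‖ ≤ R) (hg : ‖g‖ ≤ R) :
    ‖field hs α v μ N t f - field hs α v μ N t g‖ ≤ ‖μ‖ * K * ‖f - g‖ := by
  rw [field, field, ← map_sub, norm_group, ← smul_sub, norm_smul, norm_neg, norm_mul,
    Complex.norm_I, one_mul, mul_assoc]
  gcongr
  refine (hK _ _ (by rwa [norm_group]) (by rwa [norm_group])).trans ?_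
  rw [← map_sub, norm_group]

theorem field_zero {n : ℕ} {s : ℝ} (hs : 0 ≤ s) (α : ℝ) (v : E n) (μ : ℂ)
    {N : Hs n s → Hs n s} (hN : N 0 = 0) (t : ℝ) : field hs α v μ N t 0 = 0 := by
  simp [field, hN]

theorem norm_toL2_group {n : ℕ} {s : ℝ} (hs : 0 ≤ s) (v : E n) (r : ℝ) (f : Hs n s) :
    ‖Hs.toL2 n s (group hs v r f)‖ = ‖Hs.toL2 n s f‖ := by
  have h : ∀ r f, ‖Hs.toL2 n s (group hs v r f)‖ ≤ ‖Hs.toL2 n s f‖ := fun r f => by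
    rw [← Lp.norm_fourier_eq, group, UnitSymbol.fourier_mulHs, ← Lp.norm_fourier_eq (Hs.toL2 n s f)]
    exact UnitSymbol.norm_mulL2_le _ _
  refine le_antisymm (h r f) ?_
  conv_lhs => rw [← group_neg_group hs v r f]
  exact h _ _

/-- In the interaction picture, Duhamel's formula says that the derivative is the vector field. -/
theorem IsDuhamel.exists_hasDerivAt {n : ℕ} {s T : ℝ} {hs : 0 ≤ s} {hT : 0 ≤ T} {α : ℝ}
    (hα : 0 < α) {v : E n} {μ : ℂ} {N : Hs n s → Hs n s} {hN : Continuous N} {u₀ : Hs n s}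
    {u : CHs n s T} (h : IsDuhamel hs hT α v u₀ (source μ hN u) u) :
    ∃ w : ℝ → Hs n s, Continuous w ∧ w 0 = u₀ ∧
      (∀ t : Set.Icc (0 : ℝ) T, u t = group hs v (newTime α t) (w t)) ∧
      ∀ t ∈ Set.Icc (0 : ℝ) T, HasDerivAt w (field hs α v μ N t (w t)) t := by
  have hcs := Hs.completeSpace (n := n) hs
  have hc : Continuous fun τ => group hs v (-newTime α τ)
      (source μ hN u (Set.projIcc 0 T hT τ)) :=
    continuous_group_comp hs v (continuous_newTime hα).neg
      ((source μ hN u).continuous.comp continuous_projIcc)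
  have hd : ∀ t, HasDerivAt (fun t => u₀ + ∫ τ in (0 : ℝ)..t, group hs v (-newTime α τ)
      (source μ hN u (Set.projIcc 0 T hT τ))) (group hs v (-newTime α t)
      (source μ hN u (Set.projIcc 0 T hT t))) t := fun t =>
    (intervalIntegral.integral_hasDerivAt_right (hc.intervalIntegrable _ _)
      (hc.stronglyMeasurableAtFilter _ _) hc.continuousAt).const_add u₀
  have hu : ∀ t : Set.Icc (0 : ℝ) T, u t = group hs v (newTime α t)
      (u₀ + ∫ τ in (0 : ℝ)..t, group hs v (-newTime α τ)
        (source μ hN u (Set.projIcc 0 T hT τ))) := fun t => by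
    rw [h t, map_add, ← ContinuousLinearMap.intervalIntegral_comp_comm _
      (hc.intervalIntegrable _ _)]
    simp only [← group_add, ← sub_eq_add_neg]
  refine ⟨_, continuous_iff_continuousAt.2 fun t => (hd t).continuousAt, by simp, hu,
    fun t ht => ?_⟩
  have h2 := hd t
  have h3 := hu ⟨t, ht⟩
  simp only at h3
  rw [field, ← h3]
  rwa [Set.projIcc_of_mem hT ht] at h2

/-- Conversely, an integral curve of the vector field gives a solution of Duhamel's formula. -/
theorem isDuhamel_of_hasDerivWithinAt {n : ℕ} {s T : ℝ} {hs : 0 ≤ s} {hT : 0 ≤ T} {α : ℝ}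
    (hα : 0 < α) {v : E n} {μ : ℂ} {N : Hs n s → Hs n s} (hN : Continuous N)
    {w : ℝ → Hs n s} (u : CHs n s T)
    (hu : ∀ t : Set.Icc (0 : ℝ) T, u t = group hs v (newTime α t) (w t))
    (hw : ∀ t ∈ Set.Icc (0 : ℝ) T,
      HasDerivWithinAt w (field hs α v μ N t (w t)) (Set.Icc 0 T) t) :
    IsDuhamel hs hT α v (w 0) (source μ hN u) u := by
  have hcs := Hs.completeSpace (n := n) hs
  intro t
  have hc : Continuous fun τ => group hs v (-newTime α τ)
      (source μ hN u (Set.projIcc 0 T hT τ)) :=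
    continuous_group_comp hs v (continuous_newTime hα).neg
      ((source μ hN u).continuous.comp continuous_projIcc)
  have hsub : Set.Icc 0 (t : ℝ) ⊆ Set.Icc 0 T := Set.Icc_subset_Icc_right t.2.2
  have hint := intervalIntegral.integral_eq_sub_of_hasDeriv_right_of_le (a := 0) (b := (t : ℝ))
    (f := w) (f' := fun τ => group hs v (-newTime α τ)
      (source μ hN u (Set.projIcc 0 T hT τ))) t.2.1
    (fun τ hτ => ((hw τ (hsub hτ)).continuousWithinAt).mono hsub) (fun τ hτ => ?_)
    (hc.intervalIntegrable _ _)
  · have hw' : w t = w 0 + ∫ τ in (0 : ℝ)..t, group hs v (-newTime α τ)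
        (source μ hN u (Set.projIcc 0 T hT τ)) := by rw [hint]; abel
    rw [hu t, hw', map_add, ← ContinuousLinearMap.intervalIntegral_comp_comm _
      (hc.intervalIntegrable _ _)]
    simp only [← group_add, ← sub_eq_add_neg]
  · have hτ' : τ ∈ Set.Icc (0 : ℝ) T := hsub ⟨hτ.1.le, hτ.2.le⟩
    have h1 := (hw τ hτ').hasDerivAt (Icc_mem_nhds hτ.1 (hτ.2.trans_le t.2.2))
    have h2 := hu ⟨τ, hτ'⟩
    simp only at h2
    rw [field, ← h2] at h1
    rw [Set.projIcc_of_mem hT hτ']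
    exact h1.hasDerivWithinAt

/-- Local well-posedness in `H^s`, on a time interval that depends on the size of the data only,
together with a bound of the nonlinear term by the datum in `H^s` and in `L²`. -/
theorem exists_flow {n : ℕ} {s : ℝ} (hs : (n : ℝ) / 2 < s) (hs0 : 0 ≤ s) {α : ℝ} (hα : 0 < α)
    (v : E n) (k : ℕ) (μ : ℂ) (R : ℝ) :
    ∃ (T : ℝ) (hT : 0 < T), T ≤ 1 ∧ ∃ S : Hs n s → CHs n s T,
      (∀ u₀, ‖u₀‖ ≤ R → IsMildSolution n α v k μ s T u₀ (S u₀)) ∧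
      (∀ u₀, ‖u₀‖ ≤ R → ∀ u : CHs n s T, IsMildSolution n α v k μ s T u₀ u → u = S u₀) ∧
      ContinuousOn S (Metric.closedBall 0 R) ∧
      ∀ u₀, ‖u₀‖ ≤ R → ∃ F : CHs n s T, IsDuhamel hs0 hT.le α v u₀ F (S u₀) ∧
        T * ‖F‖ ≤ ‖u₀‖ ∧ ∀ t, T * ‖Hs.toL2 n s (F t)‖ ≤ ‖Hs.toL2 n s u₀‖ := by
  have hcs := Hs.completeSpace (n := n) hs0
  obtain ⟨N, hN', hN0, hNR⟩ := exists_nonlinearity hs k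
  have hN : Continuous N := by
    refine continuous_iff_continuousAt.2 fun f => ?_
    obtain ⟨K, -, hK, -⟩ := hNR (‖f‖ + 1) (by positivity)
    refine tendsto_iff_norm_sub_tendsto_zero.2 ?_
    have h0 : Tendsto (fun g => K * ‖g - f‖) (𝓝 f) (𝓝 0) := by
      have : Continuous fun g : Hs n s => K * ‖g - f‖ := by fun_prop
      simpa using this.tendsto f
    refine squeeze_zero' (Eventually.of_forall fun _ => norm_nonneg _) ?_ h0
    filter_upwards [Metric.ball_mem_nhds f one_pos] with g hg
    rw [mem_ball_iff_norm] at hg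
    refine hK g f ?_ (by linarith)
    have := norm_add_le (g - f) f
    rw [sub_add_cancel] at this
    linarith
  wlog hR : 0 < R generalizing R with H
  · obtain ⟨T, hT, hT1, S, h1, h2, h3, h4⟩ := H 1 one_pos
    have hR' : R ≤ 1 := (not_lt.1 hR).trans zero_le_one
    exact ⟨T, hT, hT1, S, fun u₀ h => h1 u₀ (h.trans hR'), fun u₀ h => h2 u₀ (h.trans hR'),
      h3.mono (Metric.closedBall_subset_closedBall hR'), fun u₀ h => h4 u₀ (h.trans hR')⟩
  obtain ⟨K, hK0, hK, hK2⟩ := hNR (2 * (R + 1)) (by positivity)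
  -- `2 ‖μ‖ K T < 1`: the field is at most `‖μ‖ K` times the norm as long as that norm is at most
  -- `2 (R + 1)`, so that solutions at most double and the source has total mass at most `‖u₀‖`
  set T : ℝ := 1 / (2 * (‖μ‖ * K) + 1) with hTdef
  have hT : 0 < T := by positivity
  have hden : 0 < 2 * (‖μ‖ * K) + 1 := by positivity
  have hTK : 2 * (‖μ‖ * K) * T < 1 := by
    rw [hTdef, mul_one_div, div_lt_one hden]; linarith
  have hT1 : T ≤ 1 := by
    rw [hTdef, div_le_one hden]
    linarith [show 0 ≤ ‖μ‖ * K by positivity]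
  set f := field hs0 α v μ N with hf
  have hfc := continuous_field hs0 hα v μ hN
  have hflip : ∀ t {w w' : Hs n s}, ‖w‖ ≤ 2 * (R + 1) → ‖w'‖ ≤ 2 * (R + 1) →
      ‖f t w - f t w'‖ ≤ ‖μ‖ * K * ‖w - w'‖ := fun t w w' => norm_field_sub_le hs0 α v μ hK t
  have hfn : ∀ t {w : Hs n s}, ‖w‖ ≤ 2 * (R + 1) → ‖f t w‖ ≤ ‖μ‖ * K * ‖w‖ := fun t w hw => by
    have := hflip t hw (w' := 0) (by rw [norm_zero]; positivity)
    rwa [hf, field_zero hs0 α v μ hN0, sub_zero, sub_zero] at this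
  let a : NNReal := ⟨2 * R, by positivity⟩
  let r : NNReal := ⟨R, hR.le⟩
  let KK : NNReal := ⟨‖μ‖ * K, by positivity⟩
  let LL : NNReal := ⟨‖μ‖ * K * (2 * R), by positivity⟩
  have hPL : IsPicardLindelof f (⟨0, le_refl 0, hT.le⟩ : Set.Icc (0 : ℝ) T) 0 a r LL KK := by
    refine ⟨fun t _ => ?_, fun x _ => ?_, fun t _ x hx => ?_, ?_⟩
    · refine LipschitzOnWith.of_dist_le_mul fun x hx y hy => ?_
      rw [dist_eq_norm, dist_eq_norm]
      rw [mem_closedBall_zero_iff] at hx hy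
      have ha : (a : ℝ) = 2 * R := rfl
      exact hflip t (by linarith) (by linarith)
    · exact (hfc.comp (continuous_id.prodMk continuous_const)).continuousOn
    · rw [mem_closedBall_zero_iff] at hx
      have ha : (a : ℝ) = 2 * R := rfl
      refine (hfn t (by linarith)).trans ?_
      change _ ≤ ‖μ‖ * K * (2 * R)
      gcongr
      linarith
    · change ‖μ‖ * K * (2 * R) * max (T - 0) (0 - 0) ≤ 2 * R - R
      rw [sub_zero, sub_zero, max_eq_left hT.le]
      nlinarith
  obtain ⟨w, hw, L', hL'⟩ := hPL.exists_forall_mem_closedBall_eq_hasDerivWithinAt_lipschitzOnWith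
  simp only [mem_closedBall_zero_iff] at hw
  change ∀ x : Hs n s, ‖x‖ ≤ R → w x 0 = x ∧ _ at hw
  -- the solution with datum `u₀`; the value for data outside the ball is irrelevant
  let S : Hs n s → CHs n s T := fun u₀ => if h : ‖u₀‖ ≤ R then
    ⟨fun t => group hs0 v (newTime α t) (w u₀ t), continuous_group_comp hs0 v
      ((continuous_newTime hα).comp continuous_subtype_val)
      (ContinuousOn.domRestrict fun t ht => ((hw u₀ h).2 t ht).continuousWithinAt)⟩ else 0
  have hS : ∀ u₀, ‖u₀‖ ≤ R → ∀ t, S u₀ t = group hs0 v (newTime α t) (w u₀ t) := by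
    intro u₀ h t
    simp only [S, dif_pos h, ContinuousMap.coe_mk]
  have hwc : ∀ u₀, ‖u₀‖ ≤ R → ContinuousOn (w u₀) (Set.Icc 0 T) := fun u₀ h t ht =>
    ((hw u₀ h).2 t ht).continuousWithinAt
  have hwd : ∀ u₀, ‖u₀‖ ≤ R → ∀ t ∈ Set.Ico 0 T,
      HasDerivWithinAt (w u₀) (f t (w u₀ t)) (Set.Ici t) t := fun u₀ h t ht =>
    ((hw u₀ h).2 t (Set.Ico_subset_Icc_self ht)).mono_of_mem_nhdsWithin
      (mem_of_superset (Icc_mem_nhdsGE ht.2) (Set.Icc_subset_Icc_left ht.1))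
  have hSD : ∀ u₀, ‖u₀‖ ≤ R → IsDuhamel hs0 hT.le α v u₀ (source μ hN (S u₀)) (S u₀) := by
    intro u₀ h
    have := isDuhamel_of_hasDerivWithinAt (hs := hs0) (hT := hT.le) hα hN (S u₀) (hS u₀ h)
      (hw u₀ h).2
    rwa [(hw u₀ h).1] at this
  -- a barrier argument: the norm at most doubles
  have hwn : ∀ u₀, ‖u₀‖ ≤ R → ∀ t ∈ Set.Icc 0 T, ‖w u₀ t‖ ≤ 2 * ‖u₀‖ := by
    intro u₀ h t ht
    refine le_of_forall_pos_le_add fun δ hδ => ?_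
    set ε := ‖u₀‖ + min (δ / 2) 1 with hε
    have hm : 0 < min (δ / 2) 1 := by positivity
    have hm1 : min (δ / 2) 1 ≤ 1 := min_le_right _ _
    have hm2 : min (δ / 2) 1 ≤ δ / 2 := min_le_left _ _
    have hε0 : 0 < ε := by positivity
    have hB := image_norm_le_of_norm_deriv_right_lt_deriv_boundary (a := 0) (b := T)
      (f := w u₀) (f' := fun t => f t (w u₀ t)) (B := fun t => ε + ε / T * t)
      (B' := fun _ => ε / T) (hwc u₀ h) (hwd u₀ h) (by rw [(hw u₀ h).1]; simp [hε, hm.le])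
      (fun x => by simpa using ((hasDerivAt_id x).const_mul (ε / T)).const_add ε)
      (fun x hx hxe => ?_) ht
    · refine hB.trans ?_
      have : ε / T * t ≤ ε := by
        rw [div_mul_eq_mul_div, div_le_iff₀ hT]
        exact mul_le_mul_of_nonneg_left ht.2 hε0.le
      linarith
    · have h1 : ε / T * x ≤ ε := by
        rw [div_mul_eq_mul_div, div_le_iff₀ hT]
        exact mul_le_mul_of_nonneg_left hx.2.le hε0.le
      have h2 : ‖w u₀ x‖ ≤ 2 * ε := by rw [hxe]; linarith
      refine (hfn x (by linarith)).trans_lt ?_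
      rw [lt_div_iff₀ hT]
      calc ‖μ‖ * K * ‖w u₀ x‖ * T ≤ ‖μ‖ * K * (2 * ε) * T := by gcongr
        _ = 2 * (‖μ‖ * K) * T * ε := by ring
        _ < 1 * ε := by gcongr
        _ = ε := one_mul ε
  have hSn : ∀ u₀, ‖u₀‖ ≤ R → ∀ t, ‖S u₀ t‖ ≤ 2 * ‖u₀‖ := fun u₀ h t => by
    rw [hS u₀ h, norm_group]
    exact hwn u₀ h t t.2
  -- the `L²` norm at most doubles as well: Grönwall's inequality, with `exp (1 / 2) ≤ 2`
  have hwL2 : ∀ u₀, ‖u₀‖ ≤ R → ∀ t ∈ Set.Icc 0 T,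
      ‖Hs.toL2 n s (w u₀ t)‖ ≤ 2 * ‖Hs.toL2 n s u₀‖ := by
    intro u₀ h t ht
    have hG := norm_le_gronwallBound_of_norm_deriv_right_le (a := 0) (b := T)
      (f := fun t => Hs.toL2CLM n hs0 (w u₀ t))
      (f' := fun t => Hs.toL2CLM n hs0 (f t (w u₀ t))) (δ := ‖Hs.toL2 n s u₀‖)
      (K := ‖μ‖ * K) (ε := 0) ((Hs.toL2CLM n hs0).continuous.comp_continuousOn (hwc u₀ h))
      (fun t ht => ((Hs.toL2CLM n hs0).restrictScalars ℝ).hasFDerivAt.comp_hasDerivWithinAt t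
        (hwd u₀ h t ht))
      (by rw [(hw u₀ h).1, Hs.toL2CLM_apply]) (fun t ht => ?_) t ht
    · rw [gronwallBound_ε0, sub_zero, mul_comm, Hs.toL2CLM_apply] at hG
      refine hG.trans ?_
      gcongr
      have h1 : ‖μ‖ * K * t ≤ 1 / 2 := by
        have : ‖μ‖ * K * t ≤ ‖μ‖ * K * T := by gcongr; exact ht.2
        linarith
      refine (Real.exp_le_exp.2 h1).trans ?_
      have h2 := Real.exp_one_lt_d9
      have h3 : Real.exp (1 / 2) ^ 2 = Real.exp 1 := by rw [← Real.exp_nat_mul]; norm_num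
      nlinarith [Real.exp_pos (1 / 2)]
    · have h2 := hwn u₀ h t (Set.Ico_subset_Icc_self ht)
      simp only [Hs.toL2CLM_apply, add_zero, hf, field]
      rw [norm_toL2_group, map_smul, norm_smul, norm_neg, norm_mul, Complex.norm_I, one_mul,
        mul_assoc]
      gcongr
      refine (hK2 _ (by rw [norm_group]; linarith)).trans ?_
      rw [norm_toL2_group]
  refine ⟨T, hT, hT1, S, fun u₀ h => ?_, fun u₀ h u hu => ?_, ?_, fun u₀ h =>
    ⟨source μ hN (S u₀), hSD u₀ h, ?_, fun t => ?_⟩⟩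
  · exact (isMildSolution_iff hs0 hT.le hα v k μ hN hN' u₀ _).2 (hSD u₀ h)
  · rw [isMildSolution_iff hs0 hT.le hα v k μ hN hN'] at hu
    obtain ⟨w', hw'c, hw'0, huw', hw'd⟩ := hu.exists_hasDerivAt hα
    -- both curves stay in a common ball, on which the vector field is Lipschitz
    have hM' : ∀ t ∈ Set.Icc 0 T, ‖w' t‖ ≤ ‖u‖ := fun t ht => by
      have := u.norm_coe_le_norm ⟨t, ht⟩
      rwa [huw', norm_group] at this
    obtain ⟨K', hK'0, hK', -⟩ := hNR (‖u‖ + 2 * R + 1) (by positivity)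
    have heq := ODE_solution_unique_of_mem_Icc_right (v := f) (a := 0) (b := T)
      (K := ⟨‖μ‖ * K', by positivity⟩) (s := fun _ => Metric.closedBall 0 (‖u‖ + 2 * R + 1))
      (f := w') (g := w u₀) (fun t _ => LipschitzOnWith.of_dist_le_mul fun x hx y hy => by
        rw [dist_eq_norm, dist_eq_norm]
        rw [mem_closedBall_zero_iff] at hx hy
        exact norm_field_sub_le hs0 α v μ hK' t hx hy)
      hw'c.continuousOn
      (fun t ht => (hw'd t (Set.Ico_subset_Icc_self ht)).hasDerivWithinAt)
      (fun t ht => by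
        rw [mem_closedBall_zero_iff]
        linarith [hM' t (Set.Ico_subset_Icc_self ht)])
      (hwc u₀ h) (hwd u₀ h)
      (fun t ht => by
        rw [mem_closedBall_zero_iff]
        linarith [hwn u₀ h t (Set.Ico_subset_Icc_self ht), norm_nonneg u])
      (by rw [hw'0, (hw u₀ h).1])
    ext1 t
    rw [huw', hS u₀ h, heq t.2]
  · refine LipschitzOnWith.continuousOn (K := L') (LipschitzOnWith.of_dist_le_mul
      fun x hx y hy => ?_)
    refine (ContinuousMap.dist_le (by positivity)).2 fun t => ?_
    have hx' := mem_closedBall_zero_iff.1 hx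
    have hy' := mem_closedBall_zero_iff.1 hy
    rw [hS x hx', hS y hy', dist_eq_norm, ← map_sub, norm_group, ← dist_eq_norm]
    exact (hL' t t.2).dist_le_mul x hx y hy
  · have h1 : ‖source μ hN (S u₀)‖ ≤ ‖μ‖ * (K * (2 * ‖u₀‖)) := by
      refine (ContinuousMap.norm_le _ (by positivity)).2 fun t => ?_
      simp only [source, ContinuousMap.coe_mk]
      rw [norm_smul, norm_neg, norm_mul, Complex.norm_I, one_mul]
      gcongr
      have h3 := hSn u₀ h t
      have h2 := hK (S u₀ t) 0 (by linarith) (by rw [norm_zero]; positivity)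
      rw [hN0, sub_zero, sub_zero] at h2
      exact h2.trans (by gcongr)
    calc T * ‖source μ hN (S u₀)‖ ≤ T * (‖μ‖ * (K * (2 * ‖u₀‖))) := by gcongr
      _ = 2 * (‖μ‖ * K) * T * ‖u₀‖ := by ring
      _ ≤ 1 * ‖u₀‖ := by gcongr
      _ = ‖u₀‖ := one_mul _
  · simp only [source, ContinuousMap.coe_mk]
    rw [map_smul, norm_smul, norm_neg, norm_mul, Complex.norm_I, one_mul]
    have h3 := hSn u₀ h t
    have h2 := hK2 (S u₀ t) (by linarith)
    have h4 : ‖Hs.toL2 n s (S u₀ t)‖ ≤ 2 * ‖Hs.toL2 n s u₀‖ := by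
      rw [hS u₀ h, norm_toL2_group]
      exact hwL2 u₀ h t t.2
    calc T * (‖μ‖ * ‖Hs.toL2 n s (N (S u₀ t))‖)
        ≤ T * (‖μ‖ * (K * (2 * ‖Hs.toL2 n s u₀‖))) := by
          gcongr
          exact h2.trans (by gcongr)
      _ = 2 * (‖μ‖ * K) * T * ‖Hs.toL2 n s u₀‖ := by ring
      _ ≤ 1 * ‖Hs.toL2 n s u₀‖ := by gcongr
      _ = ‖Hs.toL2 n s u₀‖ := one_mul _

/-! ### Oscillatory integrals and the Schur test -/

/-- A `TT*` argument. The `L²` norm, over a finite measure space, of a superposition of bounded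
functions `e(·, ξ)` is controlled by a weighted Schur test of their Gram kernel. -/
theorem lintegral_sq_superposition_le {n : ℕ} {Z : Type*} [MeasurableSpace Z] (m : Measure Z)
    [IsFiniteMeasure m] {e : Z → E n → ℂ} (he : Measurable (Function.uncurry e))
    (he1 : ∀ z ξ, ‖e z ξ‖ ≤ 1) {κ : E n → E n → ℝ} (hκ : Measurable (Function.uncurry κ))
    (hκ0 : ∀ ξ η, 0 ≤ κ ξ η) (hκs : ∀ ξ η, κ ξ η = κ η ξ)
    (hGram : ∀ ξ η, ‖∫ z, e z ξ * starRingEnd ℂ (e z η) ∂m‖ ≤ κ ξ η)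
    {ρ : E n → ℝ} (hρ : Measurable ρ) (hρ0 : ∀ ξ, 0 < ρ ξ) {C : ℝ≥0∞}
    (hC : ∀ ξ, ∫⁻ η, ENNReal.ofReal (ρ η * κ ξ η) ≤ C)
    {w : E n → ℂ} (hw : Measurable w) (hwi : Integrable w) :
    ∫⁻ z, ‖∫ ξ, w ξ * e z ξ‖ₑ ^ 2 ∂m ≤ C * ∫⁻ ξ, ENNReal.ofReal (‖w ξ‖ ^ 2 / ρ ξ) := by
  set g : Z → ℂ := fun z => ∫ ξ, w ξ * e z ξ with hg
  have hem : ∀ z, Measurable (e z) := fun z => he.comp measurable_prodMk_left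
  have hint : ∀ z, Integrable fun ξ => w ξ * e z ξ := fun z =>
    hwi.mul_bdd (hem z).aestronglyMeasurable (Eventually.of_forall (he1 z))
  have hgb : ∀ z, ‖g z‖ ≤ ∫ ξ, ‖w ξ‖ := fun z => by
    refine norm_integral_le_of_norm_le hwi.norm (Eventually.of_forall fun ξ => ?_)
    rw [norm_mul]
    exact mul_le_of_le_one_right (norm_nonneg _) (he1 z ξ)
  have hgm : StronglyMeasurable g := by
    refine StronglyMeasurable.integral_prod_right' (f := fun p : Z × E n => w p.2 * e p.1 p.2) ?_
    exact ((hw.comp measurable_snd).mul he).stronglyMeasurable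
  -- the square of the norm as a double integral
  let Φ : Z → E n × E n → ℂ := fun z p => (w p.1 * e z p.1) * starRingEnd ℂ (w p.2 * e z p.2)
  have hwm : Integrable (fun p : E n × E n => w p.1 * starRingEnd ℂ (w p.2))
      (volume.prod volume) :=
    hwi.mul_prod (f := w) (g := fun ξ => starRingEnd ℂ (w ξ))
      (hwi.mono (Complex.continuous_conj.comp_aestronglyMeasurable hwi.1)
        (Eventually.of_forall fun ξ => by simp))
  have hΦm : Measurable (Function.uncurry Φ) := by
    have h1 : Measurable fun q : Z × E n × E n => w q.2.1 * e q.1 q.2.1 :=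
      (hw.comp (measurable_fst.comp measurable_snd)).mul
        (he.comp (measurable_fst.prodMk (measurable_fst.comp measurable_snd)))
    have h2 : Measurable fun q : Z × E n × E n => w q.2.2 * e q.1 q.2.2 :=
      (hw.comp (measurable_snd.comp measurable_snd)).mul
        (he.comp (measurable_fst.prodMk (measurable_snd.comp measurable_snd)))
    exact h1.mul (Complex.continuous_conj.measurable.comp h2)
  have hΦi : Integrable (Function.uncurry Φ) (m.prod (volume.prod volume)) := by
    refine (hwm.comp_snd m).mono hΦm.aestronglyMeasurable (Eventually.of_forall fun q => ?_)
    simp only [Function.uncurry, Φ, norm_mul, RCLike.norm_conj]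
    calc _ ≤ ‖w q.2.1‖ * 1 * (‖w q.2.2‖ * 1) := by
          gcongr
          · exact he1 _ _
          · exact he1 _ _
      _ = _ := by ring
  have hsq : ∀ z, ((‖g z‖ ^ 2 : ℝ) : ℂ) = ∫ p, Φ z p ∂(volume.prod volume) := fun z => by
    rw [integral_prod_mul (fun ξ => w ξ * e z ξ) (fun ξ => starRingEnd ℂ (w ξ * e z ξ)),
      integral_conj, Complex.mul_conj']
    push_cast
    rfl
  have h1 : ((∫ z, ‖g z‖ ^ 2 ∂m : ℝ) : ℂ) = ∫ p, ∫ z, Φ z p ∂m ∂(volume.prod volume) := by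
    rw [← integral_integral_swap hΦi, ← integral_complex_ofReal]
    simp only [hsq]
  have h2 : ∀ p : E n × E n, ‖∫ z, Φ z p ∂m‖ₑ ≤
      ENNReal.ofReal (‖w p.1‖ * ‖w p.2‖ * κ p.1 p.2) := fun p => by
    have : ∀ z, Φ z p = (w p.1 * starRingEnd ℂ (w p.2)) * (e z p.1 * starRingEnd ℂ (e z p.2)) :=
      fun z => by simp only [Φ, map_mul]; ring
    simp only [this]
    rw [integral_const_mul, ← ofReal_norm, norm_mul, norm_mul, RCLike.norm_conj]
    exact ENNReal.ofReal_le_ofReal (by gcongr; exact hGram _ _)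
  -- the arithmetic-geometric mean inequality, with the weights of the Schur test
  have h3 : ∀ p : E n × E n, ENNReal.ofReal (‖w p.1‖ * ‖w p.2‖ * κ p.1 p.2) ≤
      2⁻¹ * (ENNReal.ofReal (‖w p.1‖ ^ 2 / ρ p.1) * ENNReal.ofReal (ρ p.2 * κ p.1 p.2)) +
      2⁻¹ * (ENNReal.ofReal (‖w p.2‖ ^ 2 / ρ p.2) * ENNReal.ofReal (ρ p.1 * κ p.1 p.2)) :=
    fun p => by
    have r1 := hρ0 p.1
    have r2 := hρ0 p.2
    have hk := hκ0 p.1 p.2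
    have e2 : (2⁻¹ : ℝ≥0∞) = ENNReal.ofReal 2⁻¹ := by
      rw [ENNReal.ofReal_inv_of_pos two_pos]; simp
    rw [e2, ← ENNReal.ofReal_mul (by positivity), ← ENNReal.ofReal_mul (by positivity),
      ← ENNReal.ofReal_mul (by positivity), ← ENNReal.ofReal_mul (by positivity),
      ← ENNReal.ofReal_add (by positivity) (by positivity)]
    refine ENNReal.ofReal_le_ofReal ?_
    have : ‖w p.1‖ * ‖w p.2‖ ≤ 2⁻¹ * (‖w p.1‖ ^ 2 / ρ p.1 * ρ p.2) +
        2⁻¹ * (‖w p.2‖ ^ 2 / ρ p.2 * ρ p.1) := by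
      rw [← sub_nonneg]
      have : 2⁻¹ * (‖w p.1‖ ^ 2 / ρ p.1 * ρ p.2) + 2⁻¹ * (‖w p.2‖ ^ 2 / ρ p.2 * ρ p.1) -
          ‖w p.1‖ * ‖w p.2‖ =
          2⁻¹ * ((‖w p.1‖ * ρ p.2 - ‖w p.2‖ * ρ p.1) ^ 2 / (ρ p.1 * ρ p.2)) := by
        field_simp; ring
      rw [this]
      positivity
    calc _ ≤ (2⁻¹ * (‖w p.1‖ ^ 2 / ρ p.1 * ρ p.2) + 2⁻¹ * (‖w p.2‖ ^ 2 / ρ p.2 * ρ p.1)) *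
          κ p.1 p.2 := by gcongr
      _ = _ := by ring
  have hWm : Measurable fun ξ => ENNReal.ofReal (‖w ξ‖ ^ 2 / ρ ξ) :=
    ((hw.norm.pow_const 2).div hρ).ennreal_ofReal
  have hκρ : Measurable fun p : E n × E n => ENNReal.ofReal (ρ p.2 * κ p.1 p.2) :=
    ((hρ.comp measurable_snd).mul hκ).ennreal_ofReal
  have hκρ' : Measurable fun p : E n × E n => ENNReal.ofReal (ρ p.1 * κ p.1 p.2) :=
    ((hρ.comp measurable_fst).mul hκ).ennreal_ofReal
  have M1 : Measurable fun p : E n × E n => ENNReal.ofReal (‖w p.1‖ ^ 2 / ρ p.1) *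
      ENNReal.ofReal (ρ p.2 * κ p.1 p.2) := (hWm.comp measurable_fst).mul hκρ
  have M2 : Measurable fun p : E n × E n => ENNReal.ofReal (‖w p.2‖ ^ 2 / ρ p.2) *
      ENNReal.ofReal (ρ p.1 * κ p.1 p.2) := (hWm.comp measurable_snd).mul hκρ'
  set I := ∫⁻ ξ, ENNReal.ofReal (‖w ξ‖ ^ 2 / ρ ξ) with hI
  have h4 : ∫⁻ p : E n × E n, ENNReal.ofReal (‖w p.1‖ ^ 2 / ρ p.1) *
      ENNReal.ofReal (ρ p.2 * κ p.1 p.2) ∂(volume.prod volume) ≤ C * I := by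
    rw [lintegral_prod _ M1.aemeasurable, hI,
      ← lintegral_const_mul _ hWm]
    refine lintegral_mono fun ξ => ?_
    dsimp only
    rw [lintegral_const_mul' _ _ ENNReal.ofReal_ne_top, mul_comm]
    gcongr
    exact hC ξ
  have h5 : ∫⁻ p : E n × E n, ENNReal.ofReal (‖w p.2‖ ^ 2 / ρ p.2) *
      ENNReal.ofReal (ρ p.1 * κ p.1 p.2) ∂(volume.prod volume) ≤ C * I := by
    rw [lintegral_prod_symm _ M2.aemeasurable, hI,
      ← lintegral_const_mul _ hWm]
    refine lintegral_mono fun ξ => ?_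
    dsimp only
    rw [lintegral_const_mul' _ _ ENNReal.ofReal_ne_top, mul_comm]
    gcongr
    refine le_trans (le_of_eq ?_) (hC ξ)
    exact lintegral_congr fun η => by rw [hκs]
  have h6 : ∫⁻ z, ‖g z‖ₑ ^ 2 ∂m = ENNReal.ofReal (∫ z, ‖g z‖ ^ 2 ∂m) := by
    rw [ofReal_integral_eq_lintegral_ofReal]
    · refine lintegral_congr fun z => ?_
      rw [← ofReal_norm, ENNReal.ofReal_pow (norm_nonneg _)]
    · refine Integrable.of_bound (hgm.measurable.norm.pow_const 2).aestronglyMeasurable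
        ((∫ ξ, ‖w ξ‖) ^ 2) (Eventually.of_forall fun z => ?_)
      rw [norm_pow, norm_norm]
      gcongr
      exact hgb z
    · exact Eventually.of_forall fun z => by positivity
  rw [h6, ← Real.norm_of_nonneg (integral_nonneg fun z => by positivity), ← Complex.norm_real, h1,
    ofReal_norm]
  refine (enorm_integral_le_lintegral_enorm _).trans ?_
  calc _ ≤ ∫⁻ p : E n × E n,
      (2⁻¹ * (ENNReal.ofReal (‖w p.1‖ ^ 2 / ρ p.1) * ENNReal.ofReal (ρ p.2 * κ p.1 p.2)) +
      2⁻¹ * (ENNReal.ofReal (‖w p.2‖ ^ 2 / ρ p.2) * ENNReal.ofReal (ρ p.1 * κ p.1 p.2)))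
        ∂(volume.prod volume) := lintegral_mono fun p => (h2 p).trans (h3 p)
    _ ≤ 2⁻¹ * (C * I) + 2⁻¹ * (C * I) := by
      rw [lintegral_add_left (M1.const_mul _), lintegral_const_mul _ M1, lintegral_const_mul _ M2]
      gcongr
    _ = C * I := by
      rw [← add_mul, ENNReal.inv_two_add_inv_two, one_mul]

/-! ### Gaussian weights -/

section Gaussian

variable {V : Type*} [NormedAddCommGroup V] [InnerProductSpace ℝ V] [FiniteDimensional ℝ V]
  [MeasurableSpace V] [BorelSpace V]

/-- The measure with density `exp (-π |x - c|²)`. -/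
noncomputable def gaussianMeasure (c : V) : Measure V :=
  volume.withDensity fun x => ENNReal.ofReal (Real.exp (-Real.pi * ‖x - c‖ ^ 2))

theorem integrable_gaussian (c : V) :
    Integrable fun x : V => Real.exp (-Real.pi * ‖x - c‖ ^ 2) := by
  have h : Integrable fun x : V => Real.exp (-Real.pi * ‖x‖ ^ 2) := by
    have := (GaussianFourier.integrable_cexp_neg_mul_sq_norm_add (V := V) (b := (Real.pi : ℂ))
      (by simpa using Real.pi_pos) 0 0).norm
    refine this.congr (Eventually.of_forall fun x => ?_)
    simp only [zero_mul, add_zero]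
    rw [Complex.norm_exp]
    congr 1
    rw [← Complex.ofReal_pow, ← Complex.ofReal_neg, ← Complex.ofReal_mul, Complex.ofReal_re]
  exact h.comp_sub_right c

theorem isFiniteMeasure_gaussianMeasure (c : V) : IsFiniteMeasure (gaussianMeasure c) :=
  isFiniteMeasure_withDensity_ofReal (integrable_gaussian c).2

/-- The Fourier transform of a translated Gaussian, up to the phase due to the translation. -/
theorem norm_integral_exp_gaussianMeasure (c w : V) :
    ‖∫ x, Complex.exp (((2 * Real.pi * inner ℝ x w : ℝ) : ℂ) * Complex.I) ∂(gaussianMeasure c)‖ =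
      Real.exp (-Real.pi * ‖w‖ ^ 2) := by
  have hm : Measurable fun x : V => ENNReal.ofReal (Real.exp (-Real.pi * ‖x - c‖ ^ 2)) := by
    fun_prop
  rw [gaussianMeasure, integral_withDensity_eq_integral_toReal_smul hm
    (Eventually.of_forall fun _ => ENNReal.ofReal_lt_top),
    ← integral_add_right_eq_self _ c]
  have : ∀ x : V, (ENNReal.ofReal (Real.exp (-Real.pi * ‖x + c - c‖ ^ 2))).toReal •
      Complex.exp (((2 * Real.pi * inner ℝ (x + c) w : ℝ) : ℂ) * Complex.I) =
      Complex.exp (-(Real.pi : ℂ) * ‖x‖ ^ 2 + (2 * Real.pi * Complex.I) * inner ℝ w x) *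
        Complex.exp (((2 * Real.pi * inner ℝ c w : ℝ) : ℂ) * Complex.I) := fun x => by
    rw [ENNReal.toReal_ofReal (Real.exp_pos _).le, add_sub_cancel_right, Complex.real_smul,
      Complex.ofReal_exp, ← Complex.exp_add, ← Complex.exp_add, inner_add_left,
      real_inner_comm w x]
    congr 1
    push_cast
    ring
  simp only [this]
  rw [integral_mul_const, norm_mul, Complex.norm_exp_ofReal_mul_I, mul_one,
    GaussianFourier.integral_cexp_neg_mul_sq_norm_add (by simpa using Real.pi_pos),
    div_self (by exact_mod_cast Real.pi_ne_zero), Complex.one_cpow, one_mul, Complex.norm_exp]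
  congr 1
  have : (2 * (Real.pi : ℂ) * Complex.I) ^ 2 * (‖w‖ : ℂ) ^ 2 / (4 * Real.pi) =
      ((-Real.pi * ‖w‖ ^ 2 : ℝ) : ℂ) := by
    have h : (Real.pi : ℂ) ≠ 0 := by exact_mod_cast Real.pi_ne_zero
    push_cast
    field_simp
    rw [Complex.I_sq]
    ring
  rw [this, Complex.ofReal_re]

/-- Lebesgue measure on a bounded set is dominated by a Gaussian measure. -/
theorem restrict_le_gaussianMeasure (c : V) {r : ℝ} {S : Set V}
    (hS : ∀ x ∈ S, ‖x - c‖ ≤ r) :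
    volume.restrict S ≤ ENNReal.ofReal (Real.exp (Real.pi * r ^ 2)) • gaussianMeasure c := by
  have hm : Measurable fun x : V => ENNReal.ofReal (Real.exp (-Real.pi * ‖x - c‖ ^ 2)) := by
    fun_prop
  refine Measure.le_iff.2 fun A hA => ?_
  rw [Measure.smul_apply, smul_eq_mul, gaussianMeasure, withDensity_apply _ hA,
    ← lintegral_const_mul _ hm, Measure.restrict_apply hA, ← setLIntegral_one]
  refine (setLIntegral_mono (g := fun x => ENNReal.ofReal (Real.exp (Real.pi * r ^ 2)) *
    ENNReal.ofReal (Real.exp (-Real.pi * ‖x - c‖ ^ 2))) (by fun_prop) fun x hx => ?_).trans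
    (lintegral_mono_set Set.inter_subset_left)
  rw [← ENNReal.ofReal_mul (Real.exp_pos _).le, ← Real.exp_add]
  refine ENNReal.one_le_ofReal.2 (Real.one_le_exp ?_)
  have h1 := hS x hx.2
  have h2 : ‖x - c‖ ^ 2 ≤ r ^ 2 := by gcongr
  nlinarith [Real.pi_pos]

end Gaussian

/-! ### The kernel estimate behind local smoothing -/

/-- In one dimension the weight `1 + |z|` is dominated by the derivative of the phase, away from a
compact set, so that a change of variables gives a bound that is uniform in the shift `A`. -/
theorem exists_lintegral_phase_le (b c : ℝ) (hc : 0 < c) : ∃ C : ℝ≥0∞, C ≠ ⊤ ∧ ∀ A : ℝ,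
    ∫⁻ z : ℝ, ENNReal.ofReal ((1 + |z|) *
      Real.exp (-c * (A - ((2 * Real.pi * z) ^ 2 + 2 * Real.pi * (b * z))) ^ 2)) ≤ C := by
  set M : ℝ := |b| + 1 with hM
  have hM1 : 1 ≤ M := by rw [hM]; linarith [abs_nonneg b]
  set φ : ℝ → ℝ := fun z => (2 * Real.pi * z) ^ 2 + 2 * Real.pi * (b * z) with hφ
  set φ' : ℝ → ℝ := fun z => 8 * Real.pi ^ 2 * z + 2 * Real.pi * b with hφ'
  have hd : ∀ z, HasDerivAt φ (φ' z) z := fun z => by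
    have h1 := ((hasDerivAt_id z).const_mul (2 * Real.pi)).pow 2
    have h2 := ((hasDerivAt_id z).const_mul b).const_mul (2 * Real.pi)
    refine (h1.add h2).congr_deriv ?_
    simp [hφ']
    ring
  have hpi := Real.pi_gt_three
  have hbM : |b| ≤ M := by rw [hM]; linarith
  -- for `|z| ≥ M` the derivative `φ'` of the phase dominates the weight
  have hweight : ∀ z, M ≤ |z| → 1 + |z| ≤ |φ' z| := fun z hz => by
    have h1 : |8 * Real.pi ^ 2 * z| - |2 * Real.pi * b| ≤ |φ' z| := by
      have := abs_sub_abs_le_abs_sub (8 * Real.pi ^ 2 * z) (-(2 * Real.pi * b))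
      rwa [abs_neg, sub_neg_eq_add] at this
    rw [abs_mul (8 * Real.pi ^ 2), abs_mul (2 * Real.pi),
      abs_of_pos (by positivity : (0 : ℝ) < 8 * Real.pi ^ 2),
      abs_of_pos (by positivity : (0 : ℝ) < 2 * Real.pi)] at h1
    have h2 : 2 * Real.pi * |b| ≤ 2 * Real.pi * |z| :=
      mul_le_mul_of_nonneg_left (hbM.trans hz) (by positivity)
    have h3 : 2 * |z| ≤ (8 * Real.pi ^ 2 - 2 * Real.pi) * |z| := by
      gcongr
      nlinarith
    nlinarith
  -- `φ x - φ y` is `x - y` times an affine function of `x + y`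
  have hinj : ∀ S : Set ℝ, (∀ x ∈ S, ∀ y ∈ S, 2 * M ≤ |x + y|) → Set.InjOn φ S := by
    intro S hS x hx y hy hxy
    have h1 : (x - y) * (4 * Real.pi ^ 2 * (x + y) + 2 * Real.pi * b) = 0 := by
      simp only [hφ] at hxy
      linear_combination hxy
    rcases mul_eq_zero.1 h1 with h | h
    · linarith
    · exfalso
      have h2 : 4 * Real.pi ^ 2 * (x + y) = -(2 * Real.pi * b) := by linarith
      have h3 := congrArg abs h2
      rw [abs_neg, abs_mul (4 * Real.pi ^ 2), abs_mul (2 * Real.pi),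
        abs_of_pos (by positivity : (0 : ℝ) < 4 * Real.pi ^ 2),
        abs_of_pos (by positivity : (0 : ℝ) < 2 * Real.pi)] at h3
      have h4 := hS x hx y hy
      have h5 : 4 * Real.pi ^ 2 * (2 * M) ≤ 2 * Real.pi * M := by
        calc _ ≤ 4 * Real.pi ^ 2 * |x + y| := by gcongr
          _ = 2 * Real.pi * |b| := h3
          _ ≤ _ := by gcongr
      nlinarith [mul_pos Real.pi_pos (by linarith : (0 : ℝ) < M)]
  set G : ℝ≥0∞ := ∫⁻ y : ℝ, ENNReal.ofReal (Real.exp (-c * y ^ 2)) with hG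
  have hGtop : G ≠ ⊤ := (integrable_exp_neg_mul_sq hc).lintegral_lt_top.ne
  have hpiece : ∀ (S : Set ℝ), MeasurableSet S → (∀ x ∈ S, ∀ y ∈ S, 2 * M ≤ |x + y|) →
      (∀ x ∈ S, M ≤ |x|) → ∀ A : ℝ, ∫⁻ z in S, ENNReal.ofReal ((1 + |z|) *
        Real.exp (-c * (A - φ z) ^ 2)) ≤ G := by
    intro S hSm hS hS' A
    calc _ ≤ ∫⁻ z in S, ENNReal.ofReal |φ' z| *
          (fun y => ENNReal.ofReal (Real.exp (-c * (A - y) ^ 2))) (φ z) := by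
          refine setLIntegral_mono' hSm fun z hz => ?_
          rw [← ENNReal.ofReal_mul (abs_nonneg _)]
          refine ENNReal.ofReal_le_ofReal ?_
          gcongr
          exact hweight z (hS' z hz)
      _ = ∫⁻ y in φ '' S, ENNReal.ofReal (Real.exp (-c * (A - y) ^ 2)) :=
          (lintegral_image_eq_lintegral_abs_deriv_mul hSm
            (fun z _ => (hd z).hasDerivWithinAt) (hinj S hS)
            (fun y => ENNReal.ofReal (Real.exp (-c * (A - y) ^ 2)))).symm
      _ ≤ ∫⁻ y, ENNReal.ofReal (Real.exp (-c * (A - y) ^ 2)) := setLIntegral_le_lintegral _ _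
      _ = G := lintegral_sub_left_eq_self (fun y => ENNReal.ofReal (Real.exp (-c * y ^ 2))) A
  refine ⟨G + G + ENNReal.ofReal (1 + M) * volume (Set.Icc (-M) M), ?_, fun A => ?_⟩
  · simp only [Real.volume_Icc]
    exact ENNReal.add_ne_top.2 ⟨ENNReal.add_ne_top.2 ⟨hGtop, hGtop⟩,
      ENNReal.mul_ne_top ENNReal.ofReal_ne_top ENNReal.ofReal_ne_top⟩
  · have hcover : (Set.univ : Set ℝ) ⊆ (Set.Ici M ∪ Set.Iic (-M)) ∪ Set.Icc (-M) M := by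
      intro z _
      rcases le_total M z with h | h
      · exact Or.inl (Or.inl h)
      · rcases le_total z (-M) with h' | h'
        · exact Or.inl (Or.inr h')
        · exact Or.inr ⟨h', h⟩
    rw [← setLIntegral_univ]
    refine (lintegral_mono_set hcover).trans ((lintegral_union_le _ _ _).trans ?_)
    refine add_le_add ((lintegral_union_le _ _ _).trans (add_le_add ?_ ?_)) ?_
    · refine hpiece _ measurableSet_Ici (fun x hx y hy => ?_) (fun x hx => ?_) A
      · rw [Set.mem_Ici] at hx hy
        exact le_trans (by linarith) (le_abs_self _)
      · exact le_trans hx (le_abs_self _)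
    · refine hpiece _ measurableSet_Iic (fun x hx y hy => ?_) (fun x hx => ?_) A
      · rw [Set.mem_Iic] at hx hy
        exact le_trans (by linarith) (neg_le_abs _)
      · rw [Set.mem_Iic] at hx
        exact le_trans (by linarith) (neg_le_abs _)
    · rw [← setLIntegral_const]
      refine setLIntegral_mono' measurableSet_Icc fun z hz => ENNReal.ofReal_le_ofReal ?_
      have h1 : |z| ≤ M := abs_le.2 hz
      calc _ ≤ (1 + M) * 1 := by
            gcongr
            exact Real.exp_le_one_iff.2 (by nlinarith [sq_nonneg (A - φ z)])
        _ = 1 + M := mul_one _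

/-- The Fourier transform, up to a phase, of the weight in the space variable: a Dirac mass if
`n = 1` and a Gaussian otherwise. -/
noncomputable def weightHat (n : ℕ) (ζ : E n) : ℝ :=
  if n = 1 then 1 else Real.exp (-Real.pi * ‖ζ‖ ^ 2)

theorem weightHat_pos {n : ℕ} (ζ : E n) : 0 < weightHat n ζ := by
  unfold weightHat; split_ifs <;> positivity

theorem weightHat_neg {n : ℕ} (ζ : E n) : weightHat n (-ζ) = weightHat n ζ := by
  simp [weightHat]

theorem measurable_weightHat (n : ℕ) : Measurable (weightHat n) := by
  unfold weightHat
  split_ifs <;> fun_prop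

/-- Each of the coordinates may be dropped from the Gaussian. -/
theorem weightHat_le {m : ℕ} (j : Fin (m + 1)) (ζ : E (m + 1)) :
    weightHat (m + 1) ζ ≤ Real.exp (-Real.pi * ∑ i : Fin m, ζ (j.succAbove i) ^ 2) := by
  unfold weightHat
  split_ifs with h
  · have : m = 0 := by omega
    subst this
    simp
  · refine Real.exp_le_exp.2 ?_
    rw [EuclideanSpace.real_norm_sq_eq, Fin.sum_univ_succAbove _ j]
    nlinarith [Real.pi_pos, sq_nonneg (ζ j)]

theorem lintegral_gaussian_pi_ne_top (m : ℕ) :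
    ∫⁻ y : Fin m → ℝ, ENNReal.ofReal (Real.exp (-Real.pi * ∑ i, y i ^ 2)) ≠ ⊤ := by
  have : ∀ y : Fin m → ℝ, Real.exp (-Real.pi * ∑ i, y i ^ 2) =
      ∏ i, Real.exp (-Real.pi * y i ^ 2) := fun y => by
    rw [← Real.exp_sum, Finset.mul_sum]
  simp only [this]
  exact (Integrable.fintype_prod (f := fun _ (x : ℝ) => Real.exp (-Real.pi * x ^ 2))
    fun _ => integrable_exp_neg_mul_sq Real.pi_pos).lintegral_lt_top.ne

/-- The phase is the sum of its parts along one coordinate axis and transversal to it. -/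
theorem phase_eq_succAbove {m : ℕ} (v η : E (m + 1)) (j : Fin (m + 1)) :
    phase v η = ((2 * Real.pi * η j) ^ 2 + 2 * Real.pi * (v j * η j)) +
      ∑ i : Fin m, ((2 * Real.pi * η (j.succAbove i)) ^ 2 +
        2 * Real.pi * (v (j.succAbove i) * η (j.succAbove i))) := by
  have h1 : (2 * Real.pi * ‖η‖) ^ 2 = ∑ i, (2 * Real.pi * η i) ^ 2 := by
    rw [mul_pow, EuclideanSpace.real_norm_sq_eq, Finset.mul_sum]
    exact Finset.sum_congr rfl fun i _ => by ring
  have h2 : 2 * Real.pi * inner ℝ v η = ∑ i, 2 * Real.pi * (v i * η i) := by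
    rw [PiLp.inner_apply, Finset.mul_sum]
    exact Finset.sum_congr rfl fun i _ => by simp [mul_comm]
  rw [phase, h1, h2, ← Finset.sum_add_distrib, Fin.sum_univ_succAbove _ j]

/-- The Schur bound in the direction of one coordinate. -/
theorem exists_lintegral_kernel_coord_le {m : ℕ} (v : E (m + 1)) (c : ℝ) (hc : 0 < c)
    (j : Fin (m + 1)) : ∃ C : ℝ≥0∞, C ≠ ⊤ ∧ ∀ ξ : E (m + 1),
    ∫⁻ η : E (m + 1), ENNReal.ofReal ((1 + |η j|) *
      (Real.exp (-c * (phase v ξ - phase v η) ^ 2) * weightHat (m + 1) (ξ - η))) ≤ C := by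
  obtain ⟨C, hC, hCA⟩ := exists_lintegral_phase_le (v j) c hc
  refine ⟨(∫⁻ y : Fin m → ℝ, ENNReal.ofReal (Real.exp (-Real.pi * ∑ i, y i ^ 2))) * C,
    ENNReal.mul_ne_top (lintegral_gaussian_pi_ne_top m) hC, fun ξ => ?_⟩
  set Q : (Fin m → ℝ) → ℝ := fun y => ∑ i : Fin m, ((2 * Real.pi * y i) ^ 2 +
        2 * Real.pi * (v (j.succAbove i) * y i)) with hQ
  set ξ' : Fin m → ℝ := fun i => ξ (j.succAbove i) with hξ'
  let Ψ : ℝ × (Fin m → ℝ) → ℝ≥0∞ := fun p => ENNReal.ofReal ((1 + |p.1|) *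
      Real.exp (-c * ((phase v ξ - Q p.2) - ((2 * Real.pi * p.1) ^ 2 +
        2 * Real.pi * (v j * p.1))) ^ 2)) *
      ENNReal.ofReal (Real.exp (-Real.pi * ∑ i, (ξ' - p.2) i ^ 2))
  have hQm : Measurable Q := by
    rw [hQ]; fun_prop
  have hΨ : Measurable Ψ := by
    have : Measurable fun p : ℝ × (Fin m → ℝ) => Q p.2 := hQm.comp measurable_snd
    simp only [Ψ, Pi.sub_apply]
    fun_prop
  have hmp := (volume_preserving_piFinSuccAbove (fun _ : Fin (m + 1) => ℝ) j).comp
    (EuclideanSpace.volume_preserving_symm_measurableEquiv_toLp (Fin (m + 1)))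
  calc _ ≤ ∫⁻ η : E (m + 1), Ψ (η j, fun i => η (j.succAbove i)) := by
        refine lintegral_mono fun η => ?_
        simp only [Ψ]
        rw [← ENNReal.ofReal_mul (by positivity)]
        refine ENNReal.ofReal_le_ofReal ?_
        have e : phase v ξ - phase v η = (phase v ξ - Q fun i => η (j.succAbove i)) -
            ((2 * Real.pi * η j) ^ 2 + 2 * Real.pi * (v j * η j)) := by
          rw [phase_eq_succAbove v η j]
          ring
        rw [← mul_assoc, e]
        exact mul_le_mul_of_nonneg_left (weightHat_le j (ξ - η)) (by positivity)
    _ = ∫⁻ p, Ψ p := hmp.lintegral_comp hΨ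
    _ = ∫⁻ y : Fin m → ℝ, ∫⁻ z : ℝ, Ψ (z, y) := by
        rw [Measure.volume_eq_prod, lintegral_prod_symm _ hΨ.aemeasurable]
    _ ≤ ∫⁻ y : Fin m → ℝ, C * ENNReal.ofReal (Real.exp (-Real.pi * ∑ i, (ξ' - y) i ^ 2)) := by
        refine lintegral_mono fun y => ?_
        simp only [Ψ]
        rw [lintegral_mul_const' _ _ ENNReal.ofReal_ne_top]
        gcongr
        exact hCA _
    _ = _ := by
        rw [lintegral_const_mul' _ _ hC, lintegral_sub_left_eq_self
          (fun y : Fin m → ℝ => ENNReal.ofReal (Real.exp (-Real.pi * ∑ i, y i ^ 2))) ξ', mul_comm]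

theorem norm_le_sum_abs {n : ℕ} (ξ : E n) : ‖ξ‖ ≤ ∑ i, |ξ i| := by
  rw [EuclideanSpace.norm_eq]
  refine Real.sqrt_le_iff.2 ⟨Finset.sum_nonneg fun i _ => abs_nonneg _, ?_⟩
  exact Finset.sum_sq_le_sq_sum_of_nonneg fun i _ => abs_nonneg _

/-- The Schur bound with the weight `1 + |η|` that encodes the gain of half a derivative. -/
theorem exists_lintegral_kernel_le {n : ℕ} (hn : 1 ≤ n) (v : E n) (c : ℝ) (hc : 0 < c) :
    ∃ C : ℝ≥0∞, C ≠ ⊤ ∧ ∀ ξ : E n, ∫⁻ η : E n, ENNReal.ofReal ((1 + ‖η‖) *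
      (Real.exp (-c * (phase v ξ - phase v η) ^ 2) * weightHat n (ξ - η))) ≤ C := by
  obtain ⟨m, rfl⟩ : ∃ m, n = m + 1 := ⟨n - 1, by omega⟩
  choose C hC hCξ using fun j => exists_lintegral_kernel_coord_le v c hc j
  refine ⟨∑ j, C j, ENNReal.sum_ne_top.2 fun j _ => hC j, fun ξ => ?_⟩
  have hm : ∀ j : Fin (m + 1), Measurable fun η : E (m + 1) => ENNReal.ofReal ((1 + |η j|) *
      (Real.exp (-c * (phase v ξ - phase v η) ^ 2) * weightHat (m + 1) (ξ - η))) := fun j => by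
    have h1 := (continuous_phase v).measurable
    have h2 := (measurable_weightHat (m + 1)).comp (measurable_const.sub measurable_id :
      Measurable fun η : E (m + 1) => ξ - η)
    simp only [Function.comp_def] at h2
    fun_prop
  calc _ ≤ ∫⁻ η : E (m + 1), ∑ j, ENNReal.ofReal ((1 + |η j|) *
      (Real.exp (-c * (phase v ξ - phase v η) ^ 2) * weightHat (m + 1) (ξ - η))) := by
        refine lintegral_mono fun η => ?_
        have hw := weightHat_pos (ξ - η)
        rw [← ENNReal.ofReal_sum_of_nonneg fun j _ => by positivity, ← Finset.sum_mul]
        refine ENNReal.ofReal_le_ofReal ?_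
        gcongr
        rw [Finset.sum_add_distrib]
        refine add_le_add ?_ (norm_le_sum_abs η)
        simp
    _ = ∑ j, ∫⁻ η : E (m + 1), ENNReal.ofReal ((1 + |η j|) *
      (Real.exp (-c * (phase v ξ - phase v η) ^ 2) * weightHat (m + 1) (ξ - η))) :=
        lintegral_finsetSum _ fun j _ => hm j
    _ ≤ _ := Finset.sum_le_sum fun j _ => hCξ j ξ

/-! ### Local smoothing for superpositions of plane waves -/

/-- The character `ξ ↦ exp (2πi x·ξ)`. -/
noncomputable def modulation {n : ℕ} (x : E n) : UnitSymbol n where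
  toFun ξ := Complex.exp (((2 * Real.pi * inner ℝ x ξ : ℝ) : ℂ) * Complex.I)
  measurable := by fun_prop
  norm_le_one ξ := (Complex.norm_exp_ofReal_mul_I _).le

theorem modulation_apply {n : ℕ} (x ξ : E n) :
    modulation x ξ = Complex.exp (((2 * Real.pi * inner ℝ x ξ : ℝ) : ℂ) * Complex.I) := rfl

theorem continuous_modulation {n : ℕ} (ξ : E n) : Continuous fun x => modulation x ξ := by
  simp only [modulation_apply]
  fun_prop

theorem measurable_planeWave {n : ℕ} (v : E n) :
    Measurable fun p : (ℝ × E n) × E n => groupSymbol v p.1.1 p.2 * modulation p.1.2 p.2 := by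
  have := (continuous_phase v).measurable
  simp only [groupSymbol_apply, modulation_apply]
  fun_prop

theorem norm_planeWave_le {n : ℕ} (v : E n) (r : ℝ) (x ξ : E n) :
    ‖groupSymbol v r ξ * modulation x ξ‖ ≤ 1 := by
  rw [norm_mul]
  exact mul_le_one₀ ((groupSymbol v r).norm_le_one ξ) (norm_nonneg _)
    ((modulation x).norm_le_one ξ)

theorem measurable_superposition {n : ℕ} (v : E n) {w : E n → ℂ} (hw : Measurable w) :
    Measurable fun z : ℝ × E n => ∫ ξ, w ξ * (groupSymbol v z.1 ξ * modulation z.2 ξ) := by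
  have h : Measurable fun p : (ℝ × E n) × E n =>
      w p.2 * (groupSymbol v p.1.1 p.2 * modulation p.1.2 p.2) :=
    (hw.comp measurable_snd).mul (measurable_planeWave v)
  exact h.stronglyMeasurable.integral_prod_right'.measurable

/-- Gain of half a derivative for a superposition of plane waves, with respect to a Gaussian
measure in time and a measure in space whose Fourier transform decays in all directions
transversal to some coordinate axis. -/
theorem exists_lintegral_superposition_prod_le {n : ℕ} (hn : 1 ≤ n) (v : E n) :
    ∃ C : ℝ≥0∞, C ≠ ⊤ ∧ ∀ (ν : Measure (E n)) [IsFiniteMeasure ν],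
      (∀ ζ, ‖∫ x, modulation x ζ ∂ν‖ ≤ weightHat n ζ) →
      ∀ w : E n → ℂ, Measurable w → Integrable w →
      ∫⁻ z, ‖∫ ξ, w ξ * (groupSymbol v z.1 ξ * modulation z.2 ξ)‖ₑ ^ 2
        ∂((gaussianMeasure (0 : ℝ)).prod ν) ≤
      C * ∫⁻ ξ, ENNReal.ofReal (‖w ξ‖ ^ 2 / (1 + ‖ξ‖)) := by
  obtain ⟨C, hC, hCξ⟩ := exists_lintegral_kernel_le hn v (1 / (4 * Real.pi)) (by positivity)
  refine ⟨C, hC, fun ν _ hν w hw hwi => ?_⟩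
  have hfin := isFiniteMeasure_gaussianMeasure (0 : ℝ)
  have hp := (continuous_phase v).measurable
  refine lintegral_sq_superposition_le ((gaussianMeasure (0 : ℝ)).prod ν)
    (e := fun z ξ => groupSymbol v z.1 ξ * modulation z.2 ξ) (measurable_planeWave v)
    (fun z ξ => norm_planeWave_le v z.1 z.2 ξ)
    (κ := fun ξ η => Real.exp (-(1 / (4 * Real.pi)) * (phase v ξ - phase v η) ^ 2) *
      weightHat n (ξ - η)) ?_ (fun ξ η => ?_) (fun ξ η => ?_) (fun ξ η => ?_)
    (ρ := fun ξ => 1 + ‖ξ‖) (by fun_prop) (fun ξ => by positivity) hCξ hw hwi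
  · have h2 := (measurable_weightHat n).comp
      (measurable_fst.sub measurable_snd : Measurable fun p : E n × E n => p.1 - p.2)
    simp only [Function.comp_def] at h2
    have h3 : Measurable fun p : E n × E n =>
      Real.exp (-(1 / (4 * Real.pi)) * (phase v p.1 - phase v p.2) ^ 2) *
        weightHat n (p.1 - p.2) := by fun_prop
    exact h3
  · exact mul_nonneg (Real.exp_pos _).le (weightHat_pos _).le
  · rw [← weightHat_neg (ξ - η), neg_sub, ← neg_sub (phase v η), neg_sq]
  -- the Gram kernel factorizes into a time integral, which is the Fourier transform of a Gaussian
  -- at `-(p(ξ) - p(η)) / 2π`, and a space integral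
  · have h1 : ∀ z : ℝ × E n, groupSymbol v z.1 ξ * modulation z.2 ξ *
        starRingEnd ℂ (groupSymbol v z.1 η * modulation z.2 η) =
        Complex.exp (((2 * Real.pi *
          inner ℝ z.1 (-(phase v ξ - phase v η) / (2 * Real.pi)) : ℝ) : ℂ) * Complex.I) *
        modulation z.2 (ξ - η) := fun z => by
      simp only [groupSymbol_apply, modulation_apply, ← Complex.exp_conj, ← Complex.exp_add,
        map_add, map_mul, Complex.conj_ofReal, Complex.conj_I]
      congr 1
      have : 2 * Real.pi * inner ℝ z.1 (-(phase v ξ - phase v η) / (2 * Real.pi)) =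
          -(z.1 * (phase v ξ - phase v η)) := by
        simp only [RCLike.inner_apply, conj_trivial]
        field_simp
      rw [this, inner_sub_right]
      push_cast
      ring
    simp only [h1]
    rw [integral_prod_mul (fun r : ℝ => Complex.exp (((2 * Real.pi *
          inner ℝ r (-(phase v ξ - phase v η) / (2 * Real.pi)) : ℝ) : ℂ) * Complex.I))
          (fun x => modulation x (ξ - η)), norm_mul, norm_integral_exp_gaussianMeasure]
    refine mul_le_mul (le_of_eq ?_) (hν _) (norm_nonneg _) (Real.exp_pos _).le
    congr 1
    rw [Real.norm_eq_abs, sq_abs]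
    field_simp
    ring

/-- The measures against which the local smoothing norm is tested: evaluation at a point in
dimension one, and Lebesgue measure on a unit cube otherwise. -/
def IsTestMeasure (n : ℕ) (ν : Measure (E n)) : Prop :=
  if n = 1 then ∃ x, ν = Measure.dirac x else ∃ β, ν = volume.restrict (unitCube n β)

theorem norm_sub_le_of_mem_unitCube {n : ℕ} {β : Fin n → ℤ} {x y : E n} (hx : x ∈ unitCube n β)
    (hy : ∀ i, (β i : ℝ) ≤ y i ∧ y i ≤ β i + 1) : ‖x - y‖ ≤ Real.sqrt n := by
  rw [EuclideanSpace.norm_eq]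
  refine Real.sqrt_le_sqrt ?_
  calc _ ≤ ∑ _i : Fin n, (1 : ℝ) := by
        refine Finset.sum_le_sum fun i _ => ?_
        have := hx i
        have := hy i
        rw [PiLp.sub_apply, Real.norm_eq_abs, sq_abs]
        nlinarith
    _ = _ := by simp

/-- A test measure is dominated, uniformly, by one whose Fourier transform is controlled by
`weightHat`. -/
theorem IsTestMeasure.exists_le {n : ℕ} {ν₀ : Measure (E n)} (h : IsTestMeasure n ν₀) :
    ∃ ν : Measure (E n), IsFiniteMeasure ν ∧ (∀ ζ, ‖∫ x, modulation x ζ ∂ν‖ ≤ weightHat n ζ) ∧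
      ν₀ ≤ ENNReal.ofReal (Real.exp (Real.pi * Real.sqrt n ^ 2)) • ν := by
  unfold IsTestMeasure at h
  split_ifs at h with h1
  · obtain ⟨x, rfl⟩ := h
    refine ⟨Measure.dirac x, inferInstance, fun ζ => ?_, ?_⟩
    · rw [integral_dirac, weightHat, if_pos h1]
      exact (modulation x).norm_le_one ζ
    · refine Measure.le_iff.2 fun A _ => ?_
      rw [Measure.smul_apply, smul_eq_mul]
      refine le_mul_of_one_le_left' (ENNReal.one_le_ofReal.2 (Real.one_le_exp (by positivity)))
  · obtain ⟨β, rfl⟩ := h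
    let b : E n := WithLp.toLp 2 fun i => (β i : ℝ)
    refine ⟨gaussianMeasure b, isFiniteMeasure_gaussianMeasure b, fun ζ => ?_,
      restrict_le_gaussianMeasure b fun x hx => norm_sub_le_of_mem_unitCube hx fun i => ?_⟩
    · simp only [modulation_apply]
      rw [norm_integral_exp_gaussianMeasure, weightHat, if_neg h1]
    · exact ⟨le_rfl, by simp [b]⟩

theorem IsTestMeasure.sFinite {n : ℕ} {ν : Measure (E n)} (h : IsTestMeasure n ν) : SFinite ν := by
  unfold IsTestMeasure at h
  split_ifs at h with h1
  · obtain ⟨x, rfl⟩ := h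
    infer_instance
  · obtain ⟨β, rfl⟩ := h
    infer_instance

/-- Local smoothing for a superposition of plane waves, in the time variable in which the
equation is the free Schrödinger equation with drift. -/
theorem exists_lintegral_superposition_le {n : ℕ} (hn : 1 ≤ n) (v : E n) :
    ∃ C : ℝ≥0∞, C ≠ ⊤ ∧ ∀ ν : Measure (E n), IsTestMeasure n ν →
      ∀ w : E n → ℂ, Measurable w → Integrable w →
      ∫⁻ x, (∫⁻ r in Set.Icc (-1 : ℝ) 1,
        ‖∫ ξ, w ξ * (groupSymbol v r ξ * modulation x ξ)‖ₑ ^ 2) ∂ν ≤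
      C * ∫⁻ ξ, ENNReal.ofReal (‖w ξ‖ ^ 2 / (1 + ‖ξ‖)) := by
  obtain ⟨C, hC, hCν⟩ := exists_lintegral_superposition_prod_le hn v
  set D := ENNReal.ofReal (Real.exp (Real.pi * Real.sqrt n ^ 2))
  set D' := ENNReal.ofReal (Real.exp (Real.pi * 1 ^ 2))
  refine ⟨D * (D' * C), by finiteness, fun ν₀ hν₀ w hw hwi => ?_⟩
  obtain ⟨ν, hfin, hν, hle⟩ := hν₀.exists_le
  have hfin' := isFiniteMeasure_gaussianMeasure (0 : ℝ)
  have hle' : volume.restrict (Set.Icc (-1 : ℝ) 1) ≤ D' • gaussianMeasure (0 : ℝ) :=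
    restrict_le_gaussianMeasure 0 fun x hx => by
      rw [sub_zero, Real.norm_eq_abs]
      exact abs_le.2 hx
  have hm : Measurable fun z : ℝ × E n =>
    ‖∫ ξ, w ξ * (groupSymbol v z.1 ξ * modulation z.2 ξ)‖ₑ ^ 2 :=
      (measurable_superposition v hw).enorm.pow_const 2
  calc _ ≤ ∫⁻ x, (∫⁻ r, ‖∫ ξ, w ξ * (groupSymbol v r ξ * modulation x ξ)‖ₑ ^ 2
        ∂(D' • gaussianMeasure (0 : ℝ))) ∂(D • ν) :=
        lintegral_mono' hle fun x => lintegral_mono' hle' fun _ => le_rfl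
    _ = D * (D' * ∫⁻ z, ‖∫ ξ, w ξ * (groupSymbol v z.1 ξ * modulation z.2 ξ)‖ₑ ^ 2
        ∂((gaussianMeasure (0 : ℝ)).prod ν)) := by
        rw [lintegral_prod_symm _ hm.aemeasurable, lintegral_smul_measure, smul_eq_mul]
        congr 1
        simp only [lintegral_smul_measure, smul_eq_mul]
        rw [lintegral_const_mul' _ _ ENNReal.ofReal_ne_top]
    _ ≤ D * (D' * (C * ∫⁻ ξ, ENNReal.ofReal (‖w ξ‖ ^ 2 / (1 + ‖ξ‖)))) := by
        gcongr
        exact hCν ν hν w hw hwi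
    _ = _ := by ring

/-! ### The change of the time variable -/

theorem hasDerivAt_newTime {α : ℝ} (hα : 0 < α) (t : ℝ) : HasDerivAt (newTime α) (t ^ α) t := by
  have := (Real.hasDerivAt_rpow_const (x := t) (p := α + 1) (Or.inr (by linarith))).div_const
    (α + 1)
  rw [add_sub_cancel_right, mul_div_cancel_left₀ _ (by linarith : α + 1 ≠ 0)] at this
  exact this

theorem newTime_mem {α t : ℝ} (hα : 0 < α) (ht : t ∈ Set.Icc (0 : ℝ) 1) :
    newTime α t ∈ Set.Icc (0 : ℝ) 1 := by
  have h0 : 0 ≤ t ^ (α + 1) := Real.rpow_nonneg ht.1 _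
  have h1 : t ^ (α + 1) ≤ 1 := Real.rpow_le_one ht.1 ht.2 (by linarith)
  refine ⟨div_nonneg h0 (by linarith), ?_⟩
  rw [newTime, div_le_one (by linarith)]
  linarith

theorem injOn_newTime {α : ℝ} (hα : 0 < α) : Set.InjOn (newTime α) (Set.Ici 0) := by
  intro a ha b hb h
  have h' : a ^ (α + 1) = b ^ (α + 1) := by
    unfold newTime at h
    rwa [div_left_inj' (by linarith)] at h
  exact (Real.rpow_left_inj ha hb (by linarith)).1 h'

/-- The weight `t ^ α` is the Jacobian of the change to the new time; differences of new times in
`[0,1]` lie in `[-1,1]`. -/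
theorem lintegral_newTime_le {α T : ℝ} (hα : 0 < α) (hT : T ≤ 1) {b : ℝ}
    (hb : b ∈ Set.Icc (0 : ℝ) 1) (H : ℝ → ℝ≥0∞) :
    ∫⁻ t in Set.Icc (0 : ℝ) T, ENNReal.ofReal (t ^ α) * H (newTime α t - b) ≤
      ∫⁻ r in Set.Icc (-1 : ℝ) 1, H r := by
  have h := lintegral_image_eq_lintegral_abs_deriv_mul (f := fun t => newTime α t - b)
    (f' := fun t => t ^ α) (s := Set.Icc (0 : ℝ) T) measurableSet_Icc
    (fun t _ => ((hasDerivAt_newTime hα t).sub_const b).hasDerivWithinAt)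
    (fun x hx y hy hxy => injOn_newTime hα hx.1 hy.1 (sub_left_injective hxy)) H
  calc _ = ∫⁻ t in Set.Icc (0 : ℝ) T, ENNReal.ofReal |t ^ α| * H (newTime α t - b) := by
        refine setLIntegral_congr_fun measurableSet_Icc fun t ht => ?_
        rw [abs_of_nonneg (Real.rpow_nonneg ht.1 _)]
    _ = _ := h.symm
    _ ≤ _ := by
        refine lintegral_mono_set ?_
        rintro _ ⟨t, ht, rfl⟩
        have := newTime_mem hα ⟨ht.1, ht.2.trans hT⟩
        exact ⟨by linarith [this.1, hb.2], by linarith [this.2, hb.1]⟩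

/-! ### Minkowski's inequality and the local smoothing norm -/

theorem sq_rpow_half (x : ℝ≥0∞) : (x ^ (1 / 2 : ℝ)) ^ 2 = x := by
  rw [← ENNReal.rpow_natCast, ← ENNReal.rpow_mul]; norm_num

theorem lintegral_mul_le_sq {X : Type*} [MeasurableSpace X] {m : Measure X} {A B : X → ℝ≥0∞}
    (hA : Measurable A) (hB : Measurable B) :
    ∫⁻ x, A x * B x ∂m ≤
      (∫⁻ x, A x ^ 2 ∂m) ^ (1 / 2 : ℝ) * (∫⁻ x, B x ^ 2 ∂m) ^ (1 / 2 : ℝ) := by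
  have := ENNReal.lintegral_mul_le_Lp_mul_Lq m Real.HolderConjugate.two_two hA.aemeasurable
    hB.aemeasurable
  simpa using this

/-- Minkowski's integral inequality in `L²`. -/
theorem lintegral_sq_lintegral_le {X Y : Type*} [MeasurableSpace X] [MeasurableSpace Y]
    (μ : Measure X) [SFinite μ] (ν : Measure Y) [SFinite ν] {h : X → Y → ℝ≥0∞}
    (hh : Measurable (Function.uncurry h)) :
    (∫⁻ x, (∫⁻ y, h x y ∂ν) ^ 2 ∂μ) ^ (1 / 2 : ℝ) ≤
      ∫⁻ y, (∫⁻ x, h x y ^ 2 ∂μ) ^ (1 / 2 : ℝ) ∂ν := by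
  set N : Y → ℝ≥0∞ := fun y => (∫⁻ x, h x y ^ 2 ∂μ) ^ (1 / 2 : ℝ) with hN
  have hx : ∀ x, Measurable (h x) := fun x => hh.comp measurable_prodMk_left
  have hy : ∀ y, Measurable fun x => h x y := fun y => hh.comp measurable_prodMk_right
  have M1 : Measurable fun p : X × (Y × Y) => h p.1 p.2.1 * h p.1 p.2.2 :=
    (hh.comp (measurable_fst.prodMk (measurable_fst.comp measurable_snd))).mul
      (hh.comp (measurable_fst.prodMk (measurable_snd.comp measurable_snd)))
  have hNm : Measurable N := by
    have : Measurable fun p : Y × X => h p.2 p.1 ^ 2 := (hh.comp measurable_swap).pow_const 2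
    exact this.lintegral_prod_right'.pow_const _
  have key : ∫⁻ x, (∫⁻ y, h x y ∂ν) ^ 2 ∂μ ≤ (∫⁻ y, N y ∂ν) ^ 2 := by
    calc _ = ∫⁻ x, ∫⁻ q : Y × Y, h x q.1 * h x q.2 ∂(ν.prod ν) ∂μ := by
          refine lintegral_congr fun x => ?_
          rw [lintegral_prod_mul (hx x).aemeasurable (hx x).aemeasurable, sq]
      _ = ∫⁻ q : Y × Y, ∫⁻ x, h x q.1 * h x q.2 ∂μ ∂(ν.prod ν) :=
          lintegral_lintegral_swap M1.aemeasurable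
      _ ≤ ∫⁻ q : Y × Y, N q.1 * N q.2 ∂(ν.prod ν) :=
          lintegral_mono fun q => lintegral_mul_le_sq (hy q.1) (hy q.2)
      _ = _ := by rw [lintegral_prod_mul hNm.aemeasurable hNm.aemeasurable, sq]
  calc _ ≤ ((∫⁻ y, N y ∂ν) ^ 2) ^ (1 / 2 : ℝ) := by gcongr
    _ = _ := rpow_half_sq _

theorem timeNorm_sq {n : ℕ} (α T : ℝ) (g : ℝ → E n → ℂ) (x : E n) :
    timeNorm n α T g x ^ 2 =
      ∫⁻ t in Set.Icc (0 : ℝ) T, ‖((t ^ (α / 2) : ℝ) : ℂ) * g t x‖ₑ ^ 2 := sq_rpow_half _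

/-- It suffices to bound the local smoothing norm against the test measures. -/
theorem localNorm_le {n : ℕ} {α T : ℝ} {g : ℝ → E n → ℂ} {c : ℝ≥0∞}
    (h : ∀ ν, IsTestMeasure n ν → (∫⁻ x, timeNorm n α T g x ^ 2 ∂ν) ^ (1 / 2 : ℝ) ≤ c) :
    localNorm n α T g ≤ c := by
  unfold localNorm
  unfold IsTestMeasure at h
  split_ifs at h ⊢ with h1
  · refine essSup_le_of_ae_le _ (Eventually.of_forall fun x => ?_)
    have := h _ ⟨x, rfl⟩
    rwa [lintegral_dirac, rpow_half_sq] at this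
  · exact iSup_le fun β => h _ ⟨β, rfl⟩

/-! ### Functions with bounded frequencies -/

section Band

variable {n : ℕ} {σ : ℝ} (hσ : 0 ≤ σ) {A : Set (E n)} (hA : MeasurableSet A)
  (hb : Bornology.IsBounded A)

theorem continuous_fracSymbol (hσ : 0 ≤ σ) :
    Continuous fun ξ : E n => (((2 * Real.pi * ‖ξ‖) ^ σ : ℝ) : ℂ) :=
  Complex.continuous_ofReal.comp ((by fun_prop : Continuous fun ξ : E n =>
    2 * Real.pi * ‖ξ‖).rpow_const fun _ => Or.inr hσ)

theorem memLp_bandSymbol (hσ : 0 ≤ σ) (hA : MeasurableSet A) (hb : Bornology.IsBounded A)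
    (p : ℝ≥0∞) :
    MemLp (A.indicator fun ξ : E n => (((2 * Real.pi * ‖ξ‖) ^ σ : ℝ) : ℂ)) p volume := by
  obtain ⟨M, hM⟩ := hb.isCompact_closure.exists_bound_of_continuousOn
    (continuous_fracSymbol (n := n) hσ).continuousOn
  rw [memLp_indicator_iff_restrict hA]
  have : IsFiniteMeasure (volume.restrict A) := ⟨by
    rw [Measure.restrict_apply_univ]
    exact hb.measure_lt_top⟩
  exact MemLp.of_bound (continuous_fracSymbol hσ).aestronglyMeasurable M
    (ae_restrict_of_forall_mem hA fun ξ hξ => hM ξ (subset_closure hξ))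

/-- The projection on the frequencies in `A`. -/
noncomputable def band (hA : MeasurableSet A) : UnitSymbol n where
  toFun := A.indicator 1
  measurable := measurable_one.indicator hA
  norm_le_one ξ := (norm_indicator_le_norm_self _ _).trans (by simp)

/-- The value at `x` of `D^σ P f`, for the projection `P` on the frequencies in `A`. It is written as
an inner product with `𝓕 f`, so that its continuity in `(x, f)` is that of the inner product; the
sign in `modulation (-x)` is due to the conjugation. -/
noncomputable def bandEval (x : E n) (f : L2 n) : ℂ :=
  inner ℂ ((modulation (-x)).mulL2 (memLp_bandSymbol hσ hA hb 2).toLp) (𝓕 f : L2 n)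

theorem continuous_bandEval :
    Continuous fun p : E n × L2 n => bandEval hσ hA hb p.1 p.2 := by
  have h1 : Continuous fun x : E n =>
      (modulation (-x)).mulL2 (memLp_bandSymbol hσ hA hb 2).toLp := by
    simpa [Function.comp_def] using (UnitSymbol.continuous_mulL2 (fun x : E n => modulation (-x))
      (fun ξ => (continuous_modulation ξ).comp continuous_neg)).comp
      (continuous_id.prodMk (continuous_const (y := (memLp_bandSymbol hσ hA hb 2).toLp)))
  have h2 : Continuous fun f : L2 n => (𝓕 f : L2 n) := (Lp.fourierTransformₗᵢ (E n) ℂ).continuous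
  exact (h1.comp continuous_fst).inner (h2.comp continuous_snd)

/-- The evaluation of `D^σ P f` at `x`, as a linear functional on `H^s`. -/
noncomputable def bandEvalCLM {s : ℝ} (hs : 0 ≤ s) (x : E n) : Hs n s →L[ℂ] ℂ :=
  (innerSL ℂ ((modulation (-x)).mulL2 (memLp_bandSymbol hσ hA hb 2).toLp)).comp
    ((Lp.fourierTransformₗᵢ (E n) ℂ).toContinuousLinearEquiv.toContinuousLinearMap.comp
      (Hs.toL2CLM n hs))

theorem bandEval_eq (x : E n) (f : L2 n) :
    bandEval hσ hA hb x f = ∫ ξ,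
      A.indicator (fun ξ : E n => (((2 * Real.pi * ‖ξ‖) ^ σ : ℝ) : ℂ)) ξ * (𝓕 f : L2 n) ξ * modulation x ξ := by
  rw [bandEval, L2.inner_def]
  refine integral_congr_ae ?_
  filter_upwards [UnitSymbol.coeFn_mulL2 (modulation (-x)) (memLp_bandSymbol hσ hA hb 2).toLp,
    (memLp_bandSymbol hσ hA hb 2).coeFn_toLp] with ξ h1 h2
  have h3 : starRingEnd ℂ (modulation (-x) ξ) = modulation x ξ := by
    simp only [modulation_apply, ← Complex.exp_conj, map_mul, Complex.conj_ofReal, Complex.conj_I]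
    rw [inner_neg_left]
    congr 1
    push_cast
    ring
  have h4 : starRingEnd ℂ (A.indicator (fun ξ : E n => (((2 * Real.pi * ‖ξ‖) ^ σ : ℝ) : ℂ)) ξ) =
      A.indicator (fun ξ : E n => (((2 * Real.pi * ‖ξ‖) ^ σ : ℝ) : ℂ)) ξ := by
    by_cases h : ξ ∈ A
    · rw [Set.indicator_of_mem h, Complex.conj_ofReal]
    · rw [Set.indicator_of_notMem h, map_zero]
  rw [h1, h2, RCLike.inner_apply, map_mul, h3, h4]
  ring

theorem integrable_bandSymbol_mul (hσ : 0 ≤ σ) (hA : MeasurableSet A)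
    (hb : Bornology.IsBounded A) (f : L2 n) : Integrable fun ξ =>
    A.indicator (fun ξ : E n => (((2 * Real.pi * ‖ξ‖) ^ σ : ℝ) : ℂ)) ξ * (𝓕 f : L2 n) ξ :=
  (memLp_bandSymbol hσ hA hb 2).integrable_mul (Lp.memLp (𝓕 f : L2 n))

theorem bandEval_eq_fourierInv (x : E n) (f : L2 n) :
    bandEval hσ hA hb x f = (𝓕⁻ fun ξ =>
      A.indicator (fun ξ : E n => (((2 * Real.pi * ‖ξ‖) ^ σ : ℝ) : ℂ)) ξ * (𝓕 f : L2 n) ξ) x := by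
  rw [bandEval_eq, Real.fourierInv_eq']
  refine integral_congr_ae (Eventually.of_forall fun ξ => ?_)
  dsimp only
  rw [modulation_apply, smul_eq_mul, mul_comm, real_inner_comm]

/-- For bounded frequencies the distribution `D^σ P f` is the function `x ↦ bandEval x f`. -/
theorem isFracDeriv_bandEval {s : ℝ} (hs : 0 ≤ s) (f : Hs n s) :
    IsFracDeriv n σ (Hs.toL2 n s ((band hA).mulHs hs f))
      (fun x => bandEval hσ hA hb x (Hs.toL2 n s f)) := by
  intro φ
  set a : E n → ℂ := fun ξ => A.indicator (fun ξ : E n => (((2 * Real.pi * ‖ξ‖) ^ σ : ℝ) : ℂ)) ξ *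
    (𝓕 (Hs.toL2 n s f) : L2 n) ξ with ha
  have hai : Integrable a := integrable_bandSymbol_mul hσ hA hb _
  have hg : (fun x => bandEval hσ hA hb x (Hs.toL2 n s f)) = 𝓕⁻ a :=
    funext fun x => bandEval_eq_fourierInv hσ hA hb x _
  refine ⟨?_, ?_⟩
  · refine φ.integrable.bdd_mul (c := ∫ ξ, ‖a ξ‖) ?_ (Eventually.of_forall fun x => ?_)
    · rw [hg]
      exact (continuous_fourierInv_of_integrable hai).aestronglyMeasurable
    · rw [bandEval_eq_fourierInv]
      exact norm_fourierInv_le a x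
  · have h1 := integral_fourierInv_mul_eq hai φ.integrable
    rw [← hg] at h1
    rw [h1, UnitSymbol.fourier_mulHs]
    refine integral_congr_ae ?_
    filter_upwards [(band hA).coeFn_mulL2 (𝓕 (Hs.toL2 n s f) : L2 n)] with ξ hξ
    rw [hξ, SchwartzMap.fourierInv_coe, ha]
    by_cases h : ξ ∈ A
    · simp [band, h]
    · simp [band, h]

end Band

/-! ### Local smoothing for bounded frequencies -/

/-- A Fourier multiplier acting on curves in `H^s`. -/
noncomputable def UnitSymbol.mulCHs {n : ℕ} {s T : ℝ} (hs : 0 ≤ s) (m : UnitSymbol n)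
    (u : CHs n s T) : CHs n s T := ⟨fun t => m.mulHs hs (u t), by fun_prop⟩

theorem UnitSymbol.mulCHs_apply {n : ℕ} {s T : ℝ} (hs : 0 ≤ s) (m : UnitSymbol n)
    (u : CHs n s T) (t : Set.Icc (0 : ℝ) T) : m.mulCHs hs u t = m.mulHs hs (u t) := rfl

/-- The half derivative of `D^(s+1/2)` that exceeds the regularity `s` is absorbed by the weight
`(1 + r)⁻¹`. -/
theorem fracSymbol_sq_div_le {s r : ℝ} (hs : 0 ≤ s) (hr : 0 ≤ r) :
    ((2 * Real.pi * r) ^ (s + 1 / 2)) ^ 2 / (1 + r) ≤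
      2 * Real.pi * ((1 + (2 * Real.pi * r) ^ 2) ^ (s / 2)) ^ 2 := by
  have hp := Real.pi_pos
  have hx : 0 ≤ 2 * Real.pi * r := by positivity
  have h1 : ((2 * Real.pi * r) ^ (s + 1 / 2)) ^ 2 =
      ((2 * Real.pi * r) ^ 2) ^ s * (2 * Real.pi * r) := by
    rw [← Real.rpow_natCast, ← Real.rpow_mul hx, ← Real.rpow_natCast _ 2, ← Real.rpow_mul hx]
    rw [show (s + 1 / 2) * ((2 : ℕ) : ℝ) = ((2 : ℕ) : ℝ) * s + 1 by push_cast; ring,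
      Real.rpow_add_one' hx (by positivity)]
  have h2 : ((1 + (2 * Real.pi * r) ^ 2) ^ (s / 2)) ^ 2 = (1 + (2 * Real.pi * r) ^ 2) ^ s := by
    rw [← Real.rpow_natCast, ← Real.rpow_mul (by positivity)]
    congr 1
    push_cast
    ring
  have h3 : ((2 * Real.pi * r) ^ 2) ^ s ≤ (1 + (2 * Real.pi * r) ^ 2) ^ s :=
    Real.rpow_le_rpow (by positivity) (by linarith) hs
  rw [h1, h2, div_le_iff₀ (by positivity)]
  have h4 : 0 ≤ (1 + (2 * Real.pi * r) ^ 2) ^ s := by positivity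
  calc _ ≤ (1 + (2 * Real.pi * r) ^ 2) ^ s * (2 * Real.pi * r) := by gcongr
    _ = 2 * Real.pi * (1 + (2 * Real.pi * r) ^ 2) ^ s * r := by ring
    _ ≤ _ := by gcongr; linarith

section Band

variable {n : ℕ} {s : ℝ} (hs : 0 ≤ s) {A : Set (E n)} (hA : MeasurableSet A)
  (hb : Bornology.IsBounded A)

theorem bandEval_group {σ : ℝ} (hσ : 0 ≤ σ) (v : E n) (r : ℝ) (x : E n) (f : Hs n s) :
    bandEval hσ hA hb x (Hs.toL2 n s (group hs v r f)) =
      ∫ ξ, A.indicator (fun ξ : E n => (((2 * Real.pi * ‖ξ‖) ^ σ : ℝ) : ℂ)) ξ *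
        (𝓕 (Hs.toL2 n s f) : L2 n) ξ * (groupSymbol v r ξ * modulation x ξ) := by
  rw [bandEval_eq]
  have h : (𝓕 (Hs.toL2 n s (group hs v r f)) : L2 n) =
      (groupSymbol v r).mulL2 (𝓕 (Hs.toL2 n s f) : L2 n) := UnitSymbol.fourier_mulHs hs _ f
  rw [h]
  refine integral_congr_ae ?_
  filter_upwards [(groupSymbol v r).coeFn_mulL2 (𝓕 (Hs.toL2 n s f) : L2 n)] with ξ hξ
  rw [hξ]
  ring

theorem lintegral_bandSymbol_le (f : Hs n s) :
    ∫⁻ ξ, ENNReal.ofReal (‖A.indicator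
      (fun ξ : E n => (((2 * Real.pi * ‖ξ‖) ^ (s + 1 / 2) : ℝ) : ℂ)) ξ *
        (𝓕 (Hs.toL2 n s f) : L2 n) ξ‖ ^ 2 / (1 + ‖ξ‖)) ≤
      ENNReal.ofReal (2 * Real.pi) * ENNReal.ofReal ‖(band hA).mulHs hs f‖ ^ 2 := by
  rw [Hs.enorm_eq, sq_rpow_half, ← lintegral_const_mul' _ _ ENNReal.ofReal_ne_top,
    UnitSymbol.fourier_mulHs]
  refine lintegral_mono_ae ?_
  filter_upwards [(band hA).coeFn_mulL2 (𝓕 (Hs.toL2 n s f) : L2 n)] with ξ hξ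
  rw [hξ, ← ofReal_norm, ← ENNReal.ofReal_pow (norm_nonneg _),
    ← ENNReal.ofReal_mul (by positivity)]
  refine ENNReal.ofReal_le_ofReal ?_
  by_cases h : ξ ∈ A
  · have h1 : (band hA) ξ = 1 := by simp [band, h]
    rw [Set.indicator_of_mem h, h1, one_mul, norm_mul, norm_mul, Complex.norm_real,
      Complex.norm_real, Real.norm_of_nonneg (by positivity),
      Real.norm_of_nonneg (japanese_pos n s ξ).le, mul_pow, mul_pow, mul_div_right_comm,
      ← mul_assoc]
    exact mul_le_mul_of_nonneg_right (fracSymbol_sq_div_le hs (norm_nonneg ξ)) (by positivity)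
  · rw [Set.indicator_of_notMem h]
    simp only [zero_mul, norm_zero]
    rw [zero_pow two_ne_zero, zero_div]
    positivity

end Band

theorem enorm_rpow_half_mul_sq {t : ℝ} (ht : 0 ≤ t) (α : ℝ) (z : ℂ) :
    ‖((t ^ (α / 2) : ℝ) : ℂ) * z‖ₑ ^ 2 = ENNReal.ofReal (t ^ α) * ‖z‖ₑ ^ 2 := by
  rw [enorm_mul, mul_pow, ← ofReal_norm, Complex.norm_real,
    Real.norm_of_nonneg (Real.rpow_nonneg ht _), ← ENNReal.ofReal_pow (Real.rpow_nonneg ht _),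
    ← Real.rpow_natCast, ← Real.rpow_mul ht]
  congr 3
  push_cast
  ring

/-- The local smoothing estimate for solutions of the inhomogeneous linear equation, localized to
a bounded set of frequencies; the constant depends neither on that set nor on `T ≤ 1`. -/
theorem exists_smoothingNorm_band_le {n : ℕ} (hn : 1 ≤ n) (v : E n) :
    ∃ C : ℝ≥0∞, C ≠ ⊤ ∧ ∀ {α s T : ℝ} (_ : 0 < α) (hs : 0 ≤ s) (hT : 0 ≤ T) (_ : T ≤ 1)
      {A : Set (E n)} (hA : MeasurableSet A) (_ : Bornology.IsBounded A)
      {u₀ : Hs n s} {F u : CHs n s T}, IsDuhamel hs hT α v u₀ F u →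
      smoothingNorm n α s T (s + 1 / 2) ((band hA).mulCHs hs u) ≤
        C * (ENNReal.ofReal ‖(band hA).mulHs hs u₀‖ +
          ∫⁻ τ in Set.Icc (0 : ℝ) T,
            ENNReal.ofReal ‖(band hA).mulHs hs (F (Set.projIcc 0 T hT τ))‖) := by
  obtain ⟨C, hC, hCν⟩ := exists_lintegral_superposition_le hn v
  refine ⟨(C * ENNReal.ofReal (2 * Real.pi)) ^ (1 / 2 : ℝ), by finiteness, ?_⟩
  intro α s T hα hs hT hT1 A hA hb u₀ F u hu
  have hσ : 0 ≤ s + 1 / 2 := by linarith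
  set D := C * ENNReal.ofReal (2 * Real.pi) with hD
  have hcθ := continuous_newTime hα
  -- the contribution of a single free wave
  set Φ : Hs n s → ℝ → E n → ℂ := fun f r x =>
    bandEval hσ hA hb x (Hs.toL2 n s (group hs v r f)) with hΦ
  have hfree : ∀ (ν : Measure (E n)), IsTestMeasure n ν → ∀ (f : Hs n s) (b : ℝ),
      b ∈ Set.Icc (0 : ℝ) 1 →
      (∫⁻ x, (∫⁻ t in Set.Icc (0 : ℝ) T,
        ‖((t ^ (α / 2) : ℝ) : ℂ) * Φ f (newTime α t - b) x‖ₑ ^ 2) ∂ν) ^ (1 / 2 : ℝ) ≤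
      D ^ (1 / 2 : ℝ) * ENNReal.ofReal ‖(band hA).mulHs hs f‖ := by
    intro ν hν f b hb'
    have hw : Measurable fun ξ => A.indicator
        (fun ξ : E n => (((2 * Real.pi * ‖ξ‖) ^ (s + 1 / 2) : ℝ) : ℂ)) ξ *
        (𝓕 (Hs.toL2 n s f) : L2 n) ξ :=
      ((continuous_fracSymbol hσ).measurable.indicator hA).mul (measurable_coeFn _)
    have h1 := hCν ν hν _ hw (integrable_bandSymbol_mul hσ hA hb _)
    calc _ ≤ (D * ENNReal.ofReal ‖(band hA).mulHs hs f‖ ^ 2) ^ (1 / 2 : ℝ) := by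
          refine ENNReal.rpow_le_rpow ?_ (by norm_num)
          refine le_trans (lintegral_mono fun x => ?_) (h1.trans ?_)
          · refine le_trans (le_of_eq ?_) (lintegral_newTime_le hα hT1 hb'
              (fun r => ‖∫ ξ, A.indicator
                (fun ξ : E n => (((2 * Real.pi * ‖ξ‖) ^ (s + 1 / 2) : ℝ) : ℂ)) ξ *
                (𝓕 (Hs.toL2 n s f) : L2 n) ξ * (groupSymbol v r ξ * modulation x ξ)‖ₑ ^ 2))
            refine setLIntegral_congr_fun measurableSet_Icc fun t ht => ?_
            simp only [hΦ]
            rw [enorm_rpow_half_mul_sq ht.1, bandEval_group]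
          · rw [hD, mul_assoc]
            gcongr
            exact lintegral_bandSymbol_le hs hA f
      _ = _ := by rw [ENNReal.mul_rpow_of_nonneg _ _ (by norm_num), rpow_half_sq]
  -- the representative of `D^σ P u`
  set g : ℝ → E n → ℂ := fun t x =>
    bandEval hσ hA hb x (Hs.toL2 n s (u (Set.projIcc 0 T hT t))) with hg
  have hcL2 : Continuous (Hs.toL2 n s) := (Hs.toL2CLM n hs).continuous
  have hcB := continuous_bandEval hσ hA hb
  have hcomp : ∀ {Z : Type} [TopologicalSpace Z] {x : Z → E n} {f : Z → Hs n s},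
      Continuous x → Continuous f → Continuous fun z => bandEval hσ hA hb (x z)
        (Hs.toL2 n s (f z)) := fun hx hf => by
    simpa [Function.comp_def] using hcB.comp (hx.prodMk (hcL2.comp hf))
  have hcF : Continuous fun τ : ℝ => F (Set.projIcc 0 T hT τ) :=
    F.continuous.comp continuous_projIcc
  have hcu : Continuous fun τ : ℝ => u (Set.projIcc 0 T hT τ) :=
    u.continuous.comp continuous_projIcc
  have hgc : Continuous (Function.uncurry g) := hcomp continuous_snd (hcu.comp continuous_fst)
  have hrep : Represents n s T (s + 1 / 2) ((band hA).mulCHs hs u) g := by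
    refine ⟨hgc.aestronglyMeasurable, Eventually.of_forall fun t ht => ?_⟩
    have := isFracDeriv_bandEval hσ hA hb hs (u ⟨t, ht⟩)
    simp only [hg, Set.projIcc_of_mem hT ht]
    exact this
  refine (iInf₂_le g hrep).trans (localNorm_le fun ν hν => ?_)
  have hsf := hν.sFinite
  set m : Measure (E n × ℝ) := ν.prod (volume.restrict (Set.Icc (0 : ℝ) T)) with hm
  set P : E n × ℝ → ℝ≥0∞ := fun z =>
    ‖((z.2 ^ (α / 2) : ℝ) : ℂ) * Φ u₀ (newTime α z.2) z.1‖ₑ with hP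
  set Q : E n × ℝ → ℝ → ℝ≥0∞ := fun z τ => ‖((z.2 ^ (α / 2) : ℝ) : ℂ) *
    Φ (F (Set.projIcc 0 T hT τ)) (newTime α z.2 - newTime α τ) z.1‖ₑ with hQ
  have hrm : Measurable fun t : ℝ => ((t ^ (α / 2) : ℝ) : ℂ) := by fun_prop
  have hPm : Measurable P := by
    refine Measurable.enorm (Measurable.mul (hrm.comp measurable_snd) ?_)
    exact (hcomp continuous_fst (continuous_group_comp hs v (hcθ.comp continuous_snd)
      continuous_const)).measurable
  have hQm : Measurable (Function.uncurry Q) := by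
    refine Measurable.enorm (Measurable.mul
      (hrm.comp (measurable_snd.comp measurable_fst)) ?_)
    exact (hcomp (continuous_fst.comp continuous_fst) (continuous_group_comp hs v
      ((hcθ.comp (continuous_snd.comp continuous_fst)).sub (hcθ.comp continuous_snd))
      (hcF.comp continuous_snd))).measurable
  -- Duhamel's formula, evaluated at `x`
  have hpt : ∀ x, ∀ t ∈ Set.Icc (0 : ℝ) T, ‖((t ^ (α / 2) : ℝ) : ℂ) * g t x‖ₑ ≤
      P (x, t) + ∫⁻ τ in Set.Icc (0 : ℝ) T, Q (x, t) τ := by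
    intro x t ht
    have h1 : g t x = Φ u₀ (newTime α t) x + ∫ τ in (0 : ℝ)..t,
        Φ (F (Set.projIcc 0 T hT τ)) (newTime α t - newTime α τ) x := by
      simp only [hg, hΦ, Set.projIcc_of_mem hT ht]
      have h2 := congrArg (bandEvalCLM hσ hA hb hs x) (hu ⟨t, ht⟩)
      have := Hs.completeSpace (n := n) hs
      rw [map_add, ← ContinuousLinearMap.intervalIntegral_comp_comm _
        ((continuous_duhamel_integrand hs hT hα v F t).intervalIntegrable _ _)] at h2
      exact h2
    rw [h1, mul_add]
    refine (enorm_add_le _ _).trans (add_le_add le_rfl ?_)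
    rw [← intervalIntegral.integral_const_mul, intervalIntegral.integral_of_le ht.1]
    refine (enorm_integral_le_lintegral_enorm _).trans (lintegral_mono_set fun τ hτ => ?_)
    exact ⟨hτ.1.le, hτ.2.trans ht.2⟩
  calc _ ≤ (∫⁻ z, (P z + ∫⁻ τ in Set.Icc (0 : ℝ) T, Q z τ) ^ 2 ∂m) ^ (1 / 2 : ℝ) := by
        have hPQ : Measurable fun z => (P z + ∫⁻ τ in Set.Icc (0 : ℝ) T, Q z τ) ^ 2 :=
          (hPm.add hQm.lintegral_prod_right').pow_const 2
        rw [hm, lintegral_prod _ hPQ.aemeasurable]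
        refine ENNReal.rpow_le_rpow (lintegral_mono fun x => ?_) (by norm_num)
        rw [timeNorm_sq]
        refine setLIntegral_mono' measurableSet_Icc fun t ht => ?_
        gcongr
        exact hpt x t ht
    _ ≤ (∫⁻ z, P z ^ 2 ∂m) ^ (1 / 2 : ℝ) +
        (∫⁻ z, (∫⁻ τ in Set.Icc (0 : ℝ) T, Q z τ) ^ 2 ∂m) ^ (1 / 2 : ℝ) :=
        lintegral_sq_add_le hPm hQm.lintegral_prod_right'
    _ ≤ (∫⁻ z, P z ^ 2 ∂m) ^ (1 / 2 : ℝ) +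
        ∫⁻ τ in Set.Icc (0 : ℝ) T, (∫⁻ z, Q z τ ^ 2 ∂m) ^ (1 / 2 : ℝ) := by
        gcongr
        exact lintegral_sq_lintegral_le _ _ hQm
    _ ≤ D ^ (1 / 2 : ℝ) * ENNReal.ofReal ‖(band hA).mulHs hs u₀‖ +
        ∫⁻ τ in Set.Icc (0 : ℝ) T, D ^ (1 / 2 : ℝ) *
          ENNReal.ofReal ‖(band hA).mulHs hs (F (Set.projIcc 0 T hT τ))‖ := by
        refine add_le_add ?_ (setLIntegral_mono' measurableSet_Icc fun τ hτ => ?_)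
        · rw [hm, lintegral_prod _ (hPm.pow_const 2).aemeasurable]
          have := hfree ν hν u₀ 0 ⟨le_rfl, zero_le_one⟩
          simpa only [sub_zero] using this
        · have hQτ : Measurable fun z => Q z τ ^ 2 :=
            (hQm.comp measurable_prodMk_right).pow_const 2
          rw [hm, lintegral_prod _ hQτ.aemeasurable]
          exact hfree ν hν _ _ (newTime_mem hα ⟨hτ.1, hτ.2.trans hT1⟩)
    _ = _ := by
        rw [lintegral_const_mul' _ _ (by finiteness), mul_add]

/-! ### Series in the local smoothing norm -/

theorem lintegral_sq_tsum_le {X : Type*} [MeasurableSpace X] (μ : Measure X) [SFinite μ]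
    {f : ℕ → X → ℝ≥0∞} (hf : ∀ j, Measurable (f j)) :
    (∫⁻ x, (∑' j, f j x) ^ 2 ∂μ) ^ (1 / 2 : ℝ) ≤ ∑' j, (∫⁻ x, f j x ^ 2 ∂μ) ^ (1 / 2 : ℝ) := by
  have := lintegral_sq_lintegral_le μ Measure.count (h := fun x j => f j x)
    (measurable_from_prod_countable_left hf)
  simpa only [lintegral_count] using this

section Series

variable {n : ℕ} {α T : ℝ}

theorem measurable_timeNorm {g : ℝ → E n → ℂ} (hg : Measurable (Function.uncurry g)) :
    Measurable (timeNorm n α T g) := by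
  have h : Measurable fun p : E n × ℝ => ‖((p.2 ^ (α / 2) : ℝ) : ℂ) * g p.2 p.1‖ₑ ^ 2 := by
    have : Measurable fun p : E n × ℝ => g p.2 p.1 := hg.comp measurable_swap
    fun_prop
  exact h.lintegral_prod_right'.pow_const _

theorem localNorm_congr {g g' : ℝ → E n → ℂ}
    (h : timeNorm n α T g =ᵐ[volume] timeNorm n α T g') :
    localNorm n α T g = localNorm n α T g' := by
  unfold localNorm
  split_ifs
  · exact essSup_congr_ae h
  · refine iSup_congr fun β => ?_
    congr 1
    refine lintegral_congr_ae (ae_restrict_of_ae ?_)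
    filter_upwards [h] with x hx
    rw [hx]

theorem IsFracDeriv.congr {σ : ℝ} {h : L2 n} {g g' : E n → ℂ} (H : IsFracDeriv n σ h g)
    (hg : g =ᵐ[volume] g') : IsFracDeriv n σ h g' := fun φ => by
  have e : (fun x => g x * φ x) =ᵐ[volume] fun x => g' x * φ x := by
    filter_upwards [hg] with x hx
    rw [hx]
  exact ⟨(H φ).1.congr e, (integral_congr_ae e).symm.trans (H φ).2⟩

/-- A representative may be replaced by a Borel measurable one, without changing its norm. -/
theorem Represents.exists_measurable {s σ : ℝ} {u : CHs n s T} {g : ℝ → E n → ℂ}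
    (h : Represents n s T σ u g) : ∃ g' : ℝ → E n → ℂ, Measurable (Function.uncurry g') ∧
      Represents n s T σ u g' ∧ localNorm n α T g' = localNorm n α T g := by
  have hm : Measurable (h.1.mk _) := h.1.stronglyMeasurable_mk.measurable
  have hae := h.1.ae_eq_mk
  refine ⟨fun t x => h.1.mk _ (t, x), hm, ⟨hm.aestronglyMeasurable, ?_⟩, ?_⟩
  · have h1 := Measure.ae_ae_of_ae_prod hae
    rw [ae_restrict_iff' measurableSet_Icc] at h1
    filter_upwards [h1, h.2] with t h2 h3 ht
    exact (h3 ht).congr (h2 ht)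
  · refine localNorm_congr ?_
    have h1 := Measure.ae_ae_of_ae_prod
      ((Measure.measurePreserving_swap (μ := (volume : Measure (E n)))
        (ν := (volume : Measure ℝ).restrict (Set.Icc 0 T))).quasiMeasurePreserving.ae hae)
    filter_upwards [h1] with x hx
    unfold timeNorm
    congr 1
    refine lintegral_congr_ae ?_
    filter_upwards [hx] with t ht
    simp only [Prod.swap_prod_mk, Function.uncurry_apply_pair] at ht
    rw [ht]

theorem timeNorm_tsum_le {g : ℕ → ℝ → E n → ℂ} (hg : ∀ j, Measurable (Function.uncurry (g j)))
    (x : E n) : timeNorm n α T (fun t x => ∑' j, g j t x) x ≤ ∑' j, timeNorm n α T (g j) x := by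
  refine le_trans ?_ (lintegral_sq_tsum_le (volume.restrict (Set.Icc (0 : ℝ) T))
    (f := fun j t => ‖((t ^ (α / 2) : ℝ) : ℂ) * g j t x‖ₑ) fun j => ?_)
  · refine ENNReal.rpow_le_rpow (lintegral_mono fun t => ?_) (by norm_num)
    gcongr
    simp only [enorm_mul]
    rw [ENNReal.tsum_mul_left]
    gcongr
    exact enorm_tsum_le_tsum_enorm
  · have : Measurable fun t => g j t x := (hg j).comp measurable_prodMk_right
    fun_prop

theorem localNorm_tsum_le {g : ℕ → ℝ → E n → ℂ} (hg : ∀ j, Measurable (Function.uncurry (g j))) :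
    localNorm n α T (fun t x => ∑' j, g j t x) ≤ ∑' j, localNorm n α T (g j) := by
  unfold localNorm
  split_ifs
  · refine essSup_le_of_ae_le _ ?_
    filter_upwards [ae_all_iff.2 fun j => ENNReal.ae_le_essSup (μ := (volume : Measure (E n)))
      (timeNorm n α T (g j))] with x hx
    exact (timeNorm_tsum_le hg x).trans (ENNReal.tsum_le_tsum hx)
  · refine iSup_le fun β => ?_
    calc _ ≤ (∫⁻ x in unitCube n β, (∑' j, timeNorm n α T (g j) x) ^ 2) ^ (1 / 2 : ℝ) := by
          refine ENNReal.rpow_le_rpow (lintegral_mono fun x => ?_) (by norm_num)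
          gcongr
          exact timeNorm_tsum_le hg x
      _ ≤ ∑' j, (∫⁻ x in unitCube n β, timeNorm n α T (g j) x ^ 2) ^ (1 / 2 : ℝ) :=
          lintegral_sq_tsum_le _ fun j => measurable_timeNorm (hg j)
      _ ≤ _ := ENNReal.tsum_le_tsum fun j => le_iSup
          (fun β => (∫⁻ x in unitCube n β, timeNorm n α T (g j) x ^ 2) ^ (1 / 2 : ℝ)) β

theorem measurableSet_unitCube (β : Fin n → ℤ) : MeasurableSet (unitCube n β) := by
  have : unitCube n β = ⋂ i, {x : E n | (β i : ℝ) ≤ x i ∧ x i < β i + 1} := by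
    ext x
    simp [unitCube]
  rw [this]
  refine MeasurableSet.iInter fun i => ?_
  have hi : Measurable fun x : E n => x i := by fun_prop
  exact (measurableSet_le measurable_const hi).inter (measurableSet_lt hi measurable_const)

theorem volume_unitCube (β : Fin n → ℤ) : volume (unitCube n β) = 1 := by
  have h : unitCube n β = (MeasurableEquiv.toLp 2 (Fin n → ℝ)).symm ⁻¹'
      (Set.univ.pi fun i => Set.Ico (β i : ℝ) (β i + 1)) := by
    ext x
    simp [unitCube]
  rw [h, (EuclideanSpace.volume_preserving_symm_measurableEquiv_toLp (Fin n)).measure_preimage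
    (MeasurableSet.univ_pi fun i => measurableSet_Ico).nullMeasurableSet, Real.volume_pi_Ico]
  simp

theorem mem_unitCube_iff {β : Fin n → ℤ} {x : E n} :
    x ∈ unitCube n β ↔ β = fun i => ⌊x i⌋ := by
  rw [funext_iff]
  refine forall_congr' fun i => ?_
  rw [eq_comm, Int.floor_eq_iff]

theorem iUnion_unitCube : ⋃ β, unitCube n β = Set.univ :=
  Set.eq_univ_of_forall fun _ => Set.mem_iUnion.2 ⟨_, mem_unitCube_iff.2 rfl⟩

theorem pairwise_disjoint_unitCube : Pairwise (Function.onFun Disjoint (unitCube n)) :=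
  fun _ _ h => Set.disjoint_left.2 fun _ hx hy =>
    h ((mem_unitCube_iff.1 hx).trans (mem_unitCube_iff.1 hy).symm)

theorem lintegral_unitCube_timeNorm_le {g : ℝ → E n → ℂ} (hg : Measurable (Function.uncurry g))
    (β : Fin n → ℤ) : ∫⁻ x in unitCube n β, timeNorm n α T g x ≤ localNorm n α T g := by
  unfold localNorm
  split_ifs
  · calc _ ≤ ∫⁻ _ in unitCube n β, essSup (timeNorm n α T g) volume :=
          lintegral_mono_ae (ae_restrict_of_ae (ENNReal.ae_le_essSup _))
      _ = _ := by rw [setLIntegral_const, volume_unitCube, mul_one]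
  · refine le_trans ?_ (le_iSup
      (fun β => (∫⁻ x in unitCube n β, timeNorm n α T g x ^ 2) ^ (1 / 2 : ℝ)) β)
    have := lintegral_mul_le_sq (m := volume.restrict (unitCube n β))
      (measurable_timeNorm (α := α) (T := T) hg) (measurable_const (a := (1 : ℝ≥0∞)))
    simpa [volume_unitCube] using this

end Series

/-- An integrable weight on `ℝⁿ` that dominates all Schwartz functions. -/
noncomputable def tail (n : ℕ) (x : E n) : ℝ := ((1 + ‖x‖) ^ (n + 1))⁻¹

theorem tail_pos {n : ℕ} (x : E n) : 0 < tail n x := by unfold tail; positivity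

theorem continuous_tail (n : ℕ) : Continuous (tail n) := by
  unfold tail
  exact Continuous.inv₀ (by fun_prop) fun x => by positivity

theorem lintegral_tail_lt_top (n : ℕ) : ∫⁻ x : E n, ENNReal.ofReal (tail n x) < ⊤ := by
  have := finite_integral_one_add_norm (E := E n) (μ := volume) (r := ((n + 1 : ℕ) : ℝ))
    (by simp)
  refine lt_of_le_of_lt (le_of_eq (lintegral_congr fun x => ?_)) this
  rw [tail, Real.rpow_neg (by positivity), Real.rpow_natCast]

/-- The weight is comparable at any two points of a unit cube. -/
theorem tail_le_of_mem_unitCube {n : ℕ} {β : Fin n → ℤ} {x y : E n} (hx : x ∈ unitCube n β)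
    (hy : y ∈ unitCube n β) : tail n x ≤ (1 + Real.sqrt n) ^ (n + 1) * tail n y := by
  have h1 : ‖y - x‖ ≤ Real.sqrt n :=
    norm_sub_le_of_mem_unitCube hy fun i => ⟨(hx i).1, (hx i).2.le⟩
  have h2 : ‖y‖ ≤ ‖x‖ + Real.sqrt n := by
    have := norm_le_norm_add_norm_sub' y x
    linarith
  have h3 : 1 + ‖y‖ ≤ (1 + Real.sqrt n) * (1 + ‖x‖) := by
    nlinarith [norm_nonneg x, Real.sqrt_nonneg n]
  unfold tail
  rw [← div_eq_mul_inv, le_div_iff₀ (by positivity), inv_mul_le_iff₀ (by positivity), mul_comm,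
    ← mul_pow]
  gcongr

/-- The local smoothing norm controls a global weighted norm. -/
theorem exists_lintegral_tail_mul_timeNorm_le (n : ℕ) : ∃ K : ℝ≥0∞, K ≠ ⊤ ∧
    ∀ {α T : ℝ} {g : ℝ → E n → ℂ}, Measurable (Function.uncurry g) →
      ∫⁻ x, ENNReal.ofReal (tail n x) * timeNorm n α T g x ≤ K * localNorm n α T g := by
  set c := ENNReal.ofReal ((1 + Real.sqrt n) ^ (n + 1)) with hc
  have hI := lintegral_tail_lt_top n
  refine ⟨c * ∫⁻ x : E n, ENNReal.ofReal (tail n x), by finiteness, fun {α T g} hg => ?_⟩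
  have hw : Measurable fun x : E n => ENNReal.ofReal (tail n x) :=
    (continuous_tail n).measurable.ennreal_ofReal
  have hcube : ∀ β : Fin n → ℤ, ∫⁻ x in unitCube n β, ENNReal.ofReal (tail n x) *
      timeNorm n α T g x ≤
      c * localNorm n α T g * ∫⁻ y in unitCube n β, ENNReal.ofReal (tail n y) := fun β => by
    rw [← lintegral_const_mul _ hw]
    -- average over a second point `y` of the cube
    calc _ = ∫⁻ _ in unitCube n β, ∫⁻ x in unitCube n β, ENNReal.ofReal (tail n x) *
          timeNorm n α T g x := by rw [setLIntegral_const, volume_unitCube, mul_one]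
      _ ≤ _ := by
        refine setLIntegral_mono' (measurableSet_unitCube β) fun y hy => ?_
        calc _ ≤ ∫⁻ x in unitCube n β, c * ENNReal.ofReal (tail n y) * timeNorm n α T g x := by
              refine setLIntegral_mono' (measurableSet_unitCube β) fun x hx => ?_
              gcongr
              rw [hc, ← ENNReal.ofReal_mul (by positivity)]
              exact ENNReal.ofReal_le_ofReal (tail_le_of_mem_unitCube hx hy)
          _ ≤ c * ENNReal.ofReal (tail n y) * localNorm n α T g := by
              rw [lintegral_const_mul _ (measurable_timeNorm hg)]
              gcongr
              exact lintegral_unitCube_timeNorm_le hg β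
          _ = _ := by ring
  calc _ ≤ ∑' β : Fin n → ℤ, ∫⁻ x in unitCube n β, ENNReal.ofReal (tail n x) *
        timeNorm n α T g x := by
        rw [← setLIntegral_univ, ← iUnion_unitCube]
        exact lintegral_iUnion_le _ _
    _ ≤ ∑' β : Fin n → ℤ, c * localNorm n α T g *
        ∫⁻ y in unitCube n β, ENNReal.ofReal (tail n y) := ENNReal.tsum_le_tsum hcube
    _ = _ := by
        rw [ENNReal.tsum_mul_left, ← lintegral_iUnion measurableSet_unitCube
          pairwise_disjoint_unitCube, iUnion_unitCube, setLIntegral_univ]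
        ring

/-- A series that converges absolutely in the local smoothing norm converges absolutely, for
almost every time, in a weighted `L¹` space. -/
theorem ae_tsum_lintegral_tail_lt_top {n : ℕ} {α T : ℝ} {g : ℕ → ℝ → E n → ℂ}
    (hg : ∀ j, Measurable (Function.uncurry (g j)))
    (h : ∑' j, localNorm n α T (g j) ≠ ⊤) :
    ∀ᵐ t ∂volume.restrict (Set.Icc (0 : ℝ) T),
      ∑' j, ∫⁻ x, ENNReal.ofReal (tail n x) * ‖g j t x‖ₑ < ⊤ := by
  obtain ⟨K, hK, hKg⟩ := exists_lintegral_tail_mul_timeNorm_le n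
  have hw : Measurable fun x : E n => ENNReal.ofReal (tail n x) :=
    (continuous_tail n).measurable.ennreal_ofReal
  set ω : ℝ → ℝ≥0∞ := fun t => ‖((t ^ (α / 2) : ℝ) : ℂ)‖ₑ with hω
  have hωm : Measurable ω := by
    simp only [hω]
    fun_prop
  have hm : ∀ j, Measurable fun p : ℝ × E n => ω p.1 * (ENNReal.ofReal (tail n p.2) *
      ‖g j p.1 p.2‖ₑ) := fun j => by
    have := hg j
    exact (hωm.comp measurable_fst).mul ((hw.comp measurable_snd).mul this.enorm)
  have hm' : ∀ j, Measurable fun t => ∫⁻ x, ω t * (ENNReal.ofReal (tail n x) * ‖g j t x‖ₑ) :=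
    fun j => (hm j).lintegral_prod_right'
  have key : (∫⁻ t in Set.Icc (0 : ℝ) T,
      (∑' j, ∫⁻ x, ω t * (ENNReal.ofReal (tail n x) * ‖g j t x‖ₑ)) ^ 2) ^ (1 / 2 : ℝ) ≤
      K * ∑' j, localNorm n α T (g j) := by
    refine (lintegral_sq_tsum_le _ hm').trans ?_
    rw [← ENNReal.tsum_mul_left]
    refine ENNReal.tsum_le_tsum fun j => ?_
    refine (lintegral_sq_lintegral_le _ _ (hm j)).trans (le_trans (le_of_eq ?_) (hKg (hg j)))
    refine lintegral_congr fun x => ?_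
    have : ∀ t, (ω t * (ENNReal.ofReal (tail n x) * ‖g j t x‖ₑ)) ^ 2 =
        ENNReal.ofReal (tail n x) ^ 2 * ‖((t ^ (α / 2) : ℝ) : ℂ) * g j t x‖ₑ ^ 2 := fun t => by
      rw [enorm_mul]
      ring
    simp only [this]
    rw [lintegral_const_mul' _ _ (by finiteness), ENNReal.mul_rpow_of_nonneg _ _ (by norm_num),
      rpow_half_sq]
    rfl
  have hlt := lt_of_le_of_lt key (ENNReal.mul_lt_top hK.lt_top h.lt_top)
  rw [ENNReal.rpow_lt_top_iff_of_pos (by norm_num)] at hlt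
  have hae := ae_lt_top ((Measurable.tsum hm').pow_const 2) hlt.ne
  -- the weight `t ^ (α / 2)` vanishes at `t = 0` only
  have h0 : ∀ᵐ t : ℝ ∂volume.restrict (Set.Icc (0 : ℝ) T), t ≠ 0 :=
    ae_restrict_of_ae (by simp [ae_iff, measure_singleton])
  filter_upwards [hae, h0, ae_restrict_mem measurableSet_Icc] with t h1 h2 h3
  have ht : 0 < t := lt_of_le_of_ne h3.1 (Ne.symm h2)
  have hωt : ω t ≠ 0 := by
    simp only [hω, ne_eq, enorm_eq_zero]
    exact_mod_cast (Real.rpow_pos_of_pos ht _).ne'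
  have hm2 : ∀ j, ∫⁻ x, ω t * (ENNReal.ofReal (tail n x) * ‖g j t x‖ₑ) =
      ω t * ∫⁻ x, ENNReal.ofReal (tail n x) * ‖g j t x‖ₑ := fun j =>
    lintegral_const_mul' _ _ (by simp only [hω]; finiteness)
  simp only [hm2, ENNReal.tsum_mul_left] at h1
  rw [ENNReal.pow_lt_top_iff] at h1
  have h4 := h1.resolve_right two_ne_zero
  by_contra hcon
  rw [not_lt, top_le_iff] at hcon
  rw [hcon, ENNReal.mul_top hωt] at h4
  exact lt_irrefl _ h4

/-! ### Countable subadditivity of the smoothing norm -/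

section Pairing

variable {n : ℕ} {σ : ℝ}

theorem exists_fracSymbol_mul_schwartz_le (hσ : 0 ≤ σ) (ψ : 𝓢(E n, ℂ)) :
    ∃ c : ℝ, ∀ ξ, (2 * Real.pi * ‖ξ‖) ^ σ * ‖ψ ξ‖ ≤ c * tail n ξ := by
  set N := ⌈σ⌉₊
  refine ⟨(2 * Real.pi) ^ N * (2 ^ (N + (n + 1)) *
    ((Finset.Iic (N + (n + 1), 0)).sup fun m => SchwartzMap.seminorm ℂ m.1 m.2) ψ), fun ξ => ?_⟩
  have h1 := SchwartzMap.one_add_le_sup_seminorm_apply (𝕜 := ℂ) (m := (N + (n + 1), 0))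
    (k := N + (n + 1)) (n := 0) le_rfl le_rfl ψ ξ
  rw [norm_iteratedFDeriv_zero] at h1
  have hp : 1 ≤ 2 * Real.pi := by linarith [Real.pi_gt_three]
  have h2 : (2 * Real.pi * ‖ξ‖) ^ σ ≤ (2 * Real.pi) ^ N * (1 + ‖ξ‖) ^ N := by
    rw [← mul_pow]
    calc _ ≤ (2 * Real.pi * (1 + ‖ξ‖)) ^ σ :=
          Real.rpow_le_rpow (by positivity) (by gcongr; linarith) hσ
      _ ≤ (2 * Real.pi * (1 + ‖ξ‖)) ^ (N : ℝ) :=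
          Real.rpow_le_rpow_of_exponent_le
            (one_le_mul_of_one_le_of_one_le hp (by linarith [norm_nonneg ξ])) (Nat.le_ceil σ)
      _ = _ := Real.rpow_natCast _ _
  unfold tail
  rw [← div_eq_mul_inv, le_div_iff₀ (by positivity)]
  calc _ ≤ (2 * Real.pi) ^ N * (1 + ‖ξ‖) ^ N * ‖ψ ξ‖ * (1 + ‖ξ‖) ^ (n + 1) := by gcongr
    _ = (2 * Real.pi) ^ N * ((1 + ‖ξ‖) ^ (N + (n + 1)) * ‖ψ ξ‖) := by ring
    _ ≤ _ := by gcongr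

theorem memLp_tail (n : ℕ) : MemLp (tail n) 2 volume := by
  rw [memLp_two_iff_integrable_sq (continuous_tail n).aestronglyMeasurable]
  have h : Integrable (tail n) := by
    refine ⟨(continuous_tail n).aestronglyMeasurable, ?_⟩
    rw [hasFiniteIntegral_iff_ofReal (Eventually.of_forall fun x => (tail_pos x).le)]
    exact lintegral_tail_lt_top n
  refine h.mono ((continuous_tail n).pow 2).aestronglyMeasurable (Eventually.of_forall fun x => ?_)
  have h1 : tail n x ≤ 1 := inv_le_one_of_one_le₀ (one_le_pow₀ (by linarith [norm_nonneg x]))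
  rw [Real.norm_of_nonneg (by positivity), Real.norm_of_nonneg (tail_pos x).le]
  nlinarith [tail_pos x]

theorem memLp_fracSymbol_mul_schwartz (hσ : 0 ≤ σ) (ψ : 𝓢(E n, ℂ)) :
    MemLp (fun ξ => starRingEnd ℂ ((((2 * Real.pi * ‖ξ‖) ^ σ : ℝ) : ℂ) * ψ ξ)) 2 volume := by
  obtain ⟨c, hc⟩ := exists_fracSymbol_mul_schwartz_le hσ ψ
  refine MemLp.of_le_mul (c := c) (memLp_tail n) ?_ (Eventually.of_forall fun ξ => ?_)
  · exact (Complex.continuous_conj.comp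
      ((continuous_fracSymbol hσ).mul ψ.continuous)).aestronglyMeasurable
  · rw [RCLike.norm_conj, norm_mul, Complex.norm_real, Real.norm_of_nonneg (by positivity),
      Real.norm_of_nonneg (tail_pos ξ).le]
    exact hc ξ

/-- The pairing of `D^σ f` with a Schwartz function, as a continuous functional of `f ∈ L²`. -/
noncomputable def fracPairing (hσ : 0 ≤ σ) (φ : 𝓢(E n, ℂ)) : L2 n →L[ℂ] ℂ :=
  (innerSL ℂ (memLp_fracSymbol_mul_schwartz hσ (𝓕⁻ φ)).toLp).comp
    (Lp.fourierTransformₗᵢ (E n) ℂ).toContinuousLinearEquiv.toContinuousLinearMap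

theorem fracPairing_apply (hσ : 0 ≤ σ) (φ : 𝓢(E n, ℂ)) (h : L2 n) :
    fracPairing hσ φ h =
      ∫ ξ, (((2 * Real.pi * ‖ξ‖) ^ σ : ℝ) : ℂ) * (𝓕 h : L2 n) ξ * (𝓕⁻ φ : 𝓢(E n, ℂ)) ξ := by
  change inner ℂ (memLp_fracSymbol_mul_schwartz hσ (𝓕⁻ φ)).toLp (𝓕 h : L2 n) = _
  rw [L2.inner_def]
  refine integral_congr_ae ?_
  filter_upwards [(memLp_fracSymbol_mul_schwartz hσ (𝓕⁻ φ)).coeFn_toLp] with ξ hξ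
  rw [hξ, RCLike.inner_apply, Complex.conj_conj]
  ring

/-- `D^σ` of a series in `L²` is the sum of the functions that represent its terms, if these converge
absolutely in a weighted `L¹` space. -/
theorem IsFracDeriv.tsum (hσ : 0 ≤ σ) {h : L2 n} {f : ℕ → L2 n} {g : ℕ → E n → ℂ}
    (hg : ∀ j, Measurable (g j)) (hfg : ∀ j, IsFracDeriv n σ (f j) (g j))
    (hf : Tendsto (fun J => ∑ j ∈ Finset.range J, f j) atTop (𝓝 h))
    (hsum : ∑' j, ∫⁻ x, ENNReal.ofReal (tail n x) * ‖g j x‖ₑ < ⊤) :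
    IsFracDeriv n σ h fun x => ∑' j, g j x := by
  intro φ
  obtain ⟨c, hc⟩ := exists_fracSymbol_mul_schwartz_le le_rfl φ
  have hφ : ∀ x, ‖φ x‖ₑ ≤ ENNReal.ofReal c * ENNReal.ofReal (tail n x) := fun x => by
    have := hc x
    rw [Real.rpow_zero, one_mul] at this
    rw [← ENNReal.ofReal_mul' (tail_pos x).le, ← ofReal_norm]
    exact ENNReal.ofReal_le_ofReal this
  have hm : ∀ j, Measurable fun x => g j x * φ x := fun j => (hg j).mul φ.continuous.measurable
  have hfin : ∑' j, ∫⁻ x, ‖g j x * φ x‖ₑ ≠ ⊤ := by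
    refine ne_top_of_le_ne_top (b := ENNReal.ofReal c *
      ∑' j, ∫⁻ x, ENNReal.ofReal (tail n x) * ‖g j x‖ₑ) (by finiteness) ?_
    rw [← ENNReal.tsum_mul_left]
    refine ENNReal.tsum_le_tsum fun j => ?_
    rw [← lintegral_const_mul' _ _ ENNReal.ofReal_ne_top]
    refine lintegral_mono fun x => ?_
    rw [enorm_mul, mul_comm, ← mul_assoc]
    gcongr
    exact hφ x
  have hsumm : Summable fun j => ∫ x, g j x * φ x := by
    refine Summable.of_enorm (ne_top_of_le_ne_top hfin (ENNReal.tsum_le_tsum fun j => ?_))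
    exact enorm_integral_le_lintegral_enorm _
  have heq : (fun x => (∑' j, g j x) * φ x) = fun x => ∑' j, g j x * φ x :=
    funext fun x => tsum_mul_right.symm
  rw [heq]
  constructor
  · refine ⟨(Measurable.tsum hm).aestronglyMeasurable, ?_⟩
    refine lt_of_le_of_lt (lintegral_mono fun x => enorm_tsum_le_tsum_enorm) ?_
    rw [lintegral_tsum fun j => (hm j).enorm.aemeasurable]
    exact hfin.lt_top
  · rw [integral_tsum (fun j => (hm j).aestronglyMeasurable) hfin, ← fracPairing_apply hσ]
    refine tendsto_nhds_unique hsumm.hasSum.tendsto_sum_nat ?_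
    have h1 := ((fracPairing hσ φ).continuous.tendsto h).comp hf
    refine h1.congr fun J => ?_
    rw [Function.comp_apply, map_sum]
    refine Finset.sum_congr rfl fun j _ => ?_
    rw [fracPairing_apply]
    exact (hfg j φ).2.symm

end Pairing

section Norm

variable {n : ℕ} {α s T σ : ℝ}

/-- The smoothing norm of a sum is at most the sum of the smoothing norms. The series need only
converge in `L²`, at each time. -/
theorem smoothingNorm_le_tsum (hσ : 0 ≤ σ) {u : CHs n s T} {w : ℕ → CHs n s T}
    (h : ∀ t, Tendsto (fun J => ∑ j ∈ Finset.range J, Hs.toL2 n s (w j t)) atTop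
      (𝓝 (Hs.toL2 n s (u t)))) :
    smoothingNorm n α s T σ u ≤ ∑' j, smoothingNorm n α s T σ (w j) := by
  refine ENNReal.le_of_forall_pos_le_add fun ε hε hlt => ?_
  obtain ⟨ε', hε', hsum⟩ := ENNReal.exists_pos_sum_of_countable
    (ENNReal.coe_ne_zero.2 hε.ne') ℕ
  have hex : ∀ j, ∃ g : ℝ → E n → ℂ, Measurable (Function.uncurry g) ∧
      Represents n s T σ (w j) g ∧
      localNorm n α T g ≤ smoothingNorm n α s T σ (w j) + ε' j := fun j => by
    have h1 : smoothingNorm n α s T σ (w j) < smoothingNorm n α s T σ (w j) + ε' j :=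
      ENNReal.lt_add_right (ENNReal.ne_top_of_tsum_ne_top hlt.ne j)
        (ENNReal.coe_ne_zero.2 (hε' j).ne')
    nth_rewrite 1 [smoothingNorm] at h1
    simp only [iInf_lt_iff] at h1
    obtain ⟨g, hg, hlg⟩ := h1
    obtain ⟨g', hm, hg', he⟩ := hg.exists_measurable (α := α)
    exact ⟨g', hm, hg', he.trans_le hlg.le⟩
  choose g hgm hgr hgl using hex
  have hloc : ∑' j, localNorm n α T (g j) ≤ ∑' j, smoothingNorm n α s T σ (w j) + ε := by
    refine (ENNReal.tsum_le_tsum hgl).trans ?_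
    rw [ENNReal.tsum_add]
    gcongr
  have hloc' : ∑' j, localNorm n α T (g j) ≠ ⊤ :=
    ne_top_of_le_ne_top (ENNReal.add_ne_top.2 ⟨hlt.ne, ENNReal.coe_ne_top⟩) hloc
  refine le_trans (iInf₂_le (fun t x => ∑' j, g j t x) ⟨?_, ?_⟩)
    ((localNorm_tsum_le hgm).trans hloc)
  · exact (Measurable.tsum hgm).aestronglyMeasurable
  · have h1 := ae_tsum_lintegral_tail_lt_top hgm hloc'
    rw [ae_restrict_iff' measurableSet_Icc] at h1
    filter_upwards [h1, ae_all_iff.2 fun j => (hgr j).2] with t h2 h3 ht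
    exact IsFracDeriv.tsum hσ (fun j => (hgm j).comp measurable_prodMk_left)
      (fun j => h3 j ht) (h ⟨t, ht⟩) (h2 ht)

theorem represents_zero : Represents n s T σ 0 fun _ _ => 0 := by
  refine ⟨(measurable_const : Measurable fun _ : ℝ × E n => (0 : ℂ)).aestronglyMeasurable,
    Eventually.of_forall fun t ht φ => ?_⟩
  have h0 : (𝓕 (Hs.toL2 n s ((0 : CHs n s T) ⟨t, ht⟩)) : L2 n) = 0 := by
    rw [ContinuousMap.zero_apply, map_zero]
    exact map_zero (Lp.fourierTransformₗᵢ (E n) ℂ)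
  rw [h0]
  simp only [zero_mul]
  refine ⟨integrable_zero _ _ _, ?_⟩
  rw [integral_zero]
  symm
  refine integral_eq_zero_of_ae ?_
  filter_upwards [Lp.coeFn_zero ℂ 2 (volume : Measure (E n))] with ξ hξ
  rw [hξ]
  simp

theorem smoothingNorm_zero : smoothingNorm n α s T σ 0 = 0 := by
  refine le_antisymm ((iInf₂_le _ represents_zero).trans (localNorm_le fun ν _ => ?_)) zero_le
  simp [timeNorm]

theorem smoothingNorm_add_le (hσ : 0 ≤ σ) (u w : CHs n s T) :
    smoothingNorm n α s T σ (u + w) ≤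
      smoothingNorm n α s T σ u + smoothingNorm n α s T σ w := by
  set f : ℕ → CHs n s T := fun j => if j = 0 then u else if j = 1 then w else 0 with hf
  have h := smoothingNorm_le_tsum (α := α) hσ (u := u + w) (w := f) fun t => ?_
  · refine h.trans (le_of_eq ?_)
    rw [tsum_eq_sum (s := Finset.range 2), Finset.sum_range_succ, Finset.sum_range_one]
    · simp [hf]
    · intro j hj
      rw [Finset.mem_range] at hj
      rw [hf]
      dsimp only
      rw [if_neg (by omega), if_neg (by omega), smoothingNorm_zero]
  · refine tendsto_atTop_of_eventually_const (i₀ := 2) fun J hJ => ?_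
    rw [← Finset.sum_subset (Finset.range_mono hJ) fun j _ hj => ?_]
    · rw [Finset.sum_range_succ, Finset.sum_range_one]
      simp [hf]
    · rw [Finset.mem_range] at hj
      rw [hf]
      dsimp only
      rw [if_neg (by omega), if_neg (by omega), ContinuousMap.zero_apply, map_zero]

theorem timeNorm_const_smul (c : ℂ) (g : ℝ → E n → ℂ) (x : E n) :
    timeNorm n α T (fun t x => c * g t x) x = ‖c‖ₑ * timeNorm n α T g x := by
  have : ∀ t : ℝ, ‖((t ^ (α / 2) : ℝ) : ℂ) * (c * g t x)‖ₑ ^ 2 =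
      ‖c‖ₑ ^ 2 * ‖((t ^ (α / 2) : ℝ) : ℂ) * g t x‖ₑ ^ 2 := fun t => by
    simp only [enorm_mul]
    ring
  unfold timeNorm
  simp only [this]
  rw [lintegral_const_mul' _ _ (by finiteness), ENNReal.mul_rpow_of_nonneg _ _ (by norm_num),
    rpow_half_sq]

theorem localNorm_const_smul (c : ℂ) (g : ℝ → E n → ℂ) :
    localNorm n α T (fun t x => c * g t x) = ‖c‖ₑ * localNorm n α T g := by
  have h : timeNorm n α T (fun t x => c * g t x) = fun x => ‖c‖ₑ * timeNorm n α T g x :=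
    funext fun x => timeNorm_const_smul c g x
  unfold localNorm
  rw [h]
  split_ifs
  · rw [ENNReal.essSup_const_mul]
  · rw [ENNReal.mul_iSup]
    refine iSup_congr fun β => ?_
    simp only [mul_pow]
    rw [lintegral_const_mul' _ _ (by finiteness), ENNReal.mul_rpow_of_nonneg _ _ (by norm_num),
      rpow_half_sq]

theorem smoothingNorm_smul_le (c : ℂ) (u : CHs n s T) :
    smoothingNorm n α s T σ (c • u) ≤ ‖c‖ₑ * smoothingNorm n α s T σ u := by
  rcases eq_or_ne c 0 with rfl | hc
  · rw [zero_smul, smoothingNorm_zero]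
    exact zero_le
  have hc' : ‖c‖ₑ ≠ 0 := by simpa using hc
  rw [mul_comm, ← ENNReal.div_le_iff_le_mul (Or.inl hc') (Or.inl (by finiteness))]
  refine le_iInf₂ fun g hg => ?_
  rw [ENNReal.div_le_iff_le_mul (Or.inl hc') (Or.inl (by finiteness)),
    mul_comm (localNorm n α T g), ← localNorm_const_smul]
  refine iInf₂_le (fun t x => c * g t x) ⟨hg.1.const_mul c, ?_⟩
  filter_upwards [hg.2] with t h1 ht φ
  obtain ⟨h2, h3⟩ := h1 ht φ
  have h0 : (𝓕 (Hs.toL2 n s ((c • u) ⟨t, ht⟩)) : L2 n) =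
      c • (𝓕 (Hs.toL2 n s (u ⟨t, ht⟩)) : L2 n) := by
    rw [ContinuousMap.smul_apply, map_smul]
    exact map_smul (Lp.fourierTransformₗᵢ (E n) ℂ) c _
  have hass : ∀ x, c * g t x * φ x = c * (g t x * φ x) := fun x => mul_assoc _ _ _
  simp only [hass]
  refine ⟨h2.const_mul c, ?_⟩
  rw [integral_const_mul, h3, ← integral_const_mul, h0]
  refine integral_congr_ae ?_
  filter_upwards [Lp.coeFn_smul c (𝓕 (Hs.toL2 n s (u ⟨t, ht⟩)) : L2 n)] with ξ hξ
  rw [hξ, Pi.smul_apply, smul_eq_mul]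
  ring

end Norm

/-! ### Local smoothing for the inhomogeneous linear equation -/

section Multiplier

variable {n : ℕ} {s : ℝ} (hs : 0 ≤ s)

theorem UnitSymbol.mulHs_add_mulHs {m₁ m₂ m : UnitSymbol n} (h : ∀ ξ, m₁ ξ + m₂ ξ = m ξ)
    (f : Hs n s) : m₁.mulHs hs f + m₂.mulHs hs f = m.mulHs hs f := by
  apply Hs.weighted_injective n s
  rw [map_add]
  simp only [UnitSymbol.weighted_mulHs]
  refine Lp.ext ?_
  filter_upwards [Lp.coeFn_add (m₁.mulL2 (Hs.weighted n s f)) (m₂.mulL2 (Hs.weighted n s f)),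
    m₁.coeFn_mulL2 (Hs.weighted n s f), m₂.coeFn_mulL2 (Hs.weighted n s f),
    m.coeFn_mulL2 (Hs.weighted n s f)] with ξ h1 h2 h3 h4
  rw [h1, Pi.add_apply, h2, h3, h4, ← h ξ, add_mul]

theorem UnitSymbol.mulHs_mulHs {m₁ m₂ m : UnitSymbol n} (h : ∀ ξ, m₁ ξ * m₂ ξ = m ξ)
    (f : Hs n s) : m₁.mulHs hs (m₂.mulHs hs f) = m.mulHs hs f := by
  apply Hs.weighted_injective n s
  simp only [UnitSymbol.weighted_mulHs]
  refine Lp.ext ?_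
  filter_upwards [m₁.coeFn_mulL2 (m₂.mulL2 (Hs.weighted n s f)),
    m₂.coeFn_mulL2 (Hs.weighted n s f), m.coeFn_mulL2 (Hs.weighted n s f)] with ξ h1 h2 h3
  rw [h1, h2, h3, ← h ξ, mul_assoc]

theorem UnitSymbol.mulHs_one {m : UnitSymbol n} (h : ∀ ξ, m ξ = 1) (f : Hs n s) :
    m.mulHs hs f = f := by
  apply Hs.weighted_injective n s
  rw [UnitSymbol.weighted_mulHs]
  refine Lp.ext ?_
  filter_upwards [m.coeFn_mulL2 (Hs.weighted n s f)] with ξ h1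
  rw [h1, h ξ, one_mul]

theorem band_apply {A : Set (E n)} (hA : MeasurableSet A) (ξ : E n) :
    band hA ξ = A.indicator (fun _ => 1) ξ := rfl

theorem norm_band_mulHs_le {A B : Set (E n)} (hA : MeasurableSet A) (hB : MeasurableSet B) (h : A ⊆ B)
    (f : Hs n s) : ‖(band hA).mulHs hs f‖ ≤ ‖(band hB).mulHs hs f‖ := by
  rw [← UnitSymbol.mulHs_mulHs hs (m₁ := band hA) (m₂ := band hB) (m := band hA) (fun ξ => ?_) f]
  · exact UnitSymbol.norm_mulHs_le hs _ _
  · simp only [band_apply]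
    by_cases hξ : ξ ∈ A
    · simp [hξ, h hξ]
    · simp [hξ]

theorem band_add_band {A B D : Set (E n)} (hA : MeasurableSet A) (hB : MeasurableSet B)
    (hD : MeasurableSet D) (hd : Disjoint A B) (h : A ∪ B = D) (f : Hs n s) :
    (band hA).mulHs hs f + (band hB).mulHs hs f = (band hD).mulHs hs f := by
  refine UnitSymbol.mulHs_add_mulHs hs (fun ξ => ?_) f
  simp only [band_apply]
  rw [← h, Set.indicator_union_of_disjoint hd]

theorem tendsto_band_ball (f : Hs n s) :
    Tendsto (fun j : ℕ => (band (measurableSet_ball : MeasurableSet (Metric.ball (0 : E n) j))).mulHs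
      hs f) atTop (𝓝 f) := by
  have h1 := UnitSymbol.tendsto_mulL2 (l := atTop)
    (fun j : ℕ => band (measurableSet_ball : MeasurableSet (Metric.ball (0 : E n) j)))
    (band MeasurableSet.univ) (fun ξ => ?_) (Hs.weighted n s f)
  · have h2 := ((Hs.weightedEquiv n hs).symm.continuous.tendsto _).comp h1
    have h3 : (Hs.weightedEquiv n hs).symm ((band MeasurableSet.univ).mulL2
        (Hs.weighted n s f)) = f := UnitSymbol.mulHs_one hs (fun ξ => by simp [band_apply]) f
    rw [h3] at h2
    exact h2
  · obtain ⟨N, hN⟩ := exists_nat_gt ‖ξ‖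
    refine tendsto_atTop_of_eventually_const (i₀ := N) fun j hj => ?_
    have : ‖ξ‖ < (j : ℝ) := hN.trans_le (by exact_mod_cast hj)
    simp [band_apply, this]

theorem tendsto_norm_band_compl_ball (f : Hs n s) :
    Tendsto (fun j : ℕ => ENNReal.ofReal ‖(band (measurableSet_ball :
      MeasurableSet (Metric.ball (0 : E n) j)).compl).mulHs hs f‖) atTop (𝓝 0) := by
  have h1 : ∀ j : ℕ, (band (measurableSet_ball :
      MeasurableSet (Metric.ball (0 : E n) j)).compl).mulHs hs f =
      f - (band (measurableSet_ball : MeasurableSet (Metric.ball (0 : E n) j))).mulHs hs f :=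
    fun j => by
      rw [eq_sub_iff_add_eq', band_add_band hs _ _ MeasurableSet.univ
        disjoint_compl_right (Set.union_compl_self _)]
      exact UnitSymbol.mulHs_one hs (fun ξ => by simp [band_apply]) f
  simp only [h1]
  have h2 := ((tendsto_const_nhds (x := f)).sub (tendsto_band_ball hs f)).norm
  rw [sub_self, norm_zero] at h2
  have h3 := ENNReal.tendsto_ofReal h2
  rwa [ENNReal.ofReal_zero] at h3

end Multiplier

/-- The local smoothing estimate for the inhomogeneous linear equation. -/
theorem exists_smoothingNorm_le {n : ℕ} (hn : 1 ≤ n) (v : E n) :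
    ∃ C : ℝ≥0∞, C ≠ ⊤ ∧ ∀ {α s T : ℝ} (_ : 0 < α) (hs : 0 ≤ s) (hT : 0 ≤ T) (_ : T ≤ 1)
      {u₀ : Hs n s} {F u : CHs n s T}, IsDuhamel hs hT α v u₀ F u →
      smoothingNorm n α s T (s + 1 / 2) u ≤
        C * (ENNReal.ofReal ‖u₀‖ +
          ∫⁻ τ in Set.Icc (0 : ℝ) T, ENNReal.ofReal ‖F (Set.projIcc 0 T hT τ)‖) := by
  obtain ⟨C, hC, hCu⟩ := exists_smoothingNorm_band_le hn v
  refine ⟨C, hC, fun {α s T} hα hs hT hT1 {u₀ F u} hu => ?_⟩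
  have hball : ∀ j : ℕ, MeasurableSet (Metric.ball (0 : E n) j) := fun j => measurableSet_ball
  have hcF : Continuous fun τ : ℝ => F (Set.projIcc 0 T hT τ) :=
    F.continuous.comp continuous_projIcc
  set Θ : {A : Set (E n) // MeasurableSet A} → ℝ≥0∞ := fun A =>
    ENNReal.ofReal ‖(band A.2).mulHs hs u₀‖ + ∫⁻ τ in Set.Icc (0 : ℝ) T,
      ENNReal.ofReal ‖(band A.2).mulHs hs (F (Set.projIcc 0 T hT τ))‖ with hΘ
  have hmono : ∀ A B : {A : Set (E n) // MeasurableSet A}, A.1 ⊆ B.1 → Θ A ≤ Θ B := by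
    intro A B hAB
    exact add_le_add (ENNReal.ofReal_le_ofReal (norm_band_mulHs_le hs A.2 B.2 hAB _))
      (lintegral_mono fun τ => ENNReal.ofReal_le_ofReal (norm_band_mulHs_le hs A.2 B.2 hAB _))
  have hle : ∀ A : {A : Set (E n) // MeasurableSet A}, Θ A ≤ ENNReal.ofReal ‖u₀‖ +
      ∫⁻ τ in Set.Icc (0 : ℝ) T, ENNReal.ofReal ‖F (Set.projIcc 0 T hT τ)‖ := fun A =>
    add_le_add (ENNReal.ofReal_le_ofReal (UnitSymbol.norm_mulHs_le hs _ _))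
      (lintegral_mono fun τ => ENNReal.ofReal_le_ofReal (UnitSymbol.norm_mulHs_le hs _ _))
  have hFfin : ∫⁻ τ in Set.Icc (0 : ℝ) T, ENNReal.ofReal ‖F (Set.projIcc 0 T hT τ)‖ ≠ ⊤ := by
    refine ne_top_of_le_ne_top (b := ∫⁻ τ in Set.Icc (0 : ℝ) T, ENNReal.ofReal ‖F‖) ?_
      (lintegral_mono fun τ => ENNReal.ofReal_le_ofReal (F.norm_coe_le_norm _))
    rw [setLIntegral_const, Real.volume_Icc]
    finiteness
  -- the high frequencies contribute little
  have htail : Tendsto (fun j : ℕ => Θ ⟨_, (hball j).compl⟩) atTop (𝓝 0) := by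
    have h1 : Tendsto (fun j : ℕ => ∫⁻ τ in Set.Icc (0 : ℝ) T, ENNReal.ofReal
        ‖(band (hball j).compl).mulHs hs (F (Set.projIcc 0 T hT τ))‖) atTop
        (𝓝 (∫⁻ _ in Set.Icc (0 : ℝ) T, 0)) := by
      refine tendsto_lintegral_of_dominated_convergence
        (fun τ => ENNReal.ofReal ‖F (Set.projIcc 0 T hT τ)‖) (fun j => ?_)
        (fun j => Eventually.of_forall fun τ =>
          ENNReal.ofReal_le_ofReal (UnitSymbol.norm_mulHs_le hs _ _)) hFfin
        (Eventually.of_forall fun τ => tendsto_norm_band_compl_ball hs _)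
      exact (((band (hball j).compl).mulHs hs).continuous.comp
        hcF).norm.measurable.ennreal_ofReal
    rw [lintegral_zero] at h1
    have h2 := (tendsto_norm_band_compl_ball hs u₀).add h1
    rw [add_zero] at h2
    exact h2
  refine ENNReal.le_of_forall_pos_le_add fun ε hε hlt => ?_
  obtain ⟨δ, hδ, hCδ⟩ : ∃ δ : ℝ≥0∞, δ ≠ 0 ∧ C * δ ≤ ε := by
    rcases eq_or_ne C 0 with h0 | h0
    · exact ⟨1, one_ne_zero, by simp [h0]⟩
    · refine ⟨ε / C, (ENNReal.div_pos (ENNReal.coe_ne_zero.2 hε.ne') hC).ne', ?_⟩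
      rw [ENNReal.mul_div_cancel h0 hC]
  obtain ⟨ε', hε', hsum⟩ := ENNReal.exists_pos_sum_of_countable hδ ℕ
  obtain ⟨φ, hφ, hφε⟩ := extraction_forall_of_eventually' (P := fun k j =>
      Θ ⟨_, (hball j).compl⟩ ≤ ε' k) fun k =>
    eventually_atTop.1 (htail.eventually_le_const (ENNReal.coe_pos.2 (hε' k)))
  -- a ball and successive shells
  set A : ℕ → {A : Set (E n) // MeasurableSet A} := fun k => Nat.casesOn k ⟨_, hball (φ 0)⟩
    fun k => ⟨_, (hball (φ (k + 1))).diff (hball (φ k))⟩ with hA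
  have hAb : ∀ k, Bornology.IsBounded (A k).1 := fun k => by
    cases k with
    | zero => exact Metric.isBounded_ball
    | succ k => exact Metric.isBounded_ball.subset Set.sdiff_subset
  have hpart : ∀ (J : ℕ) (f : Hs n s), ∑ j ∈ Finset.range (J + 1), (band (A j).2).mulHs hs f =
      (band (hball (φ J))).mulHs hs f := by
    intro J f
    induction J with
    | zero => rw [Finset.sum_range_one]
    | succ J ih =>
      rw [Finset.sum_range_succ, ih]
      refine band_add_band hs _ _ _ Set.disjoint_sdiff_right ?_ f
      exact Set.union_sdiff_cancel (Metric.ball_subset_ball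
        (by exact_mod_cast (hφ J.lt_succ_self).le))
  have hseries : ∀ t, Tendsto (fun J => ∑ j ∈ Finset.range J,
      Hs.toL2 n s ((band (A j).2).mulCHs hs u t)) atTop (𝓝 (Hs.toL2 n s (u t))) := by
    intro t
    rw [← tendsto_add_atTop_iff_nat 1]
    have h1 := ((Hs.toL2CLM n hs).continuous.tendsto (u t)).comp
      ((tendsto_band_ball hs (u t)).comp hφ.tendsto_atTop)
    refine h1.congr fun J => ?_
    simp only [UnitSymbol.mulCHs_apply, Function.comp_apply]
    rw [← map_sum, hpart, Hs.toL2CLM_apply]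
  have hN := smoothingNorm_le_tsum (α := α) (by linarith : (0 : ℝ) ≤ s + 1 / 2) hseries
  calc _ ≤ ∑' j, C * Θ (A j) :=
        hN.trans (ENNReal.tsum_le_tsum fun j => hCu hα hs hT hT1 (A j).2 (hAb j) hu)
    _ = C * (Θ (A 0) + ∑' k, Θ (A (k + 1))) := by
        rw [ENNReal.tsum_mul_left, tsum_eq_zero_add' ENNReal.summable]
    _ ≤ C * ((ENNReal.ofReal ‖u₀‖ +
        ∫⁻ τ in Set.Icc (0 : ℝ) T, ENNReal.ofReal ‖F (Set.projIcc 0 T hT τ)‖) + δ) := by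
        refine mul_le_mul_right (add_le_add (hle (A 0)) ?_) C
        refine le_trans (ENNReal.tsum_le_tsum fun k => ?_) hsum.le
        refine le_trans (hmono _ ⟨_, (hball (φ k)).compl⟩ ?_) (hφε k)
        exact fun ξ hξ => hξ.2
    _ ≤ _ := by
        rw [mul_add]
        gcongr

/-! ### The Banach space of curves with finite smoothing norm -/

section SmoothSpace

variable {n : ℕ} {α s T σ : ℝ}

/-- The curves in `H^s` with finite smoothing norm. -/
def smoothSubmodule (n : ℕ) (α s T : ℝ) {σ : ℝ} (hσ : 0 ≤ σ) : Submodule ℂ (CHs n s T) where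
  carrier := {u | smoothingNorm n α s T σ u < ⊤}
  zero_mem' := by
    rw [Set.mem_ofPred_eq, smoothingNorm_zero]
    exact ENNReal.zero_lt_top
  add_mem' hu hw := (smoothingNorm_add_le hσ _ _).trans_lt (ENNReal.add_lt_top.2 ⟨hu, hw⟩)
  smul_mem' c _ hu := (smoothingNorm_smul_le c _).trans_lt
    (ENNReal.mul_lt_top enorm_lt_top hu)

/-- The curves in `H^s` with finite smoothing norm, as a type that carries the sum of the supremum
norm and the smoothing norm. -/
def SmoothSpace (n : ℕ) (α s T : ℝ) {σ : ℝ} (hσ : 0 ≤ σ) : Type := ↥(smoothSubmodule n α s T hσ)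

noncomputable instance (hσ : 0 ≤ σ) : AddCommGroup (SmoothSpace n α s T hσ) :=
  inferInstanceAs (AddCommGroup ↥(smoothSubmodule n α s T hσ))

noncomputable instance (hσ : 0 ≤ σ) : Module ℂ (SmoothSpace n α s T hσ) :=
  inferInstanceAs (Module ℂ ↥(smoothSubmodule n α s T hσ))

/-- The inclusion in the space of all continuous curves. -/
noncomputable def SmoothSpace.toCHs (hσ : 0 ≤ σ) : SmoothSpace n α s T hσ →ₗ[ℂ] CHs n s T :=
  (smoothSubmodule n α s T hσ).subtype

theorem SmoothSpace.toCHs_injective (hσ : 0 ≤ σ) :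
    Function.Injective (SmoothSpace.toCHs (n := n) (α := α) (s := s) (T := T) hσ) :=
  Subtype.val_injective

theorem SmoothSpace.smoothingNorm_lt_top (hσ : 0 ≤ σ) (x : SmoothSpace n α s T hσ) :
    smoothingNorm n α s T σ (SmoothSpace.toCHs hσ x) < ⊤ := x.2

/-- A curve with finite smoothing norm, as an element of the space of such curves. -/
def SmoothSpace.mk (hσ : 0 ≤ σ) (u : CHs n s T) (hu : smoothingNorm n α s T σ u < ⊤) :
    SmoothSpace n α s T hσ := (⟨u, hu⟩ : ↥(smoothSubmodule n α s T hσ))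

theorem SmoothSpace.toCHs_mk (hσ : 0 ≤ σ) (u : CHs n s T)
    (hu : smoothingNorm n α s T σ u < ⊤) :
    SmoothSpace.toCHs hσ (SmoothSpace.mk hσ u hu) = u := rfl

theorem smoothingNorm_neg_le (u : CHs n s T) :
    smoothingNorm n α s T σ (-u) ≤ smoothingNorm n α s T σ u := by
  have := smoothingNorm_smul_le (α := α) (σ := σ) (-1) u
  rwa [neg_one_smul, enorm_neg, enorm_one, one_mul] at this

noncomputable instance (hσ : 0 ≤ σ) : NormedAddCommGroup (SmoothSpace n α s T hσ) :=
  AddGroupNorm.toNormedAddCommGroup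
    { toFun := fun x => ‖SmoothSpace.toCHs hσ x‖ +
        (smoothingNorm n α s T σ (SmoothSpace.toCHs hσ x)).toReal
      map_zero' := by
        rw [map_zero, smoothingNorm_zero, norm_zero, ENNReal.toReal_zero, add_zero]
      add_le' := fun x y => by
        have h1 := norm_add_le (SmoothSpace.toCHs hσ x) (SmoothSpace.toCHs hσ y)
        have h2 := ENNReal.toReal_mono (ENNReal.add_ne_top.2
          ⟨(x.smoothingNorm_lt_top hσ).ne, (y.smoothingNorm_lt_top hσ).ne⟩)
          (smoothingNorm_add_le (α := α) hσ (SmoothSpace.toCHs hσ x) (SmoothSpace.toCHs hσ y))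
        rw [ENNReal.toReal_add (x.smoothingNorm_lt_top hσ).ne (y.smoothingNorm_lt_top hσ).ne]
          at h2
        rw [map_add]
        linarith
      neg' := fun x => by
        rw [map_neg, norm_neg, le_antisymm (smoothingNorm_neg_le (SmoothSpace.toCHs hσ x))]
        simpa using smoothingNorm_neg_le (α := α) (σ := σ) (-SmoothSpace.toCHs hσ x)
      eq_zero_of_map_eq_zero' := fun x hx => by
        have h1 : ‖SmoothSpace.toCHs hσ x‖ = 0 :=
          ((add_eq_zero_iff_of_nonneg (norm_nonneg _) ENNReal.toReal_nonneg).1 hx).1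
        rw [norm_eq_zero] at h1
        exact SmoothSpace.toCHs_injective hσ (h1.trans (map_zero _).symm) }

theorem SmoothSpace.norm_def (hσ : 0 ≤ σ) (x : SmoothSpace n α s T hσ) :
    ‖x‖ = ‖SmoothSpace.toCHs hσ x‖ +
      (smoothingNorm n α s T σ (SmoothSpace.toCHs hσ x)).toReal := rfl

noncomputable instance (hσ : 0 ≤ σ) : NormedSpace ℂ (SmoothSpace n α s T hσ) where
  norm_smul_le c x := by
    rw [SmoothSpace.norm_def, SmoothSpace.norm_def, map_smul, norm_smul, mul_add]
    have h := ENNReal.toReal_mono (ENNReal.mul_ne_top enorm_ne_top (x.smoothingNorm_lt_top hσ).ne)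
      (smoothingNorm_smul_le (α := α) (σ := σ) c (SmoothSpace.toCHs hσ x))
    rw [ENNReal.toReal_mul, toReal_enorm] at h
    gcongr

/-- The continuous inclusion in the space of all continuous curves. -/
noncomputable def SmoothSpace.toCHsL (hσ : 0 ≤ σ) : SmoothSpace n α s T hσ →L[ℂ] CHs n s T :=
  (SmoothSpace.toCHs hσ).mkContinuous 1 fun x => by
    rw [one_mul, SmoothSpace.norm_def]
    exact le_add_of_nonneg_right ENNReal.toReal_nonneg

theorem SmoothSpace.ofReal_norm (hσ : 0 ≤ σ) (x : SmoothSpace n α s T hσ) :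
    ENNReal.ofReal ‖x‖ = ENNReal.ofReal ‖SmoothSpace.toCHs hσ x‖ +
      smoothingNorm n α s T σ (SmoothSpace.toCHs hσ x) := by
  rw [SmoothSpace.norm_def, ENNReal.ofReal_add (norm_nonneg _) ENNReal.toReal_nonneg,
    ENNReal.ofReal_toReal (x.smoothingNorm_lt_top hσ).ne]

theorem smoothingNorm_le_tsum_of_hasSum (hs : 0 ≤ s) (hσ : 0 ≤ σ) {u : CHs n s T}
    {w : ℕ → CHs n s T} (h : HasSum w u) :
    smoothingNorm n α s T σ u ≤ ∑' j, smoothingNorm n α s T σ (w j) := by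
  refine smoothingNorm_le_tsum hσ fun t => ?_
  have h1 := (((Hs.toL2CLM n hs).continuous.comp
    (continuous_eval_const t)).tendsto u).comp h.tendsto_sum_nat
  refine h1.congr fun J => ?_
  simp only [Function.comp_apply]
  rw [ContinuousMap.sum_apply, Hs.toL2CLM_apply, map_sum]

/-- Absolutely convergent series converge, by the countable subadditivity of the smoothing norm. -/
theorem SmoothSpace.completeSpace (hs : 0 ≤ s) (hσ : 0 ≤ σ) :
    CompleteSpace (SmoothSpace n α s T hσ) := by
  have := Hs.completeSpace (n := n) hs
  refine NormedAddCommGroup.completeSpace_of_summable_imp_tendsto fun x hx => ?_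
  set w : ℕ → CHs n s T := fun j => SmoothSpace.toCHs hσ (x j) with hw
  have h1 : Summable fun j => ‖w j‖ := hx.of_nonneg_of_le (fun j => norm_nonneg _) fun j =>
    le_add_of_nonneg_right ENNReal.toReal_nonneg
  have h2 : ∑' j, smoothingNorm n α s T σ (w j) ≠ ⊤ := by
    refine ne_top_of_le_ne_top hx.tsum_ofReal_ne_top (ENNReal.tsum_le_tsum fun j => ?_)
    rw [SmoothSpace.ofReal_norm]
    exact le_add_self
  obtain ⟨a, ha⟩ := h1.of_norm
  have haN : smoothingNorm n α s T σ a < ⊤ :=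
    (smoothingNorm_le_tsum_of_hasSum hs hσ ha).trans_lt h2.lt_top
  refine ⟨SmoothSpace.mk hσ a haN, ?_⟩
  rw [tendsto_iff_norm_sub_tendsto_zero]
  have hsub : ∀ J, ‖∑ i ∈ Finset.range J, x i - SmoothSpace.mk hσ a haN‖ ≤
      ‖∑ i ∈ Finset.range J, w i - a‖ + (∑' k, smoothingNorm n α s T σ (w (k + J))).toReal := by
    intro J
    rw [norm_sub_rev, norm_sub_rev (∑ i ∈ Finset.range J, w i), SmoothSpace.norm_def, map_sub,
      map_sum, SmoothSpace.toCHs_mk]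
    have h3 := smoothingNorm_le_tsum_of_hasSum (α := α) hs hσ ((hasSum_nat_add_iff' J).2 ha)
    refine add_le_add le_rfl (ENNReal.toReal_mono ?_ h3)
    exact ne_top_of_le_ne_top h2 (ENNReal.tsum_comp_le_tsum_of_injective
      (add_left_injective J) _)
  have h3 : Tendsto (fun J => ‖∑ i ∈ Finset.range J, w i - a‖ +
      (∑' k, smoothingNorm n α s T σ (w (k + J))).toReal) atTop (𝓝 0) := by
    have h4 := tendsto_iff_norm_sub_tendsto_zero.1 ha.tendsto_sum_nat
    have h5 := (ENNReal.tendsto_toReal ENNReal.zero_ne_top).comp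
      (ENNReal.tendsto_sum_nat_add (fun j => smoothingNorm n α s T σ (w j)) h2)
    simpa using h4.add h5
  exact squeeze_zero (fun J => norm_nonneg _) hsub h3

end SmoothSpace

/-! ### The estimates for solutions -/

/-- If the source has total mass at most `‖u₀‖`, then a linear estimate in terms of the datum and
the source is an estimate by the datum alone. -/
theorem le_ofReal_of_source_le {n : ℕ} {s T : ℝ} (hT : 0 < T) {u₀ : Hs n s} {F : CHs n s T}
    (hF : ∀ t, T * ‖F t‖ ≤ ‖u₀‖) {C N : ℝ≥0∞} (hC : C ≠ ⊤)
    (h : N ≤ C * (ENNReal.ofReal ‖u₀‖ +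
      ∫⁻ τ in Set.Icc (0 : ℝ) T, ENNReal.ofReal ‖F (Set.projIcc 0 T hT.le τ)‖)) :
    N ≤ ENNReal.ofReal ((2 * C.toReal + 1) * ‖u₀‖) := by
  have h1 : ∫⁻ τ in Set.Icc (0 : ℝ) T, ENNReal.ofReal ‖F (Set.projIcc 0 T hT.le τ)‖ ≤
      ENNReal.ofReal ‖u₀‖ := by
    calc _ ≤ ∫⁻ τ in Set.Icc (0 : ℝ) T, ENNReal.ofReal (‖u₀‖ / T) := by
          refine lintegral_mono fun τ => ENNReal.ofReal_le_ofReal ?_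
          rw [le_div_iff₀ hT, mul_comm]
          exact hF _
      _ = _ := by
          rw [setLIntegral_const, Real.volume_Icc, sub_zero, ← ENNReal.ofReal_mul (by positivity),
            div_mul_cancel₀ _ hT.ne']
  calc N ≤ C * (ENNReal.ofReal ‖u₀‖ + ENNReal.ofReal ‖u₀‖) := h.trans (by gcongr)
    _ = ENNReal.ofReal (2 * C.toReal * ‖u₀‖) := by
        rw [← two_mul, mul_assoc 2, ENNReal.ofReal_mul zero_le_two,
          ENNReal.ofReal_mul ENNReal.toReal_nonneg, ENNReal.ofReal_toReal hC,
          ENNReal.ofReal_ofNat]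
        ring
    _ ≤ _ := ENNReal.ofReal_le_ofReal (by nlinarith [norm_nonneg u₀])

section Inclusion

variable {n : ℕ} {s : ℝ}

/-- The inclusion of `H^s` in `H^0 = L²`. The latter is the type `Hs n 0`, to which the linear
estimate applies. -/
noncomputable def Hs.toZero (n : ℕ) {s : ℝ} (hs : 0 ≤ s) : Hs n s →L[ℂ] Hs n 0 :=
  (Hs.weightedEquiv n le_rfl).symm.toContinuousLinearEquiv.toContinuousLinearMap.comp
    ((Lp.fourierTransformₗᵢ (E n) ℂ).toContinuousLinearEquiv.toContinuousLinearMap.comp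
      (Hs.toL2CLM n hs))

theorem Hs.weighted_zero (f : Hs n 0) : Hs.weighted n 0 f = (𝓕 (Hs.toL2 n 0 f) : L2 n) := by
  refine Lp.ext ?_
  filter_upwards [f.coeFn_weighted] with ξ hξ
  rw [hξ]
  simp [japanese]

theorem Hs.toL2_toZero (hs : 0 ≤ s) (f : Hs n s) :
    Hs.toL2 n 0 (Hs.toZero n hs f) = Hs.toL2 n s f := by
  apply (Lp.fourierTransformₗᵢ (E n) ℂ).injective
  have h1 : Hs.weighted n 0 (Hs.toZero n hs f) = (𝓕 (Hs.toL2 n s f) : L2 n) :=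
    (Hs.weightedEquiv n le_rfl).apply_symm_apply _
  rw [Hs.weighted_zero] at h1
  exact h1

theorem Hs.norm_toZero (hs : 0 ≤ s) (f : Hs n s) : ‖Hs.toZero n hs f‖ = ‖Hs.toL2 n s f‖ := by
  rw [Hs.norm_def, Hs.weighted_zero, Hs.toL2_toZero]
  exact (Lp.fourierTransformₗᵢ (E n) ℂ).norm_map _

theorem Hs.toZero_group (hs : 0 ≤ s) (v : E n) (r : ℝ) (f : Hs n s) :
    Hs.toZero n hs (group hs v r f) = group le_rfl v r (Hs.toZero n hs f) := by
  apply Hs.toL2_injective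
  apply (Lp.fourierTransformₗᵢ (E n) ℂ).injective
  rw [Hs.toL2_toZero]
  have h : (𝓕 (Hs.toL2 n s (group hs v r f)) : L2 n) =
      𝓕 (Hs.toL2 n 0 (group le_rfl v r (Hs.toZero n hs f))) := by
    unfold group
    rw [UnitSymbol.fourier_mulHs, UnitSymbol.fourier_mulHs, Hs.toL2_toZero]
  exact h

/-- Curves in `H^s` as curves in `H^0 = L²`. -/
noncomputable def curveToZero {T : ℝ} (hs : 0 ≤ s) (u : CHs n s T) : CHs n 0 T :=
  ⟨fun t => Hs.toZero n hs (u t), by fun_prop⟩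

theorem IsDuhamel.toZero {T : ℝ} {hs : 0 ≤ s} {hT : 0 ≤ T} {α : ℝ} (hα : 0 < α) {v : E n}
    {u₀ : Hs n s} {F u : CHs n s T} (h : IsDuhamel hs hT α v u₀ F u) :
    IsDuhamel le_rfl hT α v (Hs.toZero n hs u₀) (curveToZero hs F) (curveToZero hs u) := by
  intro t
  have := Hs.completeSpace (n := n) hs
  have := Hs.completeSpace (n := n) (le_refl (0 : ℝ))
  change Hs.toZero n hs (u t) = _
  rw [h t, map_add, ← ContinuousLinearMap.intervalIntegral_comp_comm _
    ((continuous_duhamel_integrand hs hT hα v F t).intervalIntegrable _ _), Hs.toZero_group]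
  congr 1
  refine intervalIntegral.integral_congr fun τ _ => ?_
  exact Hs.toZero_group hs v _ _

/-- The smoothing norm does not depend on the Sobolev space in which a curve is considered. -/
theorem smoothingNorm_curveToZero {T : ℝ} (hs : 0 ≤ s) (α σ : ℝ) (u : CHs n s T) :
    smoothingNorm n α 0 T σ (curveToZero hs u) = smoothingNorm n α s T σ u := by
  have h : ∀ t, Hs.toL2 n 0 (curveToZero hs u t) = Hs.toL2 n s (u t) := fun t =>
    Hs.toL2_toZero hs (u t)
  unfold smoothingNorm Represents
  simp only [h]

end Inclusion

end DegenerateNLS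

open DegenerateNLS in
theorem theorem3 (n : ℕ) (hn : 1 ≤ n) (α : ℝ) (hα : 0 < α) (v : EuclideanSpace ℝ (Fin n))
    (k : ℕ) (hk : 1 ≤ k) (μ : ℂ) (s : ℝ) (hs : (n : ℝ) / 2 < s) :
    ∃ C : ℝ, 0 < C ∧
      -- every ball of `H^s` has a time of existence `T` and a Banach space `X`
      ∀ (f₀ : Hs n s) (ρ : ℝ), ∃ T : ℝ, 0 < T ∧
        ∃ (X : Type) (_ : NormedAddCommGroup X) (_ : NormedSpace ℂ X) (_ : CompleteSpace X)
          (ι : X →L[ℂ] CHs n s T),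
          Function.Injective ι ∧
          -- `X` consists of the `u ∈ C([0,T], H^s)` with finite smoothing norm
          (∀ u : CHs n s T, u ∈ Set.range ι ↔ smoothingNorm n α s T (s + 1 / 2) u < ⊤) ∧
          (∀ x : X, ENNReal.ofReal ‖x‖ =
            ENNReal.ofReal ‖ι x‖ + smoothingNorm n α s T (s + 1 / 2) (ι x)) ∧
          ∃ S : Metric.ball f₀ ρ → X,
            -- existence and uniqueness
            (∀ u₀ : Metric.ball f₀ ρ,
              IsMildSolution n α v k μ s T u₀ (ι (S u₀))) ∧
            (∀ (u₀ : Metric.ball f₀ ρ) (w : X),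
              IsMildSolution n α v k μ s T u₀ (ι w) → w = S u₀) ∧
            -- continuous dependence on the datum
            Continuous (fun u₀ => ι (S u₀)) ∧
            -- smoothing estimates
            (∀ u₀ : Metric.ball f₀ ρ, smoothingNorm n α s T (s + 1 / 2) (ι (S u₀)) ≤
              ENNReal.ofReal (C * ‖(u₀ : Hs n s)‖)) ∧
            (∀ u₀ : Metric.ball f₀ ρ, smoothingNorm n α s T (1 / 2) (ι (S u₀)) ≤
              ENNReal.ofReal (C * ‖Hs.toL2 n s (u₀ : Hs n s)‖)) := by
  have hs0 : 0 ≤ s := le_trans (by positivity) hs.le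
  have hσ : 0 ≤ s + 1 / 2 := by linarith
  obtain ⟨C, hC, hCu⟩ := exists_smoothingNorm_le hn v
  refine ⟨2 * C.toReal + 1, by positivity, fun f₀ ρ => ?_⟩
  obtain ⟨T, hT, hT1, S, hsol, huniq, hcont, hsrc⟩ :=
    exists_flow hs hs0 hα v k μ (‖f₀‖ + |ρ|)
  have hball : ∀ u₀ : Metric.ball f₀ ρ, ‖(u₀ : Hs n s)‖ ≤ ‖f₀‖ + |ρ| := fun u₀ => by
    have h1 := norm_le_norm_add_norm_sub' (u₀ : Hs n s) f₀
    have h2 : ‖(u₀ : Hs n s) - f₀‖ < ρ := mem_ball_iff_norm.1 u₀.2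
    linarith [le_abs_self ρ]
  have hest : ∀ u₀ : Metric.ball f₀ ρ, smoothingNorm n α s T (s + 1 / 2) (S u₀) ≤
      ENNReal.ofReal ((2 * C.toReal + 1) * ‖(u₀ : Hs n s)‖) := fun u₀ => by
    obtain ⟨F, hF, hF1, -⟩ := hsrc u₀ (hball u₀)
    refine le_ofReal_of_source_le hT (F := F) (fun t => ?_) hC (hCu hα hs0 hT.le hT1 hF)
    exact le_trans (mul_le_mul_of_nonneg_left (F.norm_coe_le_norm t) hT.le) hF1
  have hest0 : ∀ u₀ : Metric.ball f₀ ρ, smoothingNorm n α s T (1 / 2) (S u₀) ≤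
      ENNReal.ofReal ((2 * C.toReal + 1) * ‖Hs.toL2 n s (u₀ : Hs n s)‖) := fun u₀ => by
    obtain ⟨F, hF, -, hF0⟩ := hsrc u₀ (hball u₀)
    -- the estimate in `L²` is the linear estimate at regularity zero
    have h1 := hCu hα le_rfl hT.le hT1 (hF.toZero hα)
    rw [zero_add, smoothingNorm_curveToZero] at h1
    rw [← Hs.norm_toZero hs0]
    refine le_ofReal_of_source_le hT (F := curveToZero hs0 F) (fun t => ?_) hC h1
    rw [Hs.norm_toZero]
    change T * ‖Hs.toZero n hs0 (F t)‖ ≤ _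
    rw [Hs.norm_toZero]
    exact hF0 t
  refine ⟨T, hT, SmoothSpace n α s T hσ, inferInstance, inferInstance,
    SmoothSpace.completeSpace hs0 hσ, SmoothSpace.toCHsL hσ, SmoothSpace.toCHs_injective hσ,
    fun u => ⟨?_, fun hu => ⟨SmoothSpace.mk hσ u hu, rfl⟩⟩,
    SmoothSpace.ofReal_norm hσ,
    fun u₀ => SmoothSpace.mk hσ (S u₀) ((hest u₀).trans_lt ENNReal.ofReal_lt_top),
    fun u₀ => hsol u₀ (hball u₀), fun u₀ w hw => ?_, ?_, hest, hest0⟩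
  · rintro ⟨x, rfl⟩
    exact x.smoothingNorm_lt_top hσ
  · exact SmoothSpace.toCHs_injective hσ (huniq u₀ (hball u₀) _ hw)
  · exact hcont.comp_continuous continuous_subtype_val fun u₀ =>
      mem_closedBall_zero_iff.2 (hball u₀)
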